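/- Let $k$ be a field. A finite abelian category is a $k$-linear abelian category that is $k$-linearly equivalent to the category of finite-dimensional left modules over a finite-dimensional $k$-algebra. Let $\mathcal{C}$ be a finite multi-tensor category, i.e. a finite abelian category with a rigid monoidal structure whose tensor product is bilinear. A finite left (right) $\mathcal{C}$-module category is a finite abelian category with a left (right) action $\triangleright$ ($\triangleleft$) of $\mathcal{C}$ that is linear and right exact in each variable; a finite $\mathcal{C}$-bimodule category has both, together with coherent natural isomorphisms $(X\triangleright M)\triangleleft Y\cong X\triangleright(M\triangleleft Y)$. We write $X^\vee$ for the left dual of $X\in\mathcal{C}$, with $\mathrm{ev}:X^\vee\otimes X\to 1$ and $\mathrm{coev}:1\to X\otimes X^\vee$, and ${}^\vee X$ for the right dual, with $\mathrm{ev}: X\otimes {}^\vee X\to 1$ and $\mathrm{coev}:1\to {}^\vee X\otimes X$. The Nakayama functor of a $k$-linear category $\mathcal{M}$ is, when it exists, the endofunctor given by the coend $$N_{\mathcal{M}}(M)=\int^{Y\in\mathcal{M}}\mathrm{Hom}_{\mathcal{M}}(M,Y)^*\otimes Y ,$$ functorial in $M$ through $\mathrm{Hom}_{\mathcal{M}}(M,Y)^*$,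 with structure morphisms $i_{M,Y}:\mathrm{Hom}_{\mathcal{M}}(M,Y)^*\otimes Y\to N_{\mathcal{M}}(M)$; here $V\otimes Y$ is the copower, so that a morphism $V\otimes Y\to Z$ is a linear map $V\to\mathrm{Hom}_{\mathcal{M}}(Y,Z)$. It is unique up to a unique isomorphism compatible with the structure morphisms. If $G\dashv G_1\dashv G_2\dashv G_3$ are linear functors between finite abelian categories $\mathcal{M}$, $\mathcal{M}'$ with $G:\mathcal{M}\to\mathcal{M}'$, let $\mathrm{can}_G(M):G_2N_{\mathcal{M}}(M)\to N_{\mathcal{M}'}(G(M))$ be the unique morphism such that, for all $Y\in\mathcal{M}$, its composition with $G_2(i_{M,Y}):\mathrm{Hom}_{\mathcal{M}}(M,Y)^*\otimes G_2Y\to G_2N_{\mathcal{M}}(M)$ is $i_{GM,G_2Y}$ composed with the dual of $\mathrm{Hom}(GM,G_2Y)\cong\mathrm{Hom}(M,G_1G_2Y)\to\mathrm{Hom}(M,Y)$. Taking for $G$ the action of $X^{\vee\vee}$ on the left (of ${}^{\vee\vee}X$ on the right), with successive right adjoints the actions of $X^\vee,X,{}^\vee X$ (of ${}^\vee X,X,X^\vee$),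 one gets morphisms $$X\triangleright N_{\mathcal{M}}(M)\to N_{\mathcal{M}}(X^{\vee\vee}\triangleright M),\qquad N_{\mathcal{M}}(M)\triangleleft X\to N_{\mathcal{M}}(M\triangleleft{}^{\vee\vee}X).\qquad(*)$$ Let $A$ and $B$ be algebras in $\mathcal{C}$. The right action $A^\vee\otimes A\to A^\vee$ is the transpose of left multiplication, i.e. it corresponds to $\mathrm{ev}\circ(A^\vee\otimes\mu):A^\vee\otimes A\otimes A\to 1$, and the left action $A^{\vee\vee}\otimes A^\vee\to A^\vee$ corresponds to $A^{\vee\vee}\otimes A^\vee\otimes A\to A^{\vee\vee}\otimes A^\vee\to 1$; these make $A^\vee$ an $A^{\vee\vee}$-$A$-bimodule. In the mirrored way ${}^\vee B$ is a $B$-${}^{\vee\vee}B$-bimodule. For a left $A$-module $\mathbf{M}$ in $\mathcal{M}$, let $A^\vee\otimes_A\mathbf{M}$ be the coequalizer of the two morphisms $A^\vee\triangleright A\triangleright M\rightrightarrows A^\vee\triangleright M$ given by the actions of $A$ on $M$ and on $A^\vee$; it carries an induced action of $A^{\vee\vee}$. Define $\mathbf{M}\otimes_B{}^\vee B$, with its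 action of ${}^{\vee\vee}B$, in the mirrored way. If an object $Q$ has a left action of $A^{\vee\vee}$, let $A$ act on $N_{\mathcal{M}}(Q)$ by $A\triangleright N_{\mathcal{M}}(Q)\to N_{\mathcal{M}}(A^{\vee\vee}\triangleright Q)\to N_{\mathcal{M}}(Q)$, and if $Q$ has a right action of ${}^{\vee\vee}B$, let $B$ act on $N_{\mathcal{M}}(Q)$ by $N_{\mathcal{M}}(Q)\triangleleft B\to N_{\mathcal{M}}(Q\triangleleft{}^{\vee\vee}B)\to N_{\mathcal{M}}(Q)$, where the first morphisms are those of $(*)$. **Theorem.** Let $A$ and $B$ be algebras in a finite multi-tensor category $\mathcal{C}$. 1. Let $\mathcal{M}$ be a finite left $\mathcal{C}$-module category. Then $N_{\mathcal{M}}$ exists, the above action makes $N_{\mathcal{M}}(A^\vee\otimes_A\mathbf{M})$ a left $A$-module, naturally in the left $A$-module $\mathbf{M}$, and the resulting functor is the Nakayama functor of the category ${}_A\mathcal{M}$ of left $A$-modules in $\mathcal{M}$: $$N_{{}_A\mathcal{M}}(\mathbf{M})\cong N_{\mathcal{M}}(A^\vee\otimes_A\mathbf{M})\quad\text{naturally in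 }\mathbf{M}\in{}_A\mathcal{M}.$$ 2. Let $\mathcal{M}$ be a finite right $\mathcal{C}$-module category. Then $N_{\mathcal{M}}$ exists, the above action makes $N_{\mathcal{M}}(\mathbf{M}\otimes_B{}^\vee B)$ a right $B$-module, naturally in the right $B$-module $\mathbf{M}$, and the resulting functor is the Nakayama functor of the category $\mathcal{M}_B$ of right $B$-modules in $\mathcal{M}$: $$N_{\mathcal{M}_B}(\mathbf{M})\cong N_{\mathcal{M}}(\mathbf{M}\otimes_B{}^\vee B)\quad\text{naturally in }\mathbf{M}\in\mathcal{M}_B.$$ 3. Let $\mathcal{M}$ be a finite $\mathcal{C}$-bimodule category. Then $N_{\mathcal{M}}$ exists, the above two actions make $N_{\mathcal{M}}(A^\vee\otimes_A\mathbf{M}\otimes_B{}^\vee B)$ an $A$-$B$-bimodule, naturally in the $A$-$B$-bimodule $\mathbf{M}$, and the resulting functor is the Nakayama functor of the category ${}_A\mathcal{M}_B$ of $A$-$B$-bimodules in $\mathcal{M}$: $$N_{{}_A\mathcal{M}_B}(\mathbf{M})\cong N_{\mathcal{M}}(A^\vee\otimes_A\mathbf{M}\otimes_B{}^\vee B)\quad\text{naturally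 in }\mathbf{M}\in{}_A\mathcal{M}_B.$$ -/

import Mathlib

open CategoryTheory MonoidalCategory Limits
open scoped MonoidalLeftAction MonoidalRightAction MonObj

universe u v₁ u₁ v₂ u₂ v₃ u₃

namespace NakayamaModules

/-! ### Finite abelian categories -/

section Finite

/-- A `k`-linear category is a finite abelian category if it is `k`-linearly equivalent to the
category of finite-dimensional left modules over a finite-dimensional `k`-algebra `R` (over such an
algebra, finitely generated modules are the same as finite-dimensional ones). -/
class FiniteAbelian (k : Type u) [Field k] (M : Type u₁) [Category.{v₁} M] [Abelian M]
    [Linear k M] : Prop where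
  exists_equivalence : ∃ (R : Type u) (_ : Ring R) (_ : Algebra k R) (_ : Module.Finite k R)
    (F : M ⥤ FGModuleCat.{u} R), F.IsEquivalence ∧ F.Additive ∧ F.Linear k

end Finite

/-! ### The Nakayama functor -/

section Nakayama

variable (k : Type u) [Field k]
variable {M : Type u₁} [Category.{v₁} M] [Preadditive M] [Linear k M]
variable {M' : Type u₂} [Category.{v₂} M'] [Preadditive M'] [Linear k M']

/-- A dinatural family of morphisms `Hom(X, Y)^* ⊗ Y ⟶ Z`, indexed by `Y : M`, where `V ⊗ Y` is the
copower of the object `Y` by the vector space `V`. By the defining property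
`Hom(V ⊗ Y, Z) ≅ Hom_k(V, Hom(Y, Z))` of the copower, the component at `Y` is a linear map
`Hom(X, Y)^* → Hom(Y, Z)`. -/
structure NakayamaCowedge (X Z : M) where
  /-- The component at `Y`. -/
  app (Y : M) : Module.Dual k (X ⟶ Y) →ₗ[k] (Y ⟶ Z)
  dinatural {Y Y' : M} (f : Y ⟶ Y') (ξ : Module.Dual k (X ⟶ Y')) :
    app Y (ξ ∘ₗ Linear.rightComp k X f) = f ≫ app Y' ξ

/-- The structure of a Nakayama functor of `M` on an endofunctor `N`: for every `X`, a universal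
dinatural family exhibiting `N X` as the coend `∫^Y Hom(X, Y)^* ⊗ Y`, such that the action of `N`
on morphisms is the one induced by the functoriality of `Hom(X, Y)^*` in `X`. -/
structure NakayamaStructure (N : M ⥤ M) where
  /-- The universal dinatural family. -/
  cowedge (X : M) : NakayamaCowedge k X (N.obj X)
  /-- The morphism induced by the universal property. -/
  desc {X Z : M} (w : NakayamaCowedge k X Z) : N.obj X ⟶ Z
  fac {X Z : M} (w : NakayamaCowedge k X Z) (Y : M) (ξ : Module.Dual k (X ⟶ Y)) :
    (cowedge X).app Y ξ ≫ desc w = w.app Y ξ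
  uniq {X Z : M} (w : NakayamaCowedge k X Z) (g : N.obj X ⟶ Z)
    (hg : ∀ (Y : M) (ξ : Module.Dual k (X ⟶ Y)), (cowedge X).app Y ξ ≫ g = w.app Y ξ) :
    g = desc w
  natural {X X' : M} (f : X ⟶ X') (Y : M) (ξ : Module.Dual k (X ⟶ Y)) :
    (cowedge X).app Y ξ ≫ N.map f = (cowedge X').app Y (ξ ∘ₗ Linear.leftComp k Y f)

section Can

variable {G : M ⥤ M'} {G₁ : M' ⥤ M} {G₂ : M ⥤ M'} {G₃ : M' ⥤ M}
  (a₁ : G ⊣ G₁) (a₂ : G₁ ⊣ G₂) (a₃ : G₂ ⊣ G₃)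

/-- The map `Hom(G X, G₂ Y) ≅ Hom(X, G₁ G₂ Y) ⟶ Hom(X, Y)` given by the adjunction `G ⊣ G₁` and the
counit of `G₁ ⊣ G₂`. -/
@[simps]
def adjComp [G₁.Additive] [G₁.Linear k] (X Y : M) :
    (G.obj X ⟶ G₂.obj Y) →ₗ[k] (X ⟶ Y) where
  toFun h := a₁.unit.app X ≫ G₁.map h ≫ a₂.counit.app Y
  map_add' := by simp
  map_smul' := by simp

/-- The dinatural family which corresponds, under `G₂ ⊣ G₃`, to the family
`Hom(X, Y)^* ⊗ G₂ Y ⟶ Hom(G X, G₂ Y)^* ⊗ G₂ Y ⟶ N' (G X)`. -/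
@[simps]
def canCowedge [G₁.Additive] [G₁.Linear k] [G₃.Additive] [G₃.Linear k]
    {N' : M' ⥤ M'} (S' : NakayamaStructure k N') (X : M) :
    NakayamaCowedge k X (G₃.obj (N'.obj (G.obj X))) where
  app Y :=
    { toFun := fun ξ => a₃.unit.app Y ≫
        G₃.map ((S'.cowedge (G.obj X)).app (G₂.obj Y) (ξ ∘ₗ adjComp k a₁ a₂ X Y))
      map_add' := by simp [LinearMap.add_comp]
      map_smul' := by simp [LinearMap.smul_comp] }
  dinatural {Y Y'} f ξ := by
    have h : (ξ ∘ₗ Linear.rightComp k X f) ∘ₗ adjComp k a₁ a₂ X Y =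
        (ξ ∘ₗ adjComp k a₁ a₂ X Y') ∘ₗ Linear.rightComp k (G.obj X) (G₂.map f) := by
      ext h; simp
    simp only [LinearMap.coe_mk, AddHom.coe_mk]
    rw [h, (S'.cowedge (G.obj X)).dinatural]
    simp

/-- The canonical morphism `G₂ (N X) ⟶ N' (G X)` for a functor `G` with right adjoint `G₁`, double
right adjoint `G₂` and triple right adjoint `G₃`. It is characterised by `map_app_can`. -/
def can [G₁.Additive] [G₁.Linear k] [G₃.Additive] [G₃.Linear k]
    {N : M ⥤ M} {N' : M' ⥤ M'} (S : NakayamaStructure k N) (S' : NakayamaStructure k N') (X : M) :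
    G₂.obj (N.obj X) ⟶ N'.obj (G.obj X) :=
  G₂.map (S.desc (canCowedge k a₁ a₂ a₃ S' X)) ≫ a₃.counit.app _

theorem map_app_can [G₁.Additive] [G₁.Linear k] [G₃.Additive] [G₃.Linear k]
    {N : M ⥤ M} {N' : M' ⥤ M'} (S : NakayamaStructure k N) (S' : NakayamaStructure k N') (X Y : M)
    (ξ : Module.Dual k (X ⟶ Y)) :
    G₂.map ((S.cowedge X).app Y ξ) ≫ can k a₁ a₂ a₃ S S' X =
      (S'.cowedge (G.obj X)).app (G₂.obj Y) (ξ ∘ₗ adjComp k a₁ a₂ X Y) := by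
  rw [can, ← Functor.map_comp_assoc, S.fac]
  simp

end Can

end Nakayama

/-! ### Finite module categories -/

section ModuleCategories

variable (k : Type u) [Field k]
variable (C : Type u₁) [Category.{v₁} C] [MonoidalCategory C]
variable (M : Type u₂) [Category.{v₂} M]

section Left

variable [MonoidalLeftAction C M]

/-- The left action is additive in each variable. -/
class LeftActionPreadditive [Preadditive C] [Preadditive M] : Prop where
  actionHomRight_add (c : C) {m m' : M} (f g : m ⟶ m') : c ⊴ₗ (f + g) = c ⊴ₗ f + c ⊴ₗ g
  add_actionHomLeft {c c' : C} (f g : c ⟶ c') (m : M) : (f + g) ⊵ₗ m = f ⊵ₗ m + g ⊵ₗ m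

/-- The left action is `k`-linear in each variable. -/
class LeftActionLinear [Preadditive C] [Linear k C] [Preadditive M] [Linear k M] : Prop where
  actionHomRight_smul (c : C) {m m' : M} (r : k) (f : m ⟶ m') : c ⊴ₗ (r • f) = r • c ⊴ₗ f
  smul_actionHomLeft {c c' : C} (r : k) (f : c ⟶ c') (m : M) : (r • f) ⊵ₗ m = r • f ⊵ₗ m

/-- The left action is right exact in each variable. -/
class LeftActionRightExact : Prop where
  preserves_actionLeft (c : C) : PreservesFiniteColimits (MonoidalLeftAction.actionLeft M c)
  preserves_actionRight (m : M) : PreservesFiniteColimits (MonoidalLeftAction.actionRight C m)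

end Left

section Right

variable [MonoidalRightAction C M]

/-- The right action is additive in each variable. -/
class RightActionPreadditive [Preadditive C] [Preadditive M] : Prop where
  add_actionHomLeft {m m' : M} (f g : m ⟶ m') (c : C) : (f + g) ⊵ᵣ c = f ⊵ᵣ c + g ⊵ᵣ c
  actionHomRight_add (m : M) {c c' : C} (f g : c ⟶ c') : m ⊴ᵣ (f + g) = m ⊴ᵣ f + m ⊴ᵣ g

/-- The right action is `k`-linear in each variable. -/
class RightActionLinear [Preadditive C] [Linear k C] [Preadditive M] [Linear k M] : Prop where
  smul_actionHomLeft {m m' : M} (r : k) (f : m ⟶ m') (c : C) : (r • f) ⊵ᵣ c = r • f ⊵ᵣ c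
  actionHomRight_smul (m : M) {c c' : C} (r : k) (f : c ⟶ c') : m ⊴ᵣ (r • f) = r • m ⊴ᵣ f

/-- The right action is right exact in each variable. -/
class RightActionRightExact : Prop where
  preserves_actionRight (c : C) : PreservesFiniteColimits (MonoidalRightAction.actionRight M c)
  preserves_actionLeft (m : M) : PreservesFiniteColimits (MonoidalRightAction.actionLeft C m)

end Right

/-- A left and a right action of `C` on `M` form a `C`-bimodule category: there are natural middle
associativity isomorphisms satisfying the two pentagon axioms and the two triangle axioms. -/
class BimoduleCategory [MonoidalLeftAction C M] [MonoidalRightAction C M] where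
  /-- The middle associativity constraint. -/
  middle (X : C) (m : M) (Y : C) : (X ⊙ₗ m) ⊙ᵣ Y ≅ X ⊙ₗ (m ⊙ᵣ Y)
  middle_naturality_left {X X' : C} (f : X ⟶ X') (m : M) (Y : C) :
    (f ⊵ₗ m) ⊵ᵣ Y ≫ (middle X' m Y).hom = (middle X m Y).hom ≫ f ⊵ₗ (m ⊙ᵣ Y)
  middle_naturality_middle (X : C) {m m' : M} (f : m ⟶ m') (Y : C) :
    (X ⊴ₗ f) ⊵ᵣ Y ≫ (middle X m' Y).hom = (middle X m Y).hom ≫ X ⊴ₗ (f ⊵ᵣ Y)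
  middle_naturality_right (X : C) (m : M) {Y Y' : C} (f : Y ⟶ Y') :
    (X ⊙ₗ m) ⊴ᵣ f ≫ (middle X m Y').hom = (middle X m Y).hom ≫ X ⊴ₗ (m ⊴ᵣ f)
  pentagon_left (X X' : C) (m : M) (Y : C) :
    (αₗ X X' m).hom ⊵ᵣ Y ≫ (middle X (X' ⊙ₗ m) Y).hom ≫ X ⊴ₗ (middle X' m Y).hom =
      (middle (X ⊗ X') m Y).hom ≫ (αₗ X X' (m ⊙ᵣ Y)).hom
  pentagon_right (X : C) (m : M) (Y Y' : C) :
    (middle X m (Y ⊗ Y')).hom ≫ X ⊴ₗ (αᵣ m Y Y').hom =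
      (αᵣ (X ⊙ₗ m) Y Y').hom ≫ (middle X m Y).hom ⊵ᵣ Y' ≫ (middle X (m ⊙ᵣ Y) Y').hom
  triangle_left (m : M) (Y : C) :
    (middle (𝟙_ C) m Y).hom ≫ (λₗ[C] (m ⊙ᵣ Y)).hom = (λₗ[C] m).hom ⊵ᵣ Y
  triangle_right (X : C) (m : M) :
    (middle X m (𝟙_ C)).hom ≫ X ⊴ₗ (ρᵣ[C] m).hom = (ρᵣ[C] (X ⊙ₗ m)).hom

end ModuleCategories

open BimoduleCategory

/-! ### Adjunctions between actions of dual objects -/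

section Adjunctions

variable {C : Type u₁} [Category.{v₁} C] [MonoidalCategory C]
variable (M : Type u₂) [Category.{v₂} M]

section Left

variable [MonoidalLeftAction C M]

open MonoidalLeftAction

variable {M} in
theorem actionAssoc_left (X Y Z : C) (m : M) :
    X ⊴ₗ (αₗ Y Z m).hom ≫ (αₗ X Y (Z ⊙ₗ m)).inv ≫ (αₗ (X ⊗ Y) Z m).inv =
      (αₗ X (Y ⊗ Z) m).inv ≫ (α_ X Y Z).inv ⊵ₗ m := by
  rw [← cancel_epi (αₗ X (Y ⊗ Z) m).hom, ← cancel_epi ((α_ X Y Z).hom ⊵ₗ m),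
    associator_actionHom_assoc]
  simp

variable {M} in
theorem actionAssoc_left' (X Y Z : C) (m : M) :
    (αₗ (X ⊗ Y) Z m).hom ≫ (αₗ X Y (Z ⊙ₗ m)).hom ≫ X ⊴ₗ (αₗ Y Z m).inv =
      (α_ X Y Z).hom ⊵ₗ m ≫ (αₗ X (Y ⊗ Z) m).hom := by
  rw [← cancel_mono (X ⊴ₗ (αₗ Y Z m).hom)]
  simp

/-- If `Y` is dual to `X` by `coev : 𝟙 ⟶ X ⊗ Y` and `ev : Y ⊗ X ⟶ 𝟙`, then acting by `Y` is left
adjoint to acting by `X`. -/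
@[simps]
def leftActionAdj (X Y : C) [ExactPairing X Y] : actionLeft M Y ⊣ actionLeft M X where
  unit :=
    { app := fun m => (λₗ m).inv ≫ η_ X Y ⊵ₗ m ≫ (αₗ X Y m).hom
      naturality := by
        intro m m' f
        change f ≫ (λₗ m').inv ≫ η_ X Y ⊵ₗ m' ≫ (αₗ X Y m').hom =
          ((λₗ m).inv ≫ η_ X Y ⊵ₗ m ≫ (αₗ X Y m).hom) ≫ X ⊴ₗ Y ⊴ₗ f
        rw [← actionUnitIso_inv_naturality_assoc, action_exchange_assoc]
        simp }
  counit :=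
    { app := fun m => (αₗ Y X m).inv ≫ ε_ X Y ⊵ₗ m ≫ (λₗ m).hom
      naturality := by
        intro m m' f
        change Y ⊴ₗ X ⊴ₗ f ≫ (αₗ Y X m').inv ≫ ε_ X Y ⊵ₗ m' ≫ (λₗ m').hom =
          ((αₗ Y X m).inv ≫ ε_ X Y ⊵ₗ m ≫ (λₗ m).hom) ≫ f
        simp only [Category.assoc]
        rw [actionUnitIso_hom_naturality, ← action_exchange_assoc]
        simp }
  left_triangle_components m := by
    change Y ⊴ₗ ((λₗ m).inv ≫ η_ X Y ⊵ₗ m ≫ (αₗ X Y m).hom) ≫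
      (αₗ Y X (Y ⊙ₗ m)).inv ≫ ε_ X Y ⊵ₗ (Y ⊙ₗ m) ≫ (λₗ (Y ⊙ₗ m)).hom = 𝟙 _
    have h := congrArg (· ⊵ₗ m) (ExactPairing.coevaluation_evaluation X Y)
    simp only [comp_actionHomLeft, whiskerLeft_actionHomLeft, Category.assoc] at h
    simp only [actionHomLeft_action, actionHomRight_comp, Category.assoc]
    rw [← Category.assoc (αₗ Y X (Y ⊙ₗ m)).inv, ← Category.assoc (Y ⊴ₗ (αₗ X Y m).hom),
      actionAssoc_left, Category.assoc, ← cancel_epi (Y ⊴ₗ (λₗ[C] m).hom),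
      ← cancel_epi (αₗ Y (𝟙_ C) m).hom]
    simp only [actionHomRight_hom_inv_assoc]
    rw [reassoc_of% h, ← leftUnitor_actionHom, inv_hom_actionHomLeft]
    simp
  right_triangle_components m := by
    change ((λₗ (X ⊙ₗ m)).inv ≫ η_ X Y ⊵ₗ (X ⊙ₗ m) ≫ (αₗ X Y (X ⊙ₗ m)).hom) ≫
      X ⊴ₗ ((αₗ Y X m).inv ≫ ε_ X Y ⊵ₗ m ≫ (λₗ m).hom) = 𝟙 _
    have h := congrArg (· ⊵ₗ m) (ExactPairing.evaluation_coevaluation X Y)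
    simp only [comp_actionHomLeft, whiskerLeft_actionHomLeft] at h
    simp only [actionHomLeft_action, actionHomRight_comp, Category.assoc]
    rw [reassoc_of% actionAssoc_left', ← cancel_mono (X ⊴ₗ (λₗ[C] m).inv),
      ← cancel_mono (αₗ X (𝟙_ C) m).inv]
    simp only [Category.assoc, actionHomRight_hom_inv_assoc]
    rw [h, ← cancel_mono ((ρ_ X).hom ⊵ₗ m)]
    simp
    rw [← rightUnitor_actionHom, inv_hom_actionHomLeft]

end Left

section Right

variable [MonoidalRightAction C M]

open MonoidalRightAction

variable {M} in
theorem actionAssoc_right (X Y Z : C) (m : M) :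
    (αᵣ m X Y).hom ⊵ᵣ Z ≫ (αᵣ (m ⊙ᵣ X) Y Z).inv ≫ (αᵣ m X (Y ⊗ Z)).inv =
      (αᵣ m (X ⊗ Y) Z).inv ≫ m ⊴ᵣ (α_ X Y Z).hom := by
  rw [← cancel_epi (αᵣ m (X ⊗ Y) Z).hom, ← cancel_mono (αᵣ m X (Y ⊗ Z)).hom,
    ← cancel_mono (αᵣ (m ⊙ᵣ X) Y Z).hom]
  simp

variable {M} in
theorem actionAssoc_right' (X Y Z : C) (m : M) :
    (αᵣ m X (Y ⊗ Z)).hom ≫ (αᵣ (m ⊙ᵣ X) Y Z).hom ≫ (αᵣ m X Y).inv ⊵ᵣ Z =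
      m ⊴ᵣ (α_ X Y Z).inv ≫ (αᵣ m (X ⊗ Y) Z).hom := by
  rw [← cancel_mono ((αᵣ m X Y).hom ⊵ᵣ Z)]
  simp only [Category.assoc, inv_hom_actionHomLeft, Category.comp_id]
  rw [← actionHom_associator, ← actionHomRight_comp_assoc]
  simp

/-- If `Y` is dual to `X` by `coev : 𝟙 ⟶ X ⊗ Y` and `ev : Y ⊗ X ⟶ 𝟙`, then acting on the right by
`X` is left adjoint to acting on the right by `Y`. -/
@[simps]
def rightActionAdj (X Y : C) [ExactPairing X Y] : actionRight M X ⊣ actionRight M Y where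
  unit :=
    { app := fun m => (ρᵣ m).inv ≫ m ⊴ᵣ η_ X Y ≫ (αᵣ m X Y).hom
      naturality := by
        intro m m' f
        change f ≫ (ρᵣ m').inv ≫ m' ⊴ᵣ η_ X Y ≫ (αᵣ m' X Y).hom =
          ((ρᵣ m).inv ≫ m ⊴ᵣ η_ X Y ≫ (αᵣ m X Y).hom) ≫ (f ⊵ᵣ X) ⊵ᵣ Y
        rw [← actionUnitIso_inv_naturality_assoc, ← action_exchange_assoc]
        simp }
  counit :=
    { app := fun m => (αᵣ m Y X).inv ≫ m ⊴ᵣ ε_ X Y ≫ (ρᵣ m).hom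
      naturality := by
        intro m m' f
        change (f ⊵ᵣ Y) ⊵ᵣ X ≫ (αᵣ m' Y X).inv ≫ m' ⊴ᵣ ε_ X Y ≫ (ρᵣ m').hom =
          ((αᵣ m Y X).inv ≫ m ⊴ᵣ ε_ X Y ≫ (ρᵣ m).hom) ≫ f
        simp only [Category.assoc]
        rw [actionUnitIso_hom_naturality, action_exchange_assoc]
        simp }
  left_triangle_components m := by
    change ((ρᵣ m).inv ≫ m ⊴ᵣ η_ X Y ≫ (αᵣ m X Y).hom) ⊵ᵣ X ≫
      (αᵣ (m ⊙ᵣ X) Y X).inv ≫ (m ⊙ᵣ X) ⊴ᵣ ε_ X Y ≫ (ρᵣ (m ⊙ᵣ X)).hom = 𝟙 _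
    have h := congrArg (m ⊴ᵣ ·) (ExactPairing.evaluation_coevaluation X Y)
    simp only [actionHomRight_comp, actionHomRight_whiskerRight, Category.assoc] at h
    simp only [action_actionHomRight, comp_actionHomLeft, Category.assoc]
    rw [← Category.assoc (αᵣ (m ⊙ᵣ X) Y X).inv, ← Category.assoc ((αᵣ m X Y).hom ⊵ᵣ X),
      actionAssoc_right, Category.assoc, ← cancel_epi ((ρᵣ[C] m).hom ⊵ᵣ X),
      ← cancel_epi (αᵣ m (𝟙_ C) X).hom]
    simp only [hom_inv_actionHomLeft_assoc]
    rw [reassoc_of% h, ← actionHom_rightUnitor, actionHomRight_inv_hom]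
    simp
  right_triangle_components m := by
    change ((ρᵣ (m ⊙ᵣ Y)).inv ≫ (m ⊙ᵣ Y) ⊴ᵣ η_ X Y ≫ (αᵣ (m ⊙ᵣ Y) X Y).hom) ≫
      ((αᵣ m Y X).inv ≫ m ⊴ᵣ ε_ X Y ≫ (ρᵣ m).hom) ⊵ᵣ Y = 𝟙 _
    have h := congrArg (m ⊴ᵣ ·) (ExactPairing.coevaluation_evaluation X Y)
    simp only [actionHomRight_comp, actionHomRight_whiskerRight] at h
    simp only [action_actionHomRight, comp_actionHomLeft, Category.assoc]
    rw [reassoc_of% actionAssoc_right', ← cancel_mono ((ρᵣ[C] m).inv ⊵ᵣ Y),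
      ← cancel_mono (αᵣ m (𝟙_ C) Y).inv]
    simp only [Category.assoc, hom_inv_actionHomLeft_assoc]
    rw [h, ← cancel_mono (m ⊴ᵣ (λ_ Y).hom)]
    simp
    rw [← actionHom_leftUnitor, actionHomRight_inv_hom]

end Right

end Adjunctions

/-! ### Duals of algebras -/

section Duals

variable {C : Type u₁} [Category.{v₁} C] [MonoidalCategory C]

/-- The dual `X^∨` with `ev : X^∨ ⊗ X ⟶ 𝟙` and `coev : 𝟙 ⟶ X ⊗ X^∨`. -/
abbrev ldual (X : C) [HasRightDual X] : C := HasRightDual.rightDual X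

/-- The dual `^∨X` with `ev : X ⊗ ^∨X ⟶ 𝟙` and `coev : 𝟙 ⟶ ^∨X ⊗ X`. -/
abbrev rdual (X : C) [HasLeftDual X] : C := HasLeftDual.leftDual X

/-- The morphism `f : Z ⟶ Y` with `ev ∘ (f ⊗ X) = g`, where `ev : Y ⊗ X ⟶ 𝟙`. -/
def mateLeft {X Y Z : C} [ExactPairing X Y] (g : Z ⊗ X ⟶ 𝟙_ C) : Z ⟶ Y :=
  tensorRightHomEquiv Z X Y (𝟙_ C) g ≫ (λ_ Y).hom

/-- The morphism `f : Z ⟶ X` with `ev ∘ (Y ⊗ f) = g`, where `ev : Y ⊗ X ⟶ 𝟙`. -/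
def mateRight {X Y Z : C} [ExactPairing X Y] (g : Y ⊗ Z ⟶ 𝟙_ C) : Z ⟶ X :=
  tensorLeftHomEquiv Z X Y (𝟙_ C) g ≫ (ρ_ X).hom

theorem tensorRightHomEquiv_symm_unit {X Y Z : C} [ExactPairing X Y] (f : Z ⟶ Y) :
    (tensorRightHomEquiv Z X Y (𝟙_ C)).symm (f ≫ (λ_ Y).inv) = f ▷ X ≫ ε_ X Y := by
  rw [tensorRightHomEquiv_symm_naturality]
  simp [tensorRightHomEquiv, unitors_inv_equal]

theorem tensorLeftHomEquiv_symm_unit {X Y Z : C} [ExactPairing X Y] (f : Z ⟶ X) :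
    (tensorLeftHomEquiv Z X Y (𝟙_ C)).symm (f ≫ (ρ_ X).inv) = Y ◁ f ≫ ε_ X Y := by
  rw [tensorLeftHomEquiv_symm_naturality]
  simp [tensorLeftHomEquiv, ← unitors_inv_equal]

theorem mateLeft_evaluation {X Y Z : C} [ExactPairing X Y] (g : Z ⊗ X ⟶ 𝟙_ C) :
    (mateLeft g : Z ⟶ Y) ▷ X ≫ ε_ X Y = g := by
  rw [← tensorRightHomEquiv_symm_unit, mateLeft]
  simp

theorem mateRight_evaluation {X Y Z : C} [ExactPairing X Y] (g : Y ⊗ Z ⟶ 𝟙_ C) :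
    Y ◁ (mateRight g : Z ⟶ X) ≫ ε_ X Y = g := by
  rw [← tensorLeftHomEquiv_symm_unit, mateRight]
  simp

theorem mateLeft_unique {X Y Z : C} [ExactPairing X Y] {f g : Z ⟶ Y}
    (h : f ▷ X ≫ ε_ X Y = g ▷ X ≫ ε_ X Y) : f = g := by
  rw [← tensorRightHomEquiv_symm_unit, ← tensorRightHomEquiv_symm_unit] at h
  simpa using (tensorRightHomEquiv Z X Y (𝟙_ C)).symm.injective h

theorem mateRight_unique {X Y Z : C} [ExactPairing X Y] {f g : Z ⟶ X}
    (h : Y ◁ f ≫ ε_ X Y = Y ◁ g ≫ ε_ X Y) : f = g := by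
  rw [← tensorLeftHomEquiv_symm_unit, ← tensorLeftHomEquiv_symm_unit] at h
  simpa using (tensorLeftHomEquiv Z X Y (𝟙_ C)).symm.injective h

section Left

variable [RightRigidCategory C] (A : C) [MonObj A]

/-- The right action `A^∨ ⊗ A ⟶ A^∨`, given by `ev ∘ (dualAct ⊗ A) = ev ∘ (A^∨ ⊗ μ)`. -/
def dualAct : ldual A ⊗ A ⟶ ldual A :=
  mateLeft ((α_ (ldual A) A A).hom ≫ ldual A ◁ μ[A] ≫ ε_ A (ldual A))

/-- The left action `A^∨∨ ⊗ A^∨ ⟶ A^∨`, given by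
`ev ∘ (dualBiact ⊗ A) = ev ∘ (A^∨∨ ⊗ dualAct)`. -/
def dualBiact : ldual (ldual A) ⊗ ldual A ⟶ ldual A :=
  mateLeft ((α_ (ldual (ldual A)) (ldual A) A).hom ≫
    ldual (ldual A) ◁ dualAct A ≫ ε_ (ldual A) (ldual (ldual A)))

theorem dualAct_assoc :
    dualAct A ▷ A ≫ dualAct A = (α_ (ldual A) A A).hom ≫ ldual A ◁ μ[A] ≫ dualAct A := by
  apply mateLeft_unique (X := A)
  simp only [comp_whiskerRight, Category.assoc]
  have h := mateLeft_evaluation (Y := ldual A)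
    ((α_ (ldual A) A A).hom ≫ ldual A ◁ μ[A] ≫ ε_ A (ldual A))
  rw [← dualAct] at h
  rw [h, associator_naturality_left_assoc, ← whisker_exchange_assoc, h]
  simp only [tensor_whiskerLeft, whisker_assoc, Category.assoc, Iso.inv_hom_id_assoc]
  rw [← whiskerLeft_comp_assoc (ldual A) (μ[A] ▷ A), MonObj.mul_assoc]
  simp

/-- `A^∨` is an `A^∨∨`-`A`-bimodule. -/
theorem dualBiact_dualAct :
    dualBiact A ▷ A ≫ dualAct A =
      (α_ _ _ _).hom ≫ ldual (ldual A) ◁ dualAct A ≫ dualBiact A := by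
  apply mateLeft_unique (X := A)
  simp only [comp_whiskerRight, Category.assoc]
  have h := mateLeft_evaluation (Y := ldual A)
    ((α_ (ldual A) A A).hom ≫ ldual A ◁ μ[A] ≫ ε_ A (ldual A))
  rw [← dualAct] at h
  have h' := mateLeft_evaluation (Y := ldual A)
    ((α_ (ldual (ldual A)) (ldual A) A).hom ≫
    ldual (ldual A) ◁ dualAct A ≫ ε_ (ldual A) (ldual (ldual A)))
  rw [← dualBiact] at h'
  rw [h, h', associator_naturality_left_assoc, ← whisker_exchange_assoc, h']
  simp only [tensor_whiskerLeft, whisker_assoc, Category.assoc, Iso.inv_hom_id_assoc]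
  rw [← whiskerLeft_comp_assoc (ldual (ldual A)) (dualAct A ▷ A), dualAct_assoc]
  simp

end Left

section Right

variable [LeftRigidCategory C] (B : C) [MonObj B]

/-- The left action `B ⊗ ^∨B ⟶ ^∨B`, given by `ev ∘ (B ⊗ codualAct) = ev ∘ (μ ⊗ ^∨B)`. -/
def codualAct : B ⊗ rdual B ⟶ rdual B :=
  mateRight ((α_ B B (rdual B)).inv ≫ μ[B] ▷ rdual B ≫ ε_ (rdual B) B)

/-- The right action `^∨B ⊗ ^∨∨B ⟶ ^∨B`, given by
`ev ∘ (B ⊗ codualBiact) = ev ∘ (codualAct ⊗ ^∨∨B)`. -/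
def codualBiact : rdual B ⊗ rdual (rdual B) ⟶ rdual B :=
  mateRight ((α_ B (rdual B) (rdual (rdual B))).inv ≫
    codualAct B ▷ rdual (rdual B) ≫ ε_ (rdual (rdual B)) (rdual B))

theorem codualAct_assoc :
    B ◁ codualAct B ≫ codualAct B =
      (α_ B B (rdual B)).inv ≫ μ[B] ▷ rdual B ≫ codualAct B := by
  apply mateRight_unique (Y := B)
  simp only [MonoidalCategory.whiskerLeft_comp, Category.assoc]
  have h := mateRight_evaluation (X := rdual B)
    ((α_ B B (rdual B)).inv ≫ μ[B] ▷ rdual B ≫ ε_ (rdual B) B)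
  rw [← codualAct] at h
  rw [h, associator_inv_naturality_right_assoc, whisker_exchange_assoc, h]
  simp only [whiskerRight_tensor, whisker_assoc_symm, Category.assoc, Iso.hom_inv_id_assoc]
  rw [← comp_whiskerRight_assoc (B ◁ μ[B]),
    show B ◁ μ[B] ≫ μ[B] = (α_ B B B).inv ≫ μ[B] ▷ B ≫ μ[B] by simp]
  simp only [comp_whiskerRight, Category.assoc]
  rw [pentagon_inv_assoc]

/-- `^∨B` is a `B`-`^∨∨B`-bimodule. -/
theorem codualAct_codualBiact :
    B ◁ codualBiact B ≫ codualAct B =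
      (α_ _ _ _).inv ≫ codualAct B ▷ rdual (rdual B) ≫ codualBiact B := by
  apply mateRight_unique (Y := B)
  simp only [MonoidalCategory.whiskerLeft_comp, Category.assoc]
  have h := mateRight_evaluation (X := rdual B)
    ((α_ B B (rdual B)).inv ≫ μ[B] ▷ rdual B ≫ ε_ (rdual B) B)
  rw [← codualAct] at h
  have h' := mateRight_evaluation (X := rdual B)
    ((α_ B (rdual B) (rdual (rdual B))).inv ≫
      codualAct B ▷ rdual (rdual B) ≫ ε_ (rdual (rdual B)) (rdual B))
  rw [← codualBiact] at h'
  rw [h, h', associator_inv_naturality_right_assoc, whisker_exchange_assoc, h']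
  simp only [whiskerRight_tensor, whisker_assoc_symm, Category.assoc, Iso.hom_inv_id_assoc]
  rw [← comp_whiskerRight_assoc (B ◁ codualAct B), codualAct_assoc]
  simp

end Right

end Duals
/-! ### Linearity of the action functors -/

section Linearity

variable (k : Type u) [Field k]
variable {C : Type u₁} [Category.{v₁} C] [MonoidalCategory C] [Preadditive C]
variable {M : Type u₂} [Category.{v₂} M] [Preadditive M]

section Left

variable [MonoidalLeftAction C M] [LeftActionPreadditive C M]

instance (c : C) : (MonoidalLeftAction.actionLeft M c).Additive where
  map_add {_ _ f g} := LeftActionPreadditive.actionHomRight_add c f g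

instance [Linear k C] [Linear k M] [LeftActionLinear k C M] (c : C) :
    (MonoidalLeftAction.actionLeft M c).Linear k where
  map_smul f r := LeftActionLinear.actionHomRight_smul c r f

theorem actionHomRight_zero (c : C) (m m' : M) : c ⊴ₗ (0 : m ⟶ m') = 0 :=
  (MonoidalLeftAction.actionLeft M c).map_zero m m'

theorem actionHomRight_neg (c : C) {m m' : M} (f : m ⟶ m') : c ⊴ₗ (-f) = -(c ⊴ₗ f) :=
  (MonoidalLeftAction.actionLeft M c).map_neg

end Left

section Right

variable [MonoidalRightAction C M] [RightActionPreadditive C M]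

instance (c : C) : (MonoidalRightAction.actionRight M c).Additive where
  map_add {_ _ f g} := RightActionPreadditive.add_actionHomLeft f g c

instance [Linear k C] [Linear k M] [RightActionLinear k C M] (c : C) :
    (MonoidalRightAction.actionRight M c).Linear k where
  map_smul f r := RightActionLinear.smul_actionHomLeft r f c

theorem zero_actionHomLeft (c : C) (m m' : M) : (0 : m ⟶ m') ⊵ᵣ c = 0 :=
  (MonoidalRightAction.actionRight M c).map_zero m m'

theorem neg_actionHomLeft (c : C) {m m' : M} (f : m ⟶ m') : (-f) ⊵ᵣ c = -(f ⊵ᵣ c) :=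
  (MonoidalRightAction.actionRight M c).map_neg

end Right

end Linearity

/-! ### Left modules

The category of left `A`-modules in `M` is `Mod M A`. We equip it with its linear structure. -/

section LeftModules

variable (k : Type u) [Field k]
variable {C : Type u₁} [Category.{v₁} C] [MonoidalCategory C] [Preadditive C]
variable {M : Type u₂} [Category.{v₂} M] [Preadditive M]
variable [MonoidalLeftAction C M] [LeftActionPreadditive C M] {A : C} [MonObj A]

instance (X Y : Mod M A) : Add (X ⟶ Y) where
  add f g := Mod.Hom.mk' (f.hom + g.hom) (by
    rw [LeftActionPreadditive.actionHomRight_add]; simp)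

instance (X Y : Mod M A) : Zero (X ⟶ Y) where
  zero := Mod.Hom.mk' 0 (by rw [actionHomRight_zero, comp_zero, zero_comp])

instance (X Y : Mod M A) : Neg (X ⟶ Y) where
  neg f := Mod.Hom.mk' (-f.hom) (by rw [actionHomRight_neg]; simp)

instance (X Y : Mod M A) : AddCommGroup (X ⟶ Y) where
  add_assoc f g h := Mod.Hom.ext (add_assoc f.hom g.hom h.hom)
  zero_add f := Mod.Hom.ext (zero_add f.hom)
  add_zero f := Mod.Hom.ext (add_zero f.hom)
  add_comm f g := Mod.Hom.ext (add_comm f.hom g.hom)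
  neg_add_cancel f := Mod.Hom.ext (neg_add_cancel f.hom)
  nsmul := nsmulRec
  zsmul := zsmulRec

theorem mod_add_hom {X Y : Mod M A} (f g : X ⟶ Y) : (f + g).hom = f.hom + g.hom := rfl

instance : Preadditive (Mod M A) where
  add_comp _ _ _ f g h := Mod.hom_ext _ _ (by simp [mod_add_hom])
  comp_add _ _ _ f g h := Mod.hom_ext _ _ (by simp [mod_add_hom])

variable [Linear k C] [Linear k M] [LeftActionLinear k C M]

instance (X Y : Mod M A) : Module k (X ⟶ Y) where
  smul r f := Mod.Hom.mk' (r • f.hom) (by rw [LeftActionLinear.actionHomRight_smul]; simp)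
  one_smul f := Mod.Hom.ext (one_smul k f.hom)
  mul_smul r s f := Mod.Hom.ext (mul_smul r s f.hom)
  smul_zero r := Mod.Hom.ext (smul_zero r)
  smul_add r f g := Mod.Hom.ext (smul_add r f.hom g.hom)
  add_smul r s f := Mod.Hom.ext (add_smul r s f.hom)
  zero_smul f := Mod.Hom.ext (zero_smul k f.hom)

theorem mod_smul_hom {X Y : Mod M A} (r : k) (f : X ⟶ Y) : (r • f).hom = r • f.hom := rfl

instance : Linear k (Mod M A) where
  smul_comp _ _ _ r f g := Mod.hom_ext _ _ (by simp [mod_smul_hom])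
  comp_smul _ _ _ f r g := Mod.hom_ext _ _ (by simp [mod_smul_hom])

end LeftModules

/-! ### Right modules -/

section RightModules

variable {C : Type u₁} [Category.{v₁} C] [MonoidalCategory C]
variable (M : Type u₂) [Category.{v₂} M] [MonoidalRightAction C M]

/-- A right `B`-module in a right `C`-module category `M`. -/
structure RightMod (B : C) [MonObj B] where
  /-- The underlying object. -/
  X : M
  /-- The action. -/
  act : X ⊙ᵣ B ⟶ X
  act_one : X ⊴ᵣ η[B] ≫ act = (ρᵣ X).hom
  act_mul : X ⊴ᵣ μ[B] ≫ act = (αᵣ X B B).hom ≫ act ⊵ᵣ B ≫ act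

namespace RightMod

variable {M} {B : C} [MonObj B]

/-- A morphism of right `B`-modules. -/
@[ext]
structure Hom (X Y : RightMod M B) where
  /-- The underlying morphism. -/
  hom : X.X ⟶ Y.X
  act_hom : X.act ≫ hom = hom ⊵ᵣ B ≫ Y.act

instance : Category (RightMod M B) where
  Hom := Hom
  id X := ⟨𝟙 X.X, by simp⟩
  comp f g := ⟨f.hom ≫ g.hom, by
    rw [reassoc_of% f.act_hom, g.act_hom]; simp⟩

@[ext]
theorem hom_ext {X Y : RightMod M B} (f g : X ⟶ Y) (h : f.hom = g.hom) : f = g := Hom.ext h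

@[simp]
theorem id_hom (X : RightMod M B) : (𝟙 X : X ⟶ X).hom = 𝟙 X.X := rfl

@[simp]
theorem comp_hom {X Y Z : RightMod M B} (f : X ⟶ Y) (g : Y ⟶ Z) :
    (f ≫ g).hom = f.hom ≫ g.hom := rfl

section Linear

variable (k : Type u) [Field k]
variable [Preadditive C] [Preadditive M] [RightActionPreadditive C M]

instance (X Y : RightMod M B) : Add (X ⟶ Y) where
  add f g := ⟨f.hom + g.hom, by
    rw [RightActionPreadditive.add_actionHomLeft]; simp [Hom.act_hom]⟩

instance (X Y : RightMod M B) : Zero (X ⟶ Y) where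
  zero := ⟨0, by rw [zero_actionHomLeft, comp_zero, zero_comp]⟩

instance (X Y : RightMod M B) : Neg (X ⟶ Y) where
  neg f := ⟨-f.hom, by rw [neg_actionHomLeft]; simp [Hom.act_hom]⟩

instance (X Y : RightMod M B) : AddCommGroup (X ⟶ Y) where
  add_assoc f g h := Hom.ext (add_assoc f.hom g.hom h.hom)
  zero_add f := Hom.ext (zero_add f.hom)
  add_zero f := Hom.ext (add_zero f.hom)
  add_comm f g := Hom.ext (add_comm f.hom g.hom)
  neg_add_cancel f := Hom.ext (neg_add_cancel f.hom)
  nsmul := nsmulRec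
  zsmul := zsmulRec

instance : Preadditive (RightMod M B) where
  add_comp _ _ _ f g h := hom_ext _ _ (Preadditive.add_comp _ _ _ f.hom g.hom h.hom)
  comp_add _ _ _ f g h := hom_ext _ _ (Preadditive.comp_add _ _ _ f.hom g.hom h.hom)

variable [Linear k C] [Linear k M] [RightActionLinear k C M]

instance (X Y : RightMod M B) : Module k (X ⟶ Y) where
  smul r f := ⟨r • f.hom, by
    rw [RightActionLinear.smul_actionHomLeft]; simp [Hom.act_hom]⟩
  one_smul f := Hom.ext (one_smul k f.hom)
  mul_smul r s f := Hom.ext (mul_smul r s f.hom)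
  smul_zero r := Hom.ext (smul_zero r)
  smul_add r f g := Hom.ext (smul_add r f.hom g.hom)
  add_smul r s f := Hom.ext (add_smul r s f.hom)
  zero_smul f := Hom.ext (zero_smul k f.hom)

instance : Linear k (RightMod M B) where
  smul_comp _ _ _ r f g := hom_ext _ _ (Linear.smul_comp _ _ _ r f.hom g.hom)
  comp_smul _ _ _ f r g := hom_ext _ _ (Linear.comp_smul _ _ _ f.hom r g.hom)

end Linear

end RightMod

end RightModules

/-! ### Bimodules -/

section Bimodules

variable {C : Type u₁} [Category.{v₁} C] [MonoidalCategory C]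
variable (M : Type u₂) [Category.{v₂} M] [MonoidalLeftAction C M] [MonoidalRightAction C M]
  [BimoduleCategory C M]

/-- An `A`-`B`-bimodule in a `C`-bimodule category `M`. -/
structure BiMod (A B : C) [MonObj A] [MonObj B] where
  /-- The underlying left module. -/
  left : Mod M A
  /-- The right action. -/
  act : left.X ⊙ᵣ B ⟶ left.X
  act_one : left.X ⊴ᵣ η[B] ≫ act = (ρᵣ left.X).hom
  act_mul : left.X ⊴ᵣ μ[B] ≫ act = (αᵣ left.X B B).hom ≫ act ⊵ᵣ B ≫ act
  comm : (middle A left.X B).hom ≫ A ⊴ₗ act ≫ γ[left.X] = γ[left.X] ⊵ᵣ B ≫ act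

namespace BiMod

variable {M} {A B : C} [MonObj A] [MonObj B]

/-- A morphism of `A`-`B`-bimodules. -/
@[ext]
structure Hom (X Y : BiMod M A B) where
  /-- The underlying morphism of left modules. -/
  left : X.left ⟶ Y.left
  act_hom : X.act ≫ left.hom = left.hom ⊵ᵣ B ≫ Y.act

instance : Category (BiMod M A B) where
  Hom := Hom
  id X := ⟨𝟙 X.left, by simp⟩
  comp {X Y Z} f g := ⟨f.left ≫ g.left, by
    change X.act ≫ f.left.hom ≫ g.left.hom = (f.left.hom ≫ g.left.hom) ⊵ᵣ B ≫ Z.act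
    rw [reassoc_of% f.act_hom, g.act_hom]; simp⟩

@[ext]
theorem hom_ext {X Y : BiMod M A B} (f g : X ⟶ Y) (h : f.left = g.left) : f = g := Hom.ext h

@[simp]
theorem id_left (X : BiMod M A B) : (𝟙 X : X ⟶ X).left = 𝟙 X.left := rfl

@[simp]
theorem comp_left {X Y Z : BiMod M A B} (f : X ⟶ Y) (g : Y ⟶ Z) :
    (f ≫ g).left = f.left ≫ g.left := rfl

section Linear

variable (k : Type u) [Field k]
variable [Preadditive C] [Preadditive M] [LeftActionPreadditive C M] [RightActionPreadditive C M]

instance (X Y : BiMod M A B) : Add (X ⟶ Y) where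
  add f g := ⟨f.left + g.left, by
    rw [mod_add_hom, RightActionPreadditive.add_actionHomLeft]; simp [Hom.act_hom]⟩

instance (X Y : BiMod M A B) : Zero (X ⟶ Y) where
  zero := ⟨0, by
    change X.act ≫ 0 = (0 : X.left.X ⟶ Y.left.X) ⊵ᵣ B ≫ Y.act
    rw [zero_actionHomLeft, comp_zero, zero_comp]⟩

instance (X Y : BiMod M A B) : Neg (X ⟶ Y) where
  neg f := ⟨-f.left, by
    change X.act ≫ (-f.left.hom) = (-f.left.hom) ⊵ᵣ B ≫ Y.act
    rw [neg_actionHomLeft]; simp [Hom.act_hom]⟩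

instance (X Y : BiMod M A B) : AddCommGroup (X ⟶ Y) where
  add_assoc f g h := Hom.ext (add_assoc f.left g.left h.left)
  zero_add f := Hom.ext (zero_add f.left)
  add_zero f := Hom.ext (add_zero f.left)
  add_comm f g := Hom.ext (add_comm f.left g.left)
  neg_add_cancel f := Hom.ext (neg_add_cancel f.left)
  nsmul := nsmulRec
  zsmul := zsmulRec

instance : Preadditive (BiMod M A B) where
  add_comp _ _ _ f g h := hom_ext _ _ (Preadditive.add_comp _ _ _ f.left g.left h.left)
  comp_add _ _ _ f g h := hom_ext _ _ (Preadditive.comp_add _ _ _ f.left g.left h.left)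

variable [Linear k C] [Linear k M] [LeftActionLinear k C M] [RightActionLinear k C M]

instance (X Y : BiMod M A B) : Module k (X ⟶ Y) where
  smul r f := ⟨r • f.left, by
    change X.act ≫ (r • f.left.hom) = (r • f.left.hom) ⊵ᵣ B ≫ Y.act
    rw [RightActionLinear.smul_actionHomLeft]; simp [Hom.act_hom]⟩
  one_smul f := Hom.ext (one_smul k f.left)
  mul_smul r s f := Hom.ext (mul_smul r s f.left)
  smul_zero r := Hom.ext (smul_zero r)
  smul_add r f g := Hom.ext (smul_add r f.left g.left)
  add_smul r s f := Hom.ext (add_smul r s f.left)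
  zero_smul f := Hom.ext (zero_smul k f.left)

instance : Linear k (BiMod M A B) where
  smul_comp _ _ _ r f g := hom_ext _ _ (Linear.smul_comp _ _ _ r f.left g.left)
  comp_smul _ _ _ f r g := hom_ext _ _ (Linear.comp_smul _ _ _ f.left r g.left)

end Linear

end BiMod

end Bimodules

/-! ### Tensor products over algebras with duals of algebras -/

section TensorProducts

variable {C : Type u₁} [Category.{v₁} C] [MonoidalCategory C]
variable {M : Type u₂} [Category.{v₂} M] [HasCoequalizers M]

section LeftExact

open MonoidalLeftAction

variable [MonoidalLeftAction C M] [LeftActionRightExact C M]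

instance (c : C) : PreservesFiniteColimits (actionLeft M c) :=
  LeftActionRightExact.preserves_actionLeft c

instance (c : C) {P P' : M} (f : P ⟶ P') [Epi f] : Epi (c ⊴ₗ f) :=
  inferInstanceAs (Epi ((actionLeft M c).map f))

theorem actionHomRight_desc {c : C} {X Y Z : M} (f g : X ⟶ Y) (h : c ⊙ₗ Y ⟶ Z)
    (w : c ⊴ₗ f ≫ h = c ⊴ₗ g ≫ h) :
    c ⊴ₗ coequalizer.π f g ≫ (PreservesCoequalizer.iso (actionLeft M c) f g).inv ≫
      coequalizer.desc h w = h :=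
  map_π_preserves_coequalizer_inv_desc (actionLeft M c) f g h w

end LeftExact

section RightExact

open MonoidalRightAction

variable [MonoidalRightAction C M] [RightActionRightExact C M]

instance (c : C) : PreservesFiniteColimits (actionRight M c) :=
  RightActionRightExact.preserves_actionRight c

instance (c : C) {P P' : M} (f : P ⟶ P') [Epi f] : Epi (f ⊵ᵣ c) :=
  inferInstanceAs (Epi ((actionRight M c).map f))

theorem actionHomLeft_desc {c : C} {X Y Z : M} (f g : X ⟶ Y) (h : Y ⊙ᵣ c ⟶ Z)
    (w : f ⊵ᵣ c ≫ h = g ⊵ᵣ c ≫ h) :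
    coequalizer.π f g ⊵ᵣ c ≫ (PreservesCoequalizer.iso (actionRight M c) f g).inv ≫
      coequalizer.desc h w = h :=
  map_π_preserves_coequalizer_inv_desc (actionRight M c) f g h w

end RightExact

section Left

variable [MonoidalLeftAction C M] [RightRigidCategory C] (A : C) [MonObj A]

open MonoidalLeftAction

/-- The tensor product `A^∨ ⊗_A P`, for an object `P` with an action `p : A ⊗ P ⟶ P`. -/
noncomputable def dualTensor {P : M} (p : A ⊙ₗ P ⟶ P) : M :=
  coequalizer (ldual A ⊴ₗ p) ((αₗ (ldual A) A P).inv ≫ dualAct A ⊵ₗ P)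

/-- The projection `A^∨ ⊗ P ⟶ A^∨ ⊗_A P`. -/
noncomputable def dualTensorπ {P : M} (p : A ⊙ₗ P ⟶ P) : ldual A ⊙ₗ P ⟶ dualTensor A p :=
  coequalizer.π _ _

instance {P : M} (p : A ⊙ₗ P ⟶ P) : Epi (dualTensorπ A p) := by
  unfold dualTensorπ dualTensor; infer_instance

theorem dualTensor_condition {P : M} (p : A ⊙ₗ P ⟶ P) :
    ldual A ⊴ₗ p ≫ dualTensorπ A p =
      (αₗ (ldual A) A P).inv ≫ dualAct A ⊵ₗ P ≫ dualTensorπ A p := by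
  have h := coequalizer.condition (ldual A ⊴ₗ p) ((αₗ (ldual A) A P).inv ≫ dualAct A ⊵ₗ P)
  rw [Category.assoc] at h
  exact h

/-- The morphism of tensor products induced by a morphism commuting with the actions. -/
noncomputable def dualTensorMap {P P' : M} (p : A ⊙ₗ P ⟶ P) (p' : A ⊙ₗ P' ⟶ P') (f : P ⟶ P')
    (h : p ≫ f = A ⊴ₗ f ≫ p') : dualTensor A p ⟶ dualTensor A p' :=
  coequalizer.desc (ldual A ⊴ₗ f ≫ dualTensorπ A p') (by
    rw [← actionHomRight_comp_assoc, h, actionHomRight_comp_assoc, dualTensor_condition,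
      Category.assoc, ← action_exchange_assoc]
    simp)

theorem dualTensorπ_map {P P' : M} (p : A ⊙ₗ P ⟶ P) (p' : A ⊙ₗ P' ⟶ P') (f : P ⟶ P')
    (h : p ≫ f = A ⊴ₗ f ≫ p') :
    dualTensorπ A p ≫ dualTensorMap A p p' f h = ldual A ⊴ₗ f ≫ dualTensorπ A p' :=
  coequalizer.π_desc _ _

theorem dualTensorAct_condition {P : M} (p : A ⊙ₗ P ⟶ P) :
    ldual (ldual A) ⊴ₗ (ldual A ⊴ₗ p) ≫ (αₗ (ldual (ldual A)) (ldual A) P).inv ≫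
        dualBiact A ⊵ₗ P ≫ dualTensorπ A p =
      ldual (ldual A) ⊴ₗ ((αₗ (ldual A) A P).inv ≫ dualAct A ⊵ₗ P) ≫
        (αₗ (ldual (ldual A)) (ldual A) P).inv ≫ dualBiact A ⊵ₗ P ≫ dualTensorπ A p := by
  have h₁ : ldual (ldual A) ⊴ₗ ldual A ⊴ₗ p ≫ (αₗ (ldual (ldual A)) (ldual A) P).inv =
      (αₗ (ldual (ldual A)) (ldual A) (A ⊙ₗ P)).inv ≫ (ldual (ldual A) ⊗ ldual A) ⊴ₗ p := by
    simp
  have h₂ := congrArg (· ⊵ₗ P) (dualBiact_dualAct A)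
  simp only [comp_actionHomLeft, whiskerLeft_actionHomLeft, Category.assoc] at h₂
  rw [reassoc_of% h₁, action_exchange_assoc, dualTensor_condition, actionHomLeft_action]
  simp only [Category.assoc, Iso.hom_inv_id_assoc]
  rw [reassoc_of% h₂]
  have h₃ := actionAssoc_left (ldual (ldual A)) (ldual A) A P
  rw [← cancel_epi (ldual (ldual A) ⊴ₗ (αₗ (ldual A) A P).inv)] at h₃
  simp only [actionHomRight_inv_hom_assoc] at h₃
  rw [reassoc_of% h₃]
  simp

variable [LeftActionRightExact C M]

/-- The left action of `A^∨∨` on `A^∨ ⊗_A P`, induced by the action of `A^∨∨` on `A^∨`. -/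
noncomputable def dualTensorAct {P : M} (p : A ⊙ₗ P ⟶ P) :
    ldual (ldual A) ⊙ₗ dualTensor A p ⟶ dualTensor A p :=
  (PreservesCoequalizer.iso (actionLeft M (ldual (ldual A))) _ _).inv ≫
    coequalizer.desc ((αₗ (ldual (ldual A)) (ldual A) P).inv ≫
      dualBiact A ⊵ₗ P ≫ dualTensorπ A p) (dualTensorAct_condition A p)

theorem dualTensorπ_act {P : M} (p : A ⊙ₗ P ⟶ P) :
    ldual (ldual A) ⊴ₗ dualTensorπ A p ≫ dualTensorAct A p =
      (αₗ (ldual (ldual A)) (ldual A) P).inv ≫ dualBiact A ⊵ₗ P ≫ dualTensorπ A p :=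
  actionHomRight_desc _ _ _ _

end Left

section Right

variable [MonoidalRightAction C M] [LeftRigidCategory C] (B : C) [MonObj B]

open MonoidalRightAction

/-- The tensor product `P ⊗_B ^∨B`, for an object `P` with an action `b : P ⊗ B ⟶ P`. -/
noncomputable def codualTensor {P : M} (b : P ⊙ᵣ B ⟶ P) : M :=
  coequalizer (b ⊵ᵣ rdual B) ((αᵣ P B (rdual B)).inv ≫ P ⊴ᵣ codualAct B)

/-- The projection `P ⊗ ^∨B ⟶ P ⊗_B ^∨B`. -/
noncomputable def codualTensorπ {P : M} (b : P ⊙ᵣ B ⟶ P) : P ⊙ᵣ rdual B ⟶ codualTensor B b :=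
  coequalizer.π _ _

instance {P : M} (b : P ⊙ᵣ B ⟶ P) : Epi (codualTensorπ B b) := by
  unfold codualTensorπ codualTensor; infer_instance

theorem codualTensor_condition {P : M} (b : P ⊙ᵣ B ⟶ P) :
    b ⊵ᵣ rdual B ≫ codualTensorπ B b =
      (αᵣ P B (rdual B)).inv ≫ P ⊴ᵣ codualAct B ≫ codualTensorπ B b := by
  have h := coequalizer.condition (b ⊵ᵣ rdual B) ((αᵣ P B (rdual B)).inv ≫ P ⊴ᵣ codualAct B)
  rw [Category.assoc] at h
  exact h

/-- The morphism of tensor products induced by a morphism commuting with the actions. -/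
noncomputable def codualTensorMap {P P' : M} (b : P ⊙ᵣ B ⟶ P) (b' : P' ⊙ᵣ B ⟶ P') (f : P ⟶ P')
    (h : b ≫ f = f ⊵ᵣ B ≫ b') : codualTensor B b ⟶ codualTensor B b' :=
  coequalizer.desc (f ⊵ᵣ rdual B ≫ codualTensorπ B b') (by
    rw [← comp_actionHomLeft_assoc, h, comp_actionHomLeft_assoc, codualTensor_condition,
      Category.assoc, action_exchange_assoc]
    simp)

theorem codualTensorπ_map {P P' : M} (b : P ⊙ᵣ B ⟶ P) (b' : P' ⊙ᵣ B ⟶ P') (f : P ⟶ P')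
    (h : b ≫ f = f ⊵ᵣ B ≫ b') :
    codualTensorπ B b ≫ codualTensorMap B b b' f h = f ⊵ᵣ rdual B ≫ codualTensorπ B b' :=
  coequalizer.π_desc _ _

theorem codualTensorAct_condition {P : M} (b : P ⊙ᵣ B ⟶ P) :
    (b ⊵ᵣ rdual B) ⊵ᵣ rdual (rdual B) ≫ (αᵣ P (rdual B) (rdual (rdual B))).inv ≫
        P ⊴ᵣ codualBiact B ≫ codualTensorπ B b =
      ((αᵣ P B (rdual B)).inv ≫ P ⊴ᵣ codualAct B) ⊵ᵣ rdual (rdual B) ≫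
        (αᵣ P (rdual B) (rdual (rdual B))).inv ≫ P ⊴ᵣ codualBiact B ≫ codualTensorπ B b := by
  have h₁ : (b ⊵ᵣ rdual B) ⊵ᵣ rdual (rdual B) ≫ (αᵣ P (rdual B) (rdual (rdual B))).inv =
      (αᵣ (P ⊙ᵣ B) (rdual B) (rdual (rdual B))).inv ≫ b ⊵ᵣ (rdual B ⊗ rdual (rdual B)) := by
    simp
  have h₂ := congrArg (P ⊴ᵣ ·) (codualAct_codualBiact B)
  simp only [actionHomRight_comp, actionHomRight_whiskerRight, Category.assoc] at h₂
  rw [reassoc_of% h₁, ← action_exchange_assoc, codualTensor_condition, action_actionHomRight]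
  simp only [Category.assoc, Iso.hom_inv_id_assoc]
  rw [reassoc_of% h₂]
  have h₃ := actionAssoc_right B (rdual B) (rdual (rdual B)) P
  rw [← cancel_epi ((αᵣ P B (rdual B)).inv ⊵ᵣ rdual (rdual B))] at h₃
  simp only [inv_hom_actionHomLeft_assoc] at h₃
  rw [reassoc_of% h₃]
  simp

variable [RightActionRightExact C M]

/-- The right action of `^∨∨B` on `P ⊗_B ^∨B`, induced by the action of `^∨∨B` on `^∨B`. -/
noncomputable def codualTensorAct {P : M} (b : P ⊙ᵣ B ⟶ P) :
    codualTensor B b ⊙ᵣ rdual (rdual B) ⟶ codualTensor B b :=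
  (PreservesCoequalizer.iso (actionRight M (rdual (rdual B))) _ _).inv ≫
    coequalizer.desc ((αᵣ P (rdual B) (rdual (rdual B))).inv ≫
      P ⊴ᵣ codualBiact B ≫ codualTensorπ B b) (codualTensorAct_condition B b)

theorem codualTensorπ_act {P : M} (b : P ⊙ᵣ B ⟶ P) :
    codualTensorπ B b ⊵ᵣ rdual (rdual B) ≫ codualTensorAct B b =
      (αᵣ P (rdual B) (rdual (rdual B))).inv ≫ P ⊴ᵣ codualBiact B ≫ codualTensorπ B b :=
  actionHomLeft_desc _ _ _ _

end Right

section Bi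

variable [MonoidalLeftAction C M] [MonoidalRightAction C M] [BimoduleCategory C M]

theorem dualTensorRightAct_condition [RightRigidCategory C]
    (A : C) [MonObj A] {Y : C} {P : M} (p : A ⊙ₗ P ⟶ P) (r : P ⊙ᵣ Y ⟶ P)
    (h : (middle A P Y).hom ≫ A ⊴ₗ r ≫ p = p ⊵ᵣ Y ≫ r) :
    (ldual A ⊴ₗ p) ⊵ᵣ Y ≫ (middle (ldual A) P Y).hom ≫ ldual A ⊴ₗ r ≫ dualTensorπ A p =
      ((αₗ (ldual A) A P).inv ≫ dualAct A ⊵ₗ P) ⊵ᵣ Y ≫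
        (middle (ldual A) P Y).hom ≫ ldual A ⊴ₗ r ≫ dualTensorπ A p := by
  rw [reassoc_of% middle_naturality_middle (ldual A) p Y,
    ← MonoidalLeftAction.actionHomRight_comp_assoc, ← h,
    MonoidalLeftAction.actionHomRight_comp_assoc,
    MonoidalLeftAction.actionHomRight_comp_assoc, dualTensor_condition]
  have h₁ := pentagon_left (ldual A) A P Y
  rw [← cancel_epi ((αₗ (ldual A) A P).inv ⊵ᵣ Y)] at h₁
  simp only [MonoidalRightAction.inv_hom_actionHomLeft_assoc] at h₁
  rw [reassoc_of% h₁]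
  simp only [MonoidalRightAction.comp_actionHomLeft, Category.assoc]
  rw [reassoc_of% middle_naturality_left (dualAct A) P Y]
  have h₂ : (αₗ (ldual A) A (P ⊙ᵣ Y)).hom ≫ ldual A ⊴ₗ A ⊴ₗ r ≫
      (αₗ (ldual A) A P).inv = (ldual A ⊗ A) ⊴ₗ r := by
    simp
  rw [reassoc_of% h₂, MonoidalLeftAction.action_exchange_assoc]

/-- The right action on `A^∨ ⊗_A P` induced by a right action on `P` commuting with the left
action of `A`. -/
noncomputable def dualTensorRightAct [RightRigidCategory C] [RightActionRightExact C M]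
    (A : C) [MonObj A] {Y : C} {P : M} (p : A ⊙ₗ P ⟶ P) (r : P ⊙ᵣ Y ⟶ P)
    (h : (middle A P Y).hom ≫ A ⊴ₗ r ≫ p = p ⊵ᵣ Y ≫ r) :
    dualTensor A p ⊙ᵣ Y ⟶ dualTensor A p :=
  (PreservesCoequalizer.iso (MonoidalRightAction.actionRight M Y) _ _).inv ≫
    coequalizer.desc ((middle (ldual A) P Y).hom ≫ ldual A ⊴ₗ r ≫ dualTensorπ A p)
      (dualTensorRightAct_condition A p r h)

theorem dualTensorπ_rightAct [RightRigidCategory C] [RightActionRightExact C M]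
    (A : C) [MonObj A] {Y : C} {P : M} (p : A ⊙ₗ P ⟶ P) (r : P ⊙ᵣ Y ⟶ P)
    (h : (middle A P Y).hom ≫ A ⊴ₗ r ≫ p = p ⊵ᵣ Y ≫ r) :
    dualTensorπ A p ⊵ᵣ Y ≫ dualTensorRightAct A p r h =
      (middle (ldual A) P Y).hom ≫ ldual A ⊴ₗ r ≫ dualTensorπ A p :=
  actionHomLeft_desc _ _ _ _

theorem codualTensorLeftAct_condition [LeftRigidCategory C]
    (B : C) [MonObj B] {X : C} {P : M} (b : P ⊙ᵣ B ⟶ P) (l : X ⊙ₗ P ⟶ P)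
    (h : (middle X P B).hom ≫ X ⊴ₗ b ≫ l = l ⊵ᵣ B ≫ b) :
    X ⊴ₗ (b ⊵ᵣ rdual B) ≫ (middle X P (rdual B)).inv ≫ l ⊵ᵣ rdual B ≫ codualTensorπ B b =
      X ⊴ₗ ((αᵣ P B (rdual B)).inv ≫ P ⊴ᵣ codualAct B) ≫
        (middle X P (rdual B)).inv ≫ l ⊵ᵣ rdual B ≫ codualTensorπ B b := by
  have h₁ : X ⊴ₗ (b ⊵ᵣ rdual B) ≫ (middle X P (rdual B)).inv =
      (middle X (P ⊙ᵣ B) (rdual B)).inv ≫ (X ⊴ₗ b) ⊵ᵣ rdual B := by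
    rw [Iso.comp_inv_eq, Category.assoc, Iso.eq_inv_comp]
    exact (middle_naturality_middle X b (rdual B)).symm
  have h₂ : X ⊴ₗ (P ⊴ᵣ codualAct B) ≫ (middle X P (rdual B)).inv =
      (middle X P (B ⊗ rdual B)).inv ≫ (X ⊙ₗ P) ⊴ᵣ codualAct B := by
    rw [Iso.comp_inv_eq, Category.assoc, Iso.eq_inv_comp]
    exact (middle_naturality_right X P (codualAct B)).symm
  have h₃ := pentagon_right X P B (rdual B)
  have h₄ : (αᵣ (X ⊙ₗ P) B (rdual B)).inv ≫ (middle X P (B ⊗ rdual B)).hom =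
      (middle X P B).hom ⊵ᵣ rdual B ≫ (middle X (P ⊙ᵣ B) (rdual B)).hom ≫
        X ⊴ₗ (αᵣ P B (rdual B)).inv := by
    rw [Iso.inv_comp_eq, ← cancel_mono (X ⊴ₗ (αᵣ P B (rdual B)).hom), h₃]
    simp
  rw [reassoc_of% h₁, MonoidalLeftAction.actionHomRight_comp_assoc, reassoc_of% h₂,
    MonoidalRightAction.action_exchange_assoc, ← cancel_epi (middle X (P ⊙ᵣ B) (rdual B)).hom,
    ← cancel_epi ((middle X P B).hom ⊵ᵣ rdual B), ← reassoc_of% h₄, Iso.hom_inv_id_assoc,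
    Iso.hom_inv_id_assoc, ← MonoidalRightAction.comp_actionHomLeft_assoc,
    ← MonoidalRightAction.comp_actionHomLeft_assoc, Category.assoc, h,
    MonoidalRightAction.comp_actionHomLeft_assoc, codualTensor_condition]
  simp

/-- The left action on `P ⊗_B ^∨B` induced by a left action on `P` commuting with the right
action of `B`. -/
noncomputable def codualTensorLeftAct [LeftRigidCategory C] [LeftActionRightExact C M]
    (B : C) [MonObj B] {X : C} {P : M} (b : P ⊙ᵣ B ⟶ P) (l : X ⊙ₗ P ⟶ P)
    (h : (middle X P B).hom ≫ X ⊴ₗ b ≫ l = l ⊵ᵣ B ≫ b) :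
    X ⊙ₗ codualTensor B b ⟶ codualTensor B b :=
  (PreservesCoequalizer.iso (MonoidalLeftAction.actionLeft M X) _ _).inv ≫
    coequalizer.desc ((middle X P (rdual B)).inv ≫ l ⊵ᵣ rdual B ≫ codualTensorπ B b)
      (codualTensorLeftAct_condition B b l h)

theorem codualTensorπ_leftAct [LeftRigidCategory C] [LeftActionRightExact C M]
    (B : C) [MonObj B] {X : C} {P : M} (b : P ⊙ᵣ B ⟶ P) (l : X ⊙ₗ P ⟶ P)
    (h : (middle X P B).hom ≫ X ⊴ₗ b ≫ l = l ⊵ᵣ B ≫ b) :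
    X ⊴ₗ codualTensorπ B b ≫ codualTensorLeftAct B b l h =
      (middle X P (rdual B)).inv ≫ l ⊵ᵣ rdual B ≫ codualTensorπ B b :=
  actionHomRight_desc _ _ _ _

/-- The action of `A^∨∨` on `A^∨ ⊗_A P` commutes with the induced right action. -/
theorem dualTensorAct_rightAct [RightRigidCategory C] [LeftActionRightExact C M]
    [RightActionRightExact C M]
    (A : C) [MonObj A] {Y : C} {P : M} (p : A ⊙ₗ P ⟶ P) (r : P ⊙ᵣ Y ⟶ P)
    (h : (middle A P Y).hom ≫ A ⊴ₗ r ≫ p = p ⊵ᵣ Y ≫ r) :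
    (middle (ldual (ldual A)) (dualTensor A p) Y).hom ≫
        ldual (ldual A) ⊴ₗ dualTensorRightAct A p r h ≫ dualTensorAct A p =
      dualTensorAct A p ⊵ᵣ Y ≫ dualTensorRightAct A p r h := by
  rw [← cancel_epi ((ldual (ldual A) ⊴ₗ dualTensorπ A p) ⊵ᵣ Y),
    reassoc_of% middle_naturality_middle (ldual (ldual A)) (dualTensorπ A p) Y,
    ← MonoidalRightAction.comp_actionHomLeft_assoc, dualTensorπ_act,
    ← MonoidalLeftAction.actionHomRight_comp_assoc, dualTensorπ_rightAct]
  simp only [MonoidalRightAction.comp_actionHomLeft, MonoidalLeftAction.actionHomRight_comp,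
    Category.assoc]
  rw [dualTensorπ_act, dualTensorπ_rightAct]
  have h₁ := pentagon_left (ldual (ldual A)) (ldual A) P Y
  rw [← cancel_epi ((αₗ (ldual (ldual A)) (ldual A) P).inv ⊵ᵣ Y)] at h₁
  simp only [MonoidalRightAction.inv_hom_actionHomLeft_assoc] at h₁
  rw [reassoc_of% h₁, reassoc_of% middle_naturality_left (dualBiact A) P Y]
  have h₂ : (αₗ (ldual (ldual A)) (ldual A) (P ⊙ᵣ Y)).hom ≫ ldual (ldual A) ⊴ₗ ldual A ⊴ₗ r ≫
      (αₗ (ldual (ldual A)) (ldual A) P).inv = (ldual (ldual A) ⊗ ldual A) ⊴ₗ r := by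
    simp
  rw [reassoc_of% h₂, MonoidalLeftAction.action_exchange_assoc]

end Bi

end TensorProducts

/-! ### The tensor product functors -/

section TensorFunctors

variable {C : Type u₁} [Category.{v₁} C] [MonoidalCategory C]
variable {M : Type u₂} [Category.{v₂} M] [HasCoequalizers M]

section Left

variable [MonoidalLeftAction C M] [RightRigidCategory C] (A : C) [MonObj A]

/-- The functor `P ↦ A^∨ ⊗_A P` from left `A`-modules to `M`. -/
noncomputable def dualTensorFunctor : Mod M A ⥤ M where
  obj P := dualTensor A γ[P.X]
  map {P P'} f := dualTensorMap A γ[P.X] γ[P'.X] f.hom (by simp)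
  map_id P := by
    rw [← cancel_epi (dualTensorπ A γ[P.X]), dualTensorπ_map]; simp
  map_comp {P P' P''} f g := by
    rw [← cancel_epi (dualTensorπ A γ[P.X]), dualTensorπ_map, reassoc_of% dualTensorπ_map,
      dualTensorπ_map]
    simp

end Left

section Right

variable [MonoidalRightAction C M] [LeftRigidCategory C] (B : C) [MonObj B]

/-- The functor `P ↦ P ⊗_B ^∨B` from right `B`-modules to `M`. -/
noncomputable def codualTensorFunctor : RightMod M B ⥤ M where
  obj P := codualTensor B P.act
  map {P P'} f := codualTensorMap B P.act P'.act f.hom f.act_hom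
  map_id P := by
    rw [← cancel_epi (codualTensorπ B P.act), codualTensorπ_map]; simp
  map_comp {P P' P''} f g := by
    rw [← cancel_epi (codualTensorπ B P.act), codualTensorπ_map, reassoc_of% codualTensorπ_map,
      codualTensorπ_map]
    simp

end Right

section Bi

variable [MonoidalLeftAction C M] [MonoidalRightAction C M] [BimoduleCategory C M]
  [RigidCategory C] {A B : C} [MonObj A] [MonObj B]

namespace BiMod

/-- The morphism `A^∨ ⊗_A P ⟶ A^∨ ⊗_A P'` induced by a morphism of bimodules. -/
noncomputable def innerMap {P P' : BiMod M A B} (f : P ⟶ P') :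
    dualTensor A γ[P.left.X] ⟶ dualTensor A γ[P'.left.X] :=
  dualTensorMap A γ[P.left.X] γ[P'.left.X] f.left.hom (by simp)

theorem innerMap_id (P : BiMod M A B) : innerMap (𝟙 P) = 𝟙 _ :=
  (dualTensorFunctor A).map_id P.left

theorem innerMap_comp {P P' P'' : BiMod M A B} (f : P ⟶ P') (g : P' ⟶ P'') :
    innerMap (f ≫ g) = innerMap f ≫ innerMap g :=
  (dualTensorFunctor A).map_comp f.left g.left

variable [RightActionRightExact C M]

/-- The right action of `B` on `A^∨ ⊗_A P`, for an `A`-`B`-bimodule `P`. -/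
noncomputable def innerAct (P : BiMod M A B) :
    dualTensor A γ[P.left.X] ⊙ᵣ B ⟶ dualTensor A γ[P.left.X] :=
  dualTensorRightAct A γ[P.left.X] P.act P.comm

/-- The object `(A^∨ ⊗_A P) ⊗_B ^∨B`, for an `A`-`B`-bimodule `P`. -/
noncomputable def biTensor (P : BiMod M A B) : M :=
  codualTensor B P.innerAct

/-- The left action of `A^∨∨` on `(A^∨ ⊗_A P) ⊗_B ^∨B`. -/
noncomputable def biTensorLeftAct [LeftActionRightExact C M] (P : BiMod M A B) :
    ldual (ldual A) ⊙ₗ P.biTensor ⟶ P.biTensor :=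
  codualTensorLeftAct B P.innerAct (dualTensorAct A γ[P.left.X])
    (dualTensorAct_rightAct A γ[P.left.X] P.act P.comm)

/-- The right action of `^∨∨B` on `(A^∨ ⊗_A P) ⊗_B ^∨B`. -/
noncomputable def biTensorRightAct (P : BiMod M A B) :
    P.biTensor ⊙ᵣ rdual (rdual B) ⟶ P.biTensor :=
  codualTensorAct B P.innerAct

theorem innerAct_map {P P' : BiMod M A B} (f : P ⟶ P') :
    P.innerAct ≫ innerMap f = innerMap f ⊵ᵣ B ≫ P'.innerAct := by
  rw [← cancel_epi (dualTensorπ A γ[P.left.X] ⊵ᵣ B)]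
  simp only [innerAct, innerMap]
  rw [reassoc_of% dualTensorπ_rightAct, ← MonoidalRightAction.comp_actionHomLeft_assoc,
    dualTensorπ_map, MonoidalRightAction.comp_actionHomLeft_assoc, dualTensorπ_rightAct,
    reassoc_of% middle_naturality_middle (ldual A) f.left.hom B,
    ← MonoidalLeftAction.actionHomRight_comp_assoc,
    ← MonoidalLeftAction.actionHomRight_comp_assoc, f.act_hom]

/-- The morphism `(A^∨ ⊗_A P) ⊗_B ^∨B ⟶ (A^∨ ⊗_A P') ⊗_B ^∨B` induced by a morphism of
bimodules. -/
noncomputable def biTensorMap {P P' : BiMod M A B} (f : P ⟶ P') : P.biTensor ⟶ P'.biTensor :=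
  codualTensorMap B P.innerAct P'.innerAct (innerMap f) (innerAct_map f)

theorem biTensorMap_id (P : BiMod M A B) : biTensorMap (𝟙 P) = 𝟙 P.biTensor := by
  simp only [biTensorMap, biTensor]
  rw [← cancel_epi (codualTensorπ B P.innerAct), codualTensorπ_map, innerMap_id]
  simp

theorem biTensorMap_comp {P P' P'' : BiMod M A B} (f : P ⟶ P') (g : P' ⟶ P'') :
    biTensorMap (f ≫ g) = biTensorMap f ≫ biTensorMap g := by
  simp only [biTensorMap, biTensor]
  rw [← cancel_epi (codualTensorπ B P.innerAct), codualTensorπ_map,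
    reassoc_of% codualTensorπ_map, codualTensorπ_map, innerMap_comp,
    MonoidalRightAction.comp_actionHomLeft, Category.assoc]

end BiMod

variable [RightActionRightExact C M]

variable (A B) in
/-- The functor `P ↦ (A^∨ ⊗_A P) ⊗_B ^∨B` from `A`-`B`-bimodules to `M`. -/
noncomputable def biTensorFunctor : BiMod M A B ⥤ M where
  obj P := P.biTensor
  map f := BiMod.biTensorMap f
  map_id P := BiMod.biTensorMap_id P
  map_comp f g := BiMod.biTensorMap_comp f g

end Bi

end TensorFunctors

/-! ### Lifting functors to categories of modules -/

section Lifts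

variable {C : Type u₁} [Category.{v₁} C] [MonoidalCategory C]
variable {M : Type u₂} [Category.{v₂} M]
variable {D : Type u₃} [Category.{v₃} D]

section Left

variable [MonoidalLeftAction C M] {A : C} [MonObj A]

/-- A family of morphisms `A ⊗ F d ⟶ F d` satisfies the axioms of a left action of `A`, and is
natural in `d`. -/
structure IsLeftActionOn (F : D ⥤ M) (a : ∀ d, A ⊙ₗ F.obj d ⟶ F.obj d) : Prop where
  one (d : D) : η[A] ⊵ₗ F.obj d ≫ a d = (λₗ (F.obj d)).hom
  mul (d : D) : μ[A] ⊵ₗ F.obj d ≫ a d = (αₗ A A (F.obj d)).hom ≫ A ⊴ₗ a d ≫ a d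
  natural {d d' : D} (f : d ⟶ d') : a d ≫ F.map f = A ⊴ₗ F.map f ≫ a d'

/-- The functor `d ↦ (F d, a d)` to left `A`-modules. -/
def IsLeftActionOn.lift {F : D ⥤ M} {a : ∀ d, A ⊙ₗ F.obj d ⟶ F.obj d}
    (h : IsLeftActionOn F a) : D ⥤ Mod M A where
  obj d :=
    { X := F.obj d
      mod :=
        { smul := a d
          one_smul := h.one d
          mul_smul := h.mul d } }
  map {d d'} f :=
    letI : ModObj A (F.obj d) := ⟨a d, h.one d, h.mul d⟩
    letI : ModObj A (F.obj d') := ⟨a d', h.one d', h.mul d'⟩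
    Mod.Hom.mk' (F.map f) (h.natural f)

end Left

section Right

variable [MonoidalRightAction C M] {B : C} [MonObj B]

/-- A family of morphisms `F d ⊗ B ⟶ F d` satisfies the axioms of a right action of `B`, and is
natural in `d`. -/
structure IsRightActionOn (F : D ⥤ M) (b : ∀ d, F.obj d ⊙ᵣ B ⟶ F.obj d) : Prop where
  one (d : D) : F.obj d ⊴ᵣ η[B] ≫ b d = (ρᵣ (F.obj d)).hom
  mul (d : D) : F.obj d ⊴ᵣ μ[B] ≫ b d = (αᵣ (F.obj d) B B).hom ≫ b d ⊵ᵣ B ≫ b d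
  natural {d d' : D} (f : d ⟶ d') : b d ≫ F.map f = F.map f ⊵ᵣ B ≫ b d'

/-- The functor `d ↦ (F d, b d)` to right `B`-modules. -/
def IsRightActionOn.lift {F : D ⥤ M} {b : ∀ d, F.obj d ⊙ᵣ B ⟶ F.obj d}
    (h : IsRightActionOn F b) : D ⥤ RightMod M B where
  obj d := ⟨F.obj d, b d, h.one d, h.mul d⟩
  map f := ⟨F.map f, h.natural f⟩

end Right

section Bi

variable [MonoidalLeftAction C M] [MonoidalRightAction C M] [BimoduleCategory C M]
  {A B : C} [MonObj A] [MonObj B]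

/-- A left action of `A` and a right action of `B` which commute with each other. -/
structure IsBiactionOn (F : D ⥤ M) (a : ∀ d, A ⊙ₗ F.obj d ⟶ F.obj d)
    (b : ∀ d, F.obj d ⊙ᵣ B ⟶ F.obj d) : Prop where
  left : IsLeftActionOn F a
  right : IsRightActionOn F b
  comm (d : D) : (middle A (F.obj d) B).hom ≫ A ⊴ₗ b d ≫ a d = a d ⊵ᵣ B ≫ b d

/-- The functor `d ↦ (F d, a d, b d)` to `A`-`B`-bimodules. -/
def IsBiactionOn.lift {F : D ⥤ M} {a : ∀ d, A ⊙ₗ F.obj d ⟶ F.obj d}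
    {b : ∀ d, F.obj d ⊙ᵣ B ⟶ F.obj d} (h : IsBiactionOn F a b) : D ⥤ BiMod M A B where
  obj d := ⟨h.left.lift.obj d, b d, h.right.one d, h.right.mul d, h.comm d⟩
  map f := ⟨h.left.lift.map f, h.right.natural f⟩

end Bi

end Lifts

/-! ### The module structures on the values of the Nakayama functor -/

section Twists

variable (k : Type u) [Field k]
variable {C : Type u₁} [Category.{v₁} C] [Preadditive C] [Linear k C] [MonoidalCategory C]
  [RigidCategory C]
variable {M : Type u₂} [Category.{v₂} M] [Preadditive M] [Linear k M]
variable {N : M ⥤ M} (S : NakayamaStructure k N)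

section Left

variable [MonoidalLeftAction C M] [LeftActionPreadditive C M] [LeftActionLinear k C M]

/-- The canonical morphism `X ⊗ N P ⟶ N (X^∨∨ ⊗ P)`. -/
def leftTwist (X : C) (P : M) : X ⊙ₗ N.obj P ⟶ N.obj (ldual (ldual X) ⊙ₗ P) :=
  can k (leftActionAdj M (ldual X) (ldual (ldual X))) (leftActionAdj M X (ldual X))
    (leftActionAdj M (rdual X) X) S S P

/-- The morphism `A ⊗ N Q ⟶ N (A^∨∨ ⊗ Q) ⟶ N Q` induced by `A^∨∨ ⊗ Q ⟶ Q`. -/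
def nakayamaLeftAct (A : C) {Q : M} (q : ldual (ldual A) ⊙ₗ Q ⟶ Q) :
    A ⊙ₗ N.obj Q ⟶ N.obj Q :=
  leftTwist k S A Q ≫ N.map q

end Left

section Right

variable [MonoidalRightAction C M] [RightActionPreadditive C M] [RightActionLinear k C M]

/-- The canonical morphism `N P ⊗ X ⟶ N (P ⊗ ^∨∨X)`. -/
def rightTwist (X : C) (P : M) : N.obj P ⊙ᵣ X ⟶ N.obj (P ⊙ᵣ rdual (rdual X)) :=
  can k (rightActionAdj M (rdual (rdual X)) (rdual X)) (rightActionAdj M (rdual X) X)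
    (rightActionAdj M X (ldual X)) S S P

/-- The morphism `N Q ⊗ B ⟶ N (Q ⊗ ^∨∨B) ⟶ N Q` induced by `Q ⊗ ^∨∨B ⟶ Q`. -/
def nakayamaRightAct (B : C) {Q : M} (q : Q ⊙ᵣ rdual (rdual B) ⟶ Q) :
    N.obj Q ⊙ᵣ B ⟶ N.obj Q :=
  rightTwist k S B Q ≫ N.map q

end Right

end Twists

end NakayamaModules

open NakayamaModules

namespace NakayamaModules

open BimoduleCategory

/-! ### Uniqueness of Nakayama functors -/

section Uniqueness

variable {k : Type u} [Field k]
variable {M : Type u₁} [Category.{v₁} M] [Preadditive M] [Linear k M]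

/-! Let E be one of the three module categories and U : E ⟶ M its forgetful functor. It ends a chain
G ⊣ F ⊣ U, where F is the free module functor and G is the functor A^∨ ⊗_A -, - ⊗_B ^∨B, or both.
Indeed A ⊗ - is right adjoint to A^∨ ⊗ -, and module morphisms P ⟶ A ⊗ Y correspond to balanced
morphisms A^∨ ⊗ P ⟶ Y.

For such a chain, Hom(P, F Y) ≅ Hom(G P, Y) and Hom(F Y, Z) ≅ Hom(Y, U Z) turn a dinatural family on
E from P to Z into one on M from G P to U Z. So N(G P) is the natural candidate for the object
underlying the Nakayama functor of E. Its structure morphisms U Q ⟶ N(G P) are given by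
`relCowedge`: a functional on Hom(P, Q) is pulled back along Hom(G P, U Q) ≅ Hom(P, F U Q) ⟶ Hom(P,
Q). In the left case this map is a trace over A: in terms of elements and dual bases, f goes to p ↦
∑ e_i f(e^i ⊗ p).

What remains is linearity over the algebras. The core is that `relCowedge` intertwines the action on
Q with the action on N(G P) defined through `can`. The characterisation of `can`, naturality and
dinaturality reduce this to an identity for the trace (`cowedge_nakayamaLeftAct`), which holds
because the action of A^∨∨ on A^∨ is the double transpose of multiplication (`leftCoev_mul`,
`dualTensorUnit_mul`).

The rest is formal. The morphisms `relCowedge` are jointly epimorphic (`relCowedge_hom_ext`) and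
stay so under the actions of objects of C, because C is rigid. Hence the action axioms on N(G P),
the commutation of the two actions and the linearity of induced morphisms are inherited from the
modules Q, and `NakayamaStructure.nonempty_of_adjunctions` applies. For bimodules the chain is a
composite of two chains through right modules, and the additional input is the compatibility of the
middle associativity with evaluation and coevaluation.

Existence of N on M: for modules over R the coend is Hom(X, R)^*, since a dinatural family is
determined by its component at R. This is transported along an equivalence e, using the chain e ⊣
e⁻¹ ⊣ e. -/

theorem NakayamaStructure.hom_ext {N : M ⥤ M} (S : NakayamaStructure k N) {X Z : M}
    {g g' : N.obj X ⟶ Z}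
    (h : ∀ (Y : M) (ξ : Module.Dual k (X ⟶ Y)),
      (S.cowedge X).app Y ξ ≫ g = (S.cowedge X).app Y ξ ≫ g') : g = g' := by
  -- The universal family followed by `g'`: both morphisms solve its factorisation problem.
  let w : NakayamaCowedge k X Z :=
    { app := fun Y => Linear.rightComp k Y g' ∘ₗ (S.cowedge X).app Y
      dinatural := fun f ξ => by simp [(S.cowedge X).dinatural] }
  rw [S.uniq w g h, S.uniq w g' fun _ _ => rfl]

/-- Two Nakayama functors of the same category are isomorphic. -/
def NakayamaStructure.iso {N N' : M ⥤ M} (S : NakayamaStructure k N)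
    (S' : NakayamaStructure k N') : N ≅ N' :=
  NatIso.ofComponents
    (fun X =>
      { hom := S.desc (S'.cowedge X)
        inv := S'.desc (S.cowedge X)
        hom_inv_id := S.hom_ext fun Y ξ => by rw [reassoc_of% S.fac, S'.fac, Category.comp_id]
        inv_hom_id := S'.hom_ext fun Y ξ => by rw [reassoc_of% S'.fac, S.fac, Category.comp_id] })
    (fun f => S.hom_ext fun Y ξ => by
      rw [reassoc_of% S.natural, S.fac, reassoc_of% S.fac, S'.natural])

end Uniqueness

/-! ### Nakayama functors and chains of adjunctions -/

/-! ### Descent of a Nakayama structure along `G ⊣ F ⊣ U` -/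

section Relative

variable {k : Type u} [Field k]
variable {E : Type u₁} [Category.{v₁} E] [Preadditive E] [Linear k E]
variable {M : Type u₂} [Category.{v₂} M] [Preadditive M] [Linear k M]
variable {G : E ⥤ M} {F : M ⥤ E} {U : E ⥤ M} (a₁ : G ⊣ F) (a₂ : F ⊣ U)
variable [F.Additive] [F.Linear k] {N : M ⥤ M} (S : NakayamaStructure k N)

/-- By the triangle identity of `F ⊣ U`, the comparison map loses nothing on free targets: there it
restricts to the bijection of `G ⊣ F`. -/
theorem adjComp_comp_unit {P : E} {Y : M} (h : G.obj P ⟶ Y) :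
    adjComp k a₁ a₂ P (F.obj Y) (h ≫ a₂.unit.app Y) = a₁.homEquiv _ _ h := by
  simp [adjComp, Adjunction.homEquiv_unit]

/-- The morphism `U Q ⟶ N (G P)` attached to a functional on `Hom(P, Q)`, for `G ⊣ F ⊣ U`. -/
def relCowedge (P Q : E) : Module.Dual k (P ⟶ Q) →ₗ[k] (U.obj Q ⟶ N.obj (G.obj P)) :=
  (S.cowedge (G.obj P)).app (U.obj Q) ∘ₗ LinearMap.lcomp k k (adjComp k a₁ a₂ P Q)

theorem relCowedge_apply (P Q : E) (ξ : Module.Dual k (P ⟶ Q)) :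
    relCowedge a₁ a₂ S P Q ξ =
      (S.cowedge (G.obj P)).app (U.obj Q) (ξ ∘ₗ adjComp k a₁ a₂ P Q) := rfl

theorem relCowedge_dinatural (P : E) {Q Q' : E} (f : Q ⟶ Q') (ξ : Module.Dual k (P ⟶ Q')) :
    relCowedge a₁ a₂ S P Q (ξ ∘ₗ Linear.rightComp k P f) =
      U.map f ≫ relCowedge a₁ a₂ S P Q' ξ := by
  rw [relCowedge_apply, relCowedge_apply, ← NakayamaCowedge.dinatural]
  congr 1
  ext h
  simp [adjComp]

/-- Serves twice: for the naturality in `P` of the action on `N (G P)`, and for the functoriality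
condition of the new Nakayama structure. -/
theorem relCowedge_natural {P P' : E} (f : P ⟶ P') (Q : E) (ξ : Module.Dual k (P ⟶ Q)) :
    relCowedge a₁ a₂ S P Q ξ ≫ N.map (G.map f) =
      relCowedge a₁ a₂ S P' Q (ξ ∘ₗ Linear.leftComp k Q f) := by
  rw [relCowedge_apply, relCowedge_apply, S.natural]
  congr 1
  ext h
  simp [adjComp]

/-- The bijection `Hom(G P, Y) ≅ Hom(P, F Y)` as a linear map. -/
def adjTranspose (P : E) (Y : M) : (P ⟶ F.obj Y) →ₗ[k] (G.obj P ⟶ Y) :=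
  { toFun := fun f => (a₁.homEquiv P Y).symm f
    map_add' := fun f g => (a₁.homEquiv P Y).injective (by
      rw [Equiv.apply_symm_apply, Adjunction.homEquiv_unit, F.map_add, Preadditive.comp_add,
        ← Adjunction.homEquiv_unit, ← Adjunction.homEquiv_unit, Equiv.apply_symm_apply,
        Equiv.apply_symm_apply])
    map_smul' := fun r f => (a₁.homEquiv P Y).injective (by
      rw [Equiv.apply_symm_apply, Adjunction.homEquiv_unit, F.map_smul, Linear.comp_smul,
        ← Adjunction.homEquiv_unit, Equiv.apply_symm_apply, RingHom.id_apply]) }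

/-- Dinaturality along the unit `Y ⟶ U F Y`. At `Q = F Y` the comparison map becomes invertible, so
the family on `E` recovers the universal family on `M`. -/
theorem unit_relCowedge (P : E) (Y : M) (ζ : Module.Dual k (G.obj P ⟶ Y)) :
    a₂.unit.app Y ≫ relCowedge a₁ a₂ S P (F.obj Y) (ζ ∘ₗ adjTranspose a₁ P Y) =
      (S.cowedge (G.obj P)).app Y ζ := by
  rw [relCowedge_apply]
  refine ((S.cowedge (G.obj P)).dinatural (a₂.unit.app Y) _).symm.trans ?_
  congr 1
  ext h
  refine (congrArg (fun x => ζ (adjTranspose a₁ P Y x)) (adjComp_comp_unit a₁ a₂ h)).trans ?_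
  simp [adjTranspose]

/-- By `unit_relCowedge`, every structure morphism of `N` at `G P` factors through a member of the
family with `Q = F Y`. -/
theorem relCowedge_hom_ext {P : E} {Z : M} {g g' : N.obj (G.obj P) ⟶ Z}
    (h : ∀ (Q : E) (ξ : Module.Dual k (P ⟶ Q)),
      relCowedge a₁ a₂ S P Q ξ ≫ g = relCowedge a₁ a₂ S P Q ξ ≫ g') : g = g' := by
  refine S.hom_ext fun Y ζ => ?_
  rw [← unit_relCowedge a₁ a₂ S, Category.assoc, h, Category.assoc]

variable [U.Additive] [U.Linear k]

/-- The dinatural family on `M` induced by a dinatural family on `E`, for `G ⊣ F ⊣ U`. -/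
def NakayamaCowedge.restrict {P Z : E} (w : NakayamaCowedge k P Z) :
    NakayamaCowedge k (G.obj P) (U.obj Z) where
  app Y := Linear.leftComp k _ (a₂.unit.app Y) ∘ₗ U.mapLinearMap k ∘ₗ w.app (F.obj Y) ∘ₗ
    LinearMap.lcomp k k (adjTranspose a₁ P Y)
  dinatural {Y Y'} f ζ := by
    have h : (ζ ∘ₗ Linear.rightComp k (G.obj P) f) ∘ₗ adjTranspose a₁ P Y =
        (ζ ∘ₗ adjTranspose a₁ P Y') ∘ₗ Linear.rightComp k P (F.map f) := by
      ext h
      simp [adjTranspose, Adjunction.homEquiv_naturality_right_symm]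
    simp only [LinearMap.comp_apply, LinearMap.lcomp_apply', h, w.dinatural]
    simp

/-- Comparison followed by transposition is composition with the counit `F U Q ⟶ Q`. Dinaturality of
`w` at this counit and a triangle identity leave only the image of `w` under `U`. -/
theorem relCowedge_desc_restrict {P Z : E} (w : NakayamaCowedge k P Z) (Q : E)
    (ξ : Module.Dual k (P ⟶ Q)) :
    relCowedge a₁ a₂ S P Q ξ ≫ S.desc (w.restrict a₁ a₂) = U.map (w.app Q ξ) := by
  have h : (ξ ∘ₗ adjComp k a₁ a₂ P Q) ∘ₗ adjTranspose a₁ P (U.obj Q) =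
      ξ ∘ₗ Linear.rightComp k P (a₂.counit.app Q) := by
    ext h
    simp [adjTranspose, Adjunction.homEquiv_counit, adjComp]
  rw [relCowedge_apply, S.fac]
  simp only [NakayamaCowedge.restrict, LinearMap.comp_apply, LinearMap.lcomp_apply', h, w.dinatural]
  simp

/-- For `G ⊣ F ⊣ U` with `U` faithful, an endofunctor `L` lying over `G ⋙ N` is a Nakayama functor
if the family `relCowedge` lifts along `U` and detects which morphisms out of `L P` lift. -/
theorem NakayamaStructure.nonempty_of_adjunctions [U.Faithful] {L : E ⥤ E}
    (e : L ⋙ U ≅ G ⋙ N)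
    (hL : ∀ (P Q : E) (ξ : Module.Dual k (P ⟶ Q)),
      ∃ t : Q ⟶ L.obj P, U.map t ≫ e.hom.app P = relCowedge a₁ a₂ S P Q ξ)
    (hd : ∀ (P Z : E) (g : N.obj (G.obj P) ⟶ U.obj Z),
      (∀ (Q : E) (ξ : Module.Dual k (P ⟶ Q)),
        ∃ s : Q ⟶ Z, U.map s = relCowedge a₁ a₂ S P Q ξ ≫ g) →
      ∃ t : L.obj P ⟶ Z, U.map t = e.hom.app P ≫ g) :
    Nonempty (NakayamaStructure k L) := by
  choose t ht using hL
  -- The morphism induced by the restricted family satisfies the condition in `hd`: its composites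
  -- with `relCowedge` are the images of the components of `w`.
  have key (P Z : E) (w : NakayamaCowedge k P Z) :
      ∃ d : L.obj P ⟶ Z, U.map d = e.hom.app P ≫ S.desc (w.restrict a₁ a₂) :=
    hd P Z _ fun Q ξ => ⟨w.app Q ξ, (relCowedge_desc_restrict a₁ a₂ S w Q ξ).symm⟩
  choose d hdesc using key
  -- Since `U` is faithful and `e` is invertible, identities between morphisms into `L P` may be
  -- checked in `M`.
  have inj {P Q : E} {f g : Q ⟶ L.obj P}
      (h : U.map f ≫ e.hom.app P = U.map g ≫ e.hom.app P) : f = g :=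
    U.map_injective ((cancel_mono _).1 h)
  refine ⟨{
    cowedge := fun P =>
      { app := fun Q =>
          { toFun := t P Q
            map_add' := fun ξ ζ => inj (by simp [ht])
            map_smul' := fun r ξ => inj (by simp [ht]) }
        dinatural := fun f ξ => inj (by
          simp only [LinearMap.coe_mk, AddHom.coe_mk, Functor.map_comp, Category.assoc, ht]
          exact relCowedge_dinatural a₁ a₂ S _ f ξ) }
    desc := fun {P Z} w => d P Z w
    fac := fun {P Z} w Q ξ => U.map_injective (by
      simp only [LinearMap.coe_mk, AddHom.coe_mk, Functor.map_comp, hdesc, reassoc_of% ht]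
      exact relCowedge_desc_restrict a₁ a₂ S w Q ξ)
    uniq := fun {P Z} w g hg => U.map_injective (by
      rw [hdesc, ← cancel_epi (e.inv.app P), e.inv_hom_id_app_assoc]
      refine relCowedge_hom_ext a₁ a₂ S fun Q ξ => ?_
      rw [relCowedge_desc_restrict, ← hg, ← ht]
      simp)
    natural := fun {P P'} f Q ξ => inj ?_ }⟩
  simp only [LinearMap.coe_mk, AddHom.coe_mk, Functor.map_comp, Category.assoc, ht]
  rw [← relCowedge_natural, ← ht, Category.assoc]
  exact congrArg (U.map (t P Q ξ) ≫ ·) (e.hom.naturality f)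

/-- Nakayama functors are transported along linear equivalences. -/
theorem NakayamaStructure.exists_of_equivalence {E : Type u₁} [Category.{v₁} E] [Preadditive E]
    [Linear k E] {M : Type u₂} [Category.{v₂} M] [Preadditive M] [Linear k M] (e : E ≌ M)
    [e.functor.Additive] [e.functor.Linear k] {N : M ⥤ M} (S : NakayamaStructure k N) :
    ∃ L : E ⥤ E, Nonempty (NakayamaStructure k L) :=
  -- In the chain `e ⊣ e⁻¹ ⊣ e` the same functor plays the parts of `G` and `U`; in the second part
  -- it is written `e.symm.inverse`.
  haveI : e.symm.inverse.Additive := inferInstanceAs e.functor.Additive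
  haveI : e.symm.inverse.Linear k := inferInstanceAs (e.functor.Linear k)
  ⟨e.functor ⋙ N ⋙ e.inverse,
    nonempty_of_adjunctions e.toAdjunction e.symm.toAdjunction S
      (Functor.isoWhiskerLeft (e.functor ⋙ N) e.counitIso)
      -- An equivalence is full, so both lifting conditions hold without further input.
      (fun P Q ξ => ⟨e.functor.preimage
        (relCowedge e.toAdjunction e.symm.toAdjunction S P Q ξ ≫ e.counitInv.app _), by simp⟩)
      (fun P Z g _ => ⟨e.functor.preimage (e.counit.app _ ≫ g), by simp⟩)⟩

end Relative

/-! ### Existence of Nakayama functors -/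

section Existence

variable (k : Type u) [Field k] (R : Type u) [Ring R] [Algebra k R]

/-- The regular module. -/
abbrev regularModule : FGModuleCat.{u} R := FGModuleCat.of R R

variable {R} in
/-- The morphism from the regular module given by an element of a module. -/
def ofElement {Y : FGModuleCat.{u} R} (y : Y) : regularModule R ⟶ Y :=
  FGModuleCat.ofHom (LinearMap.toSpanSingleton R Y y)

variable {R}

theorem regularModule_hom_ext {Y : FGModuleCat.{u} R} {f g : regularModule R ⟶ Y}
    (h : f.hom.hom (1 : R) = g.hom.hom (1 : R)) : f = g :=
  FGModuleCat.hom_ext (LinearMap.ext_ring h)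

theorem ofElement_comp {Y Z : FGModuleCat.{u} R} (y : Y) (f : Y ⟶ Z) :
    ofElement y ≫ f = ofElement (f.hom.hom y) :=
  regularModule_hom_ext (by
    change f.hom.hom ((1 : R) • y) = (1 : R) • f.hom.hom y
    rw [one_smul, one_smul])

theorem ofElement_add {Y : FGModuleCat.{u} R} (y y' : Y) :
    ofElement (y + y') = ofElement y + ofElement y' :=
  regularModule_hom_ext (smul_add (1 : R) y y')

theorem ofElement_smul {Y : FGModuleCat.{u} R} (r : R) (y : Y) :
    ofElement (r • y) = ofElement (Y := regularModule R) r ≫ ofElement y :=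
  regularModule_hom_ext (by
    change (1 : R) • r • y = ((1 : R) • r) • y
    rw [one_smul, one_smul])

theorem ofElement_apply_one {Y : FGModuleCat.{u} R} (f : regularModule R ⟶ Y) :
    ofElement (f.hom.hom (1 : R)) = f :=
  regularModule_hom_ext (one_smul R _)

/-- The dual of `Hom(X, R)`, a left `R`-module through the right action of `R` on itself. -/
abbrev RegularDual (X : FGModuleCat.{u} R) : Type u := Module.Dual k (X ⟶ regularModule R)

instance (X : FGModuleCat.{u} R) : Module R (RegularDual k X) where
  smul r ξ := ξ ∘ₗ Linear.rightComp k X (ofElement (Y := regularModule R) r)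
  one_smul ξ := LinearMap.ext fun h => congrArg ξ (by
    have e : ofElement (Y := regularModule R) (1 : R) = 𝟙 _ := ofElement_apply_one (𝟙 _)
    rw [e, Linear.rightComp_apply, Category.comp_id])
  mul_smul r s ξ := LinearMap.ext fun h => congrArg ξ (by
    have e := ofElement_smul (Y := regularModule R) r s
    rw [smul_eq_mul] at e
    rw [e, Linear.rightComp_apply]
    exact (Category.assoc _ _ _).symm)
  smul_zero r := rfl
  smul_add r ξ ζ := rfl
  add_smul r s ξ := LinearMap.ext fun h => by
    have e := ofElement_add (Y := regularModule R) r s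
    refine (congrArg ξ (?_ : _ = h ≫ ofElement (Y := regularModule R) r +
      h ≫ ofElement (Y := regularModule R) s)).trans (map_add ξ _ _)
    rw [e, Linear.rightComp_apply, Preadditive.comp_add]
  zero_smul ξ := LinearMap.ext fun h => by
    have e : ofElement (Y := regularModule R) (0 : R) = 0 := ofElement_apply_one 0
    refine (congrArg ξ (?_ : _ = (0 : X ⟶ regularModule R))).trans (map_zero ξ)
    rw [e, Linear.rightComp_apply, comp_zero]

theorem smul_regularDual_apply (X : FGModuleCat.{u} R) (r : R) (ξ : RegularDual k X)
    (h : X ⟶ regularModule R) :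
    (r • ξ) h = ξ (h ≫ ofElement (Y := regularModule R) r) := rfl

instance (X : FGModuleCat.{u} R) : IsScalarTower k R (RegularDual k X) where
  smul_assoc c r ξ := LinearMap.ext fun h => by
    have e : ofElement (Y := regularModule R) (c • r) = c • ofElement (Y := regularModule R) r :=
      regularModule_hom_ext (by
        change (1 : R) • c • r = algebraMap k R c • ((1 : R) • r)
        rw [one_smul, one_smul, algebraMap_smul])
    rw [LinearMap.smul_apply, smul_regularDual_apply, smul_regularDual_apply, e,
      Linear.comp_smul, map_smul]

/-- Over a finite-dimensional algebra finitely generated modules are finite-dimensional, and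
`R`-linear maps embed into `k`-linear ones. -/
theorem finite_hom [Module.Finite k R] (X Y : FGModuleCat.{u} R) : Module.Finite k (X ⟶ Y) := by
  let (Z : FGModuleCat.{u} R) : Module k Z := Module.compHom Z (algebraMap k R)
  have (Z : FGModuleCat.{u} R) : IsScalarTower k R Z :=
    ⟨fun c r z => by
      change (c • r) • z = algebraMap k R c • r • z
      rw [Algebra.smul_def, mul_smul]⟩
  have (Z : FGModuleCat.{u} R) : Module.Finite k Z := Module.Finite.trans R Z
  let f : (X ⟶ Y) →ₗ[k] (X →ₗ[k] Y) :=
    { toFun := fun h => h.hom.hom.restrictScalars k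
      map_add' := fun _ _ => rfl
      map_smul' := fun _ _ => rfl }
  exact Module.Finite.of_injective f fun g g' h => FGModuleCat.hom_ext
    (LinearMap.ext fun x => LinearMap.congr_fun h x)

instance [Module.Finite k R] (X : FGModuleCat.{u} R) : Module.Finite R (RegularDual k X) := by
  have := finite_hom k X (regularModule R)
  exact Module.Finite.of_restrictScalars_finite k R _

variable (R) in
/-- The Nakayama functor `X ↦ Hom(X, R)^*` of the category of finitely generated modules. -/
def regularDualFunctor [Module.Finite k R] : FGModuleCat.{u} R ⥤ FGModuleCat.{u} R where
  obj X := FGModuleCat.of R (RegularDual k X)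
  map f := FGModuleCat.ofHom
    { toFun := fun ξ => ξ ∘ₗ Linear.leftComp k (regularModule R) f
      map_add' := fun _ _ => rfl
      map_smul' := fun _ ξ => LinearMap.ext fun h => congrArg ξ (Category.assoc f h _) }
  map_id X := FGModuleCat.hom_ext (LinearMap.ext fun ξ => LinearMap.ext fun h =>
    congrArg (DFunLike.coe (F := RegularDual k X) ξ) (Category.id_comp h))
  map_comp f g := FGModuleCat.hom_ext (LinearMap.ext fun ξ => LinearMap.ext fun h =>
    congrArg (DFunLike.coe (F := RegularDual k _) ξ) (Category.assoc f g h))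

/-- The universal dinatural family sends `ξ` and `y` to the functional `h ↦ ξ (x ↦ h x • y)`. -/
def regularDualCowedge [Module.Finite k R] (X : FGModuleCat.{u} R) :
    NakayamaCowedge k X (FGModuleCat.of R (RegularDual k X)) where
  app Y :=
    { toFun := fun ξ => FGModuleCat.ofHom
        { toFun := fun y => ξ ∘ₗ Linear.rightComp k X (ofElement y)
          map_add' := fun y y' => LinearMap.ext fun h => by
            simp [ofElement_add]
          map_smul' := fun r y => LinearMap.ext fun h => by
            simp [ofElement_smul, smul_regularDual_apply] }
      map_add' := fun ξ ζ => FGModuleCat.hom_ext (LinearMap.ext fun y => rfl)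
      map_smul' := fun r ξ => FGModuleCat.hom_ext (LinearMap.ext fun y => by
        change r • (ξ ∘ₗ Linear.rightComp k X (ofElement y)) =
          algebraMap k R r • (ξ ∘ₗ Linear.rightComp k X (ofElement y) : RegularDual k X)
        rw [algebraMap_smul]) }
  dinatural {Y Y'} f ξ := FGModuleCat.hom_ext (LinearMap.ext fun y =>
    LinearMap.ext fun (h : X ⟶ regularModule R) => by
      change ξ ((h ≫ ofElement y) ≫ f) = ξ (h ≫ ofElement (f.hom.hom y))
      rw [← ofElement_comp, Category.assoc])

/-- Dinaturality along the morphism from the regular module that sends `1` to `y`. The component at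
the regular module thus determines the whole family, which is why the coend is Hom(X, R)^*. -/
theorem NakayamaCowedge.app_ofElement {X Z : FGModuleCat.{u} R} (w : NakayamaCowedge k X Z)
    {Y : FGModuleCat.{u} R} (ξ : Module.Dual k (X ⟶ Y)) (y : Y) :
    (w.app (regularModule R) (ξ ∘ₗ Linear.rightComp k X (ofElement y))).hom.hom (1 : R) =
      (w.app Y ξ).hom.hom y := by
  rw [w.dinatural]
  change (w.app Y ξ).hom.hom ((1 : R) • y) = _
  rw [one_smul]

/-- The morphism `Hom(X, R)^* ⟶ Z` induced by a dinatural family. -/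
def regularDualDesc [Module.Finite k R] {X Z : FGModuleCat.{u} R} (w : NakayamaCowedge k X Z) :
    FGModuleCat.of R (RegularDual k X) ⟶ Z :=
  FGModuleCat.ofHom
    { toFun := fun ξ => (w.app (regularModule R) ξ).hom.hom (1 : R)
      map_add' := fun ξ ζ => by rw [map_add]; rfl
      map_smul' := fun r ξ => by
        -- The functional `r • ξ` is `ξ` composed with right multiplication by `r`, so its component
        -- at `1` is the component of `ξ` at `r = r * 1`.
        refine (w.app_ofElement k (Y := regularModule R) ξ r).trans ?_
        rw [RingHom.id_apply, ← map_smul]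
        exact congrArg _ (mul_one r).symm }

variable (R) in
/-- The functor `X ↦ Hom(X, R)^*` is a Nakayama functor. -/
def regularDualStructure [Module.Finite k R] : NakayamaStructure k (regularDualFunctor k R) where
  cowedge X := regularDualCowedge k X
  desc w := regularDualDesc k w
  fac {X Z} w Y ξ := FGModuleCat.hom_ext (LinearMap.ext fun y => w.app_ofElement k ξ y)
  uniq {X Z} w g hg := FGModuleCat.hom_ext (LinearMap.ext fun (ξ : RegularDual k X) => by
    change _ = (w.app (regularModule R) ξ).hom.hom (1 : R)
    rw [← hg]
    -- At the regular module the universal family sends `ξ` and `1` back to `ξ`.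
    refine congrArg g.hom.hom (LinearMap.ext fun (h : X ⟶ regularModule R) => ?_)
    have e : ofElement (Y := regularModule R) (1 : R) = 𝟙 _ := ofElement_apply_one (𝟙 _)
    change ξ h = ξ (h ≫ ofElement (Y := regularModule R) (1 : R))
    rw [e, Category.comp_id])
  natural {X X'} f Y ξ := FGModuleCat.hom_ext (LinearMap.ext fun y =>
    LinearMap.ext fun (h : X' ⟶ regularModule R) => by
      change ξ ((f ≫ h) ≫ ofElement y) = ξ (f ≫ h ≫ ofElement y)
      rw [Category.assoc])

theorem FiniteAbelian.exists_nakayamaStructure (M : Type u₁) [Category.{v₁} M] [Abelian M]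
    [Linear k M] [FiniteAbelian k M] : ∃ N : M ⥤ M, Nonempty (NakayamaStructure k N) := by
  obtain ⟨R, _, _, _, F, _, _, _⟩ := FiniteAbelian.exists_equivalence (k := k) (M := M)
  have : F.asEquivalence.functor.Additive := inferInstanceAs F.Additive
  have : F.asEquivalence.functor.Linear k := inferInstanceAs (F.Linear k)
  exact NakayamaStructure.exists_of_equivalence F.asEquivalence (regularDualStructure k R)

end Existence

/-! ### Left module categories -/

section LeftDuality

open MonoidalLeftAction

variable {C : Type u₁} [Category.{v₁} C] [MonoidalCategory C]
variable {M : Type u₂} [Category.{v₂} M] [MonoidalLeftAction C M]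

section Pairing

variable (X Y : C) [ExactPairing X Y]

/-- The coevaluation `P ⟶ X ⊗ Y ⊗ P` of a dual pair acting on the left. -/
def leftCoev (P : M) : P ⟶ X ⊙ₗ Y ⊙ₗ P := (λₗ P).inv ≫ η_ X Y ⊵ₗ P ≫ (αₗ X Y P).hom

/-- The evaluation `Y ⊗ X ⊗ P ⟶ P` of a dual pair acting on the left. -/
def leftEv (P : M) : Y ⊙ₗ X ⊙ₗ P ⟶ P := (αₗ Y X P).inv ≫ ε_ X Y ⊵ₗ P ≫ (λₗ P).hom

theorem leftCoev_naturality {P P' : M} (f : P ⟶ P') :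
    f ≫ leftCoev X Y P' = leftCoev X Y P ≫ X ⊴ₗ Y ⊴ₗ f :=
  (leftActionAdj M X Y).unit.naturality f

theorem leftEv_naturality {P P' : M} (f : P ⟶ P') :
    Y ⊴ₗ X ⊴ₗ f ≫ leftEv X Y P' = leftEv X Y P ≫ f :=
  (leftActionAdj M X Y).counit.naturality f

theorem leftCoev_leftEv (P : M) : Y ⊴ₗ leftCoev X Y P ≫ leftEv X Y (Y ⊙ₗ P) = 𝟙 (Y ⊙ₗ P) :=
  (leftActionAdj M X Y).left_triangle_components P

theorem leftCoev_leftEv' (P : M) : leftCoev X Y (X ⊙ₗ P) ≫ X ⊴ₗ leftEv X Y P = 𝟙 (X ⊙ₗ P) :=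
  (leftActionAdj M X Y).right_triangle_components P

end Pairing

section Mates

variable {X Y V Z T : C} [ExactPairing X Y] [ExactPairing V Z] {s : T ⊗ X ⟶ V} {r : Z ⊗ T ⟶ Y}
  (h : r ▷ X ≫ ε_ X Y = (α_ Z T X).hom ≫ Z ◁ s ≫ ε_ V Z)

include h

/-- The hypothesis says that `r` is the transpose of `s`; this is its form after acting on an
object. The pairs in use are (`μ`, `dualAct`) and (`dualAct`, `dualBiact`). -/
theorem leftEv_mate (W : M) :
    Z ⊴ₗ ((αₗ T X W).inv ≫ s ⊵ₗ W) ≫ leftEv V Z W =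
      (αₗ Z T (X ⊙ₗ W)).inv ≫ r ⊵ₗ (X ⊙ₗ W) ≫ leftEv X Y W := by
  have h' := congrArg (· ⊵ₗ W) h
  simp only [comp_actionHomLeft, whiskerLeft_actionHomLeft, Category.assoc] at h'
  have h₁ : r ⊵ₗ (X ⊙ₗ W) ≫ (αₗ Y X W).inv = (αₗ (Z ⊗ T) X W).inv ≫ (r ▷ X) ⊵ₗ W := by simp
  have h₂ := actionAssoc_left Z T X W
  rw [← cancel_epi (Z ⊴ₗ (αₗ T X W).inv)] at h₂
  simp only [actionHomRight_inv_hom_assoc] at h₂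
  simp only [leftEv, actionHomRight_comp, Category.assoc]
  rw [reassoc_of% h₁, reassoc_of% h', reassoc_of% h₂]
  simp

/-- Both sides have the same transpose under the adjunction between the actions of `Z` and `V`. -/
theorem leftCoev_mate (P : M) :
    T ⊴ₗ leftCoev X Y P ≫ (αₗ T X (Y ⊙ₗ P)).inv ≫ s ⊵ₗ (Y ⊙ₗ P) =
      leftCoev V Z (T ⊙ₗ P) ≫ V ⊴ₗ ((αₗ Z T P).inv ≫ r ⊵ₗ P) := by
  have h₁ : Z ⊴ₗ T ⊴ₗ leftCoev X Y P ≫ (αₗ Z T (X ⊙ₗ Y ⊙ₗ P)).inv =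
      (αₗ Z T P).inv ≫ (Z ⊗ T) ⊴ₗ leftCoev X Y P := by simp
  -- Evaluation against `Z` turns `s` into `r`, after which the coevaluation and evaluation of `X`
  -- and `Y` cancel.
  have key : Z ⊴ₗ (T ⊴ₗ leftCoev X Y P ≫ (αₗ T X (Y ⊙ₗ P)).inv ≫ s ⊵ₗ (Y ⊙ₗ P)) ≫
      leftEv V Z (Y ⊙ₗ P) = (αₗ Z T P).inv ≫ r ⊵ₗ P := by
    rw [actionHomRight_comp, Category.assoc, leftEv_mate h, reassoc_of% h₁,
      action_exchange_assoc, leftCoev_leftEv, Category.comp_id]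
  rw [← key, actionHomRight_comp, ← reassoc_of% leftCoev_naturality V Z, leftCoev_leftEv',
    Category.comp_id]

end Mates

section Algebras

variable [RightRigidCategory C] (A : C) [MonObj A]

theorem dualAct_evaluation :
    dualAct A ▷ A ≫ ε_ A (ldual A) =
      (α_ (ldual A) A A).hom ≫ ldual A ◁ μ[A] ≫ ε_ A (ldual A) :=
  mateLeft_evaluation _

theorem dualBiact_evaluation :
    dualBiact A ▷ A ≫ ε_ A (ldual A) =
      (α_ (ldual (ldual A)) (ldual A) A).hom ≫ ldual (ldual A) ◁ dualAct A ≫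
        ε_ (ldual A) (ldual (ldual A)) :=
  mateLeft_evaluation _

/-- The transport of multiplication through `A^∨∨ ⊗ A^∨ ⟶ A^∨`. In terms of elements, for dual
bases `e_i`, `e^i`, it is `∑ e_i e_j ⟨e^j, H (e^i ⊗ p)⟩ = ∑ e_i H (e^i ⊗ p)`. -/
theorem leftCoev_mul {P Q : M} (H : ldual A ⊙ₗ P ⟶ A ⊙ₗ Q) :
    leftCoev A (ldual A) P ≫ A ⊴ₗ H ≫ (αₗ A A Q).inv ≫ μ[A] ⊵ₗ Q =
      leftCoev A (ldual A) P ≫ A ⊴ₗ (leftCoev (ldual A) (ldual (ldual A)) (ldual A ⊙ₗ P) ≫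
        ldual A ⊴ₗ ((αₗ _ _ P).inv ≫ dualBiact A ⊵ₗ P ≫ H) ≫ leftEv A (ldual A) Q) := by
  have h₁ := leftCoev_mate (dualBiact_evaluation A) P
  -- The inner morphism on the right is the transpose of the whole left side: `h₁` trades
  -- `dualBiact` for `dualAct`, and `dualAct` is the transpose of `μ`. Transposing back then gives
  -- the claim.
  have h₂ : leftCoev (ldual A) (ldual (ldual A)) (ldual A ⊙ₗ P) ≫
        ldual A ⊴ₗ ((αₗ _ _ P).inv ≫ dualBiact A ⊵ₗ P ≫ H) ≫ leftEv A (ldual A) Q =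
      ldual A ⊴ₗ (leftCoev A (ldual A) P ≫ A ⊴ₗ H ≫ (αₗ A A Q).inv ≫ μ[A] ⊵ₗ Q) ≫
        leftEv A (ldual A) Q := by
    have h₃ : ldual A ⊴ₗ A ⊴ₗ H ≫ (αₗ (ldual A) A (A ⊙ₗ Q)).inv =
        (αₗ (ldual A) A (ldual A ⊙ₗ P)).inv ≫ (ldual A ⊗ A) ⊴ₗ H := by simp
    rw [← Category.assoc (αₗ _ _ P).inv, actionHomRight_comp, Category.assoc,
      ← reassoc_of% h₁]
    simp only [actionHomRight_comp (ldual A) (leftCoev A (ldual A) P),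
      actionHomRight_comp (ldual A) (A ⊴ₗ H), Category.assoc]
    rw [leftEv_mate (dualAct_evaluation A), reassoc_of% h₃, action_exchange_assoc]
  rw [h₂, actionHomRight_comp, ← reassoc_of% leftCoev_naturality A (ldual A)]
  simp only [Category.assoc]
  rw [leftCoev_leftEv', Category.comp_id]

end Algebras

end LeftDuality

/-! ### The adjunctions between left modules and objects -/

section LeftModuleAdjunctions

open MonoidalLeftAction

variable {C : Type u₁} [Category.{v₁} C] [MonoidalCategory C]
variable (M : Type u₂) [Category.{v₂} M] [MonoidalLeftAction C M] (A : C) [MonObj A]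

/-- The free left `A`-module on an object. -/
def freeModObj (Y : M) : Mod M A where
  X := A ⊙ₗ Y
  mod :=
    { smul := (αₗ A A Y).inv ≫ μ[A] ⊵ₗ Y
      one_smul := by
        have h := congrArg (· ⊵ₗ Y) (MonObj.one_mul A)
        simp only [comp_actionHomLeft] at h
        rw [actionHomLeft_action]
        simp [h]
      mul_smul := by
        have h := congrArg (· ⊵ₗ Y) (MonObj.mul_assoc A)
        simp only [comp_actionHomLeft, whiskerLeft_actionHomLeft, Category.assoc] at h
        rw [actionHomLeft_action]
        simp only [Category.assoc, Iso.hom_inv_id_assoc, actionHomRight_comp]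
        rw [h, ← reassoc_of% actionAssoc_left' A A A Y, Iso.inv_hom_id_assoc] }

variable {M} in
theorem mul_actionHomRight {Y Y' : M} (f : Y ⟶ Y') :
    ((αₗ A A Y).inv ≫ μ[A] ⊵ₗ Y) ≫ A ⊴ₗ f = A ⊴ₗ A ⊴ₗ f ≫ (αₗ A A Y').inv ≫ μ[A] ⊵ₗ Y' := by
  rw [Category.assoc, ← action_exchange]
  simp

/-- The free left `A`-module functor. -/
def freeMod : M ⥤ Mod M A where
  obj Y := freeModObj M A Y
  map f := Mod.Hom.mk' (A ⊴ₗ f) (mul_actionHomRight A f)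
  map_id Y := Mod.hom_ext _ _ (by simp; rfl)
  map_comp f g := Mod.hom_ext _ _ (by simp; rfl)

/-- Free modules are left adjoint to the forgetful functor. -/
def freeModAdj : freeMod M A ⊣ Mod.forget (D := M) A where
  unit :=
    { app := fun Y => (λₗ Y).inv ≫ η[A] ⊵ₗ Y
      naturality := fun Y Y' f => by
        change f ≫ (λₗ Y').inv ≫ η[A] ⊵ₗ Y' = ((λₗ Y).inv ≫ η[A] ⊵ₗ Y) ≫ A ⊴ₗ f
        rw [← actionUnitIso_inv_naturality_assoc, Category.assoc, ← action_exchange] }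
  counit :=
    { app := fun Q => Mod.Hom.mk' (M := freeModObj M A Q.X) γ[Q.X] (by
        change ((αₗ A A Q.X).inv ≫ μ[A] ⊵ₗ Q.X) ≫ γ[Q.X] = A ⊴ₗ γ[Q.X] ≫ γ[Q.X]
        simp)
      naturality := fun Q Q' f => Mod.hom_ext _ _ (IsModHom.smul_hom (f := f.hom)).symm }
  left_triangle_components Y := Mod.hom_ext _ _ (by
    have h := congrArg (· ⊵ₗ Y) (MonObj.mul_one A)
    simp only [comp_actionHomLeft, whiskerLeft_actionHomLeft, Category.assoc,
      rightUnitor_actionHom] at h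
    change A ⊴ₗ ((λₗ Y).inv ≫ η[A] ⊵ₗ Y) ≫ (αₗ A A Y).inv ≫ μ[A] ⊵ₗ Y = 𝟙 _
    rw [actionHomRight_comp, Category.assoc, ← cancel_epi (A ⊴ₗ (λₗ[C] Y).hom),
      ← cancel_epi (αₗ A (𝟙_ C) Y).hom]
    simp [h])
  right_triangle_components Q := by
    change ((λₗ Q.X).inv ≫ η[A] ⊵ₗ Q.X) ≫ γ[Q.X] = 𝟙 _
    simp

end LeftModuleAdjunctions

/-! ### The adjunction between A^∨ ⊗_A - and free left modules -/

section DualTensorAdjunction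

open MonoidalLeftAction

variable {C : Type u₁} [Category.{v₁} C] [MonoidalCategory C] [RightRigidCategory C]
variable {M : Type u₂} [Category.{v₂} M] [MonoidalLeftAction C M] [HasCoequalizers M]
variable (A : C) [MonObj A]

/-- A balanced morphism out of `A^∨ ⊗ P` factors through `A^∨ ⊗_A P`. -/
noncomputable def dualTensorDesc {P Z : M} (p : A ⊙ₗ P ⟶ P) (g : ldual A ⊙ₗ P ⟶ Z)
    (h : ldual A ⊴ₗ p ≫ g = ((αₗ (ldual A) A P).inv ≫ dualAct A ⊵ₗ P) ≫ g) :
    dualTensor A p ⟶ Z :=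
  coequalizer.desc g h

theorem dualTensorπ_desc {P Z : M} (p : A ⊙ₗ P ⟶ P) (g : ldual A ⊙ₗ P ⟶ Z)
    (h : ldual A ⊴ₗ p ≫ g = ((αₗ (ldual A) A P).inv ≫ dualAct A ⊵ₗ P) ≫ g) :
    dualTensorπ A p ≫ dualTensorDesc A p g h = g :=
  coequalizer.π_desc _ _

/-- The unit `P ⟶ A ⊗ (A^∨ ⊗_A P)`. -/
noncomputable def dualTensorUnit {P : M} (p : A ⊙ₗ P ⟶ P) : P ⟶ A ⊙ₗ dualTensor A p :=
  leftCoev A (ldual A) P ≫ A ⊴ₗ dualTensorπ A p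

/-- Naturality of the coevaluation carries `p` to the factor A^∨ ⊗ P, where balancing replaces it by
the action of A on A^∨. The transpose of that action is multiplication on the outer factor A. -/
theorem dualTensorUnit_act {P : M} (p : A ⊙ₗ P ⟶ P) :
    p ≫ dualTensorUnit A p = A ⊴ₗ dualTensorUnit A p ≫
      (αₗ A A (dualTensor A p)).inv ≫ μ[A] ⊵ₗ (dualTensor A p) := by
  have h := leftCoev_mate (dualAct_evaluation A) P
  have h₁ : A ⊴ₗ A ⊴ₗ dualTensorπ A p ≫ (αₗ A A (dualTensor A p)).inv =
    (αₗ A A (ldual A ⊙ₗ P)).inv ≫ (A ⊗ A) ⊴ₗ dualTensorπ A p := by simp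
  rw [dualTensorUnit, reassoc_of% leftCoev_naturality A (ldual A),
    actionHomRight_comp A (leftCoev _ _ _), Category.assoc, reassoc_of% h₁, action_exchange,
    reassoc_of% h, ← actionHomRight_comp, ← actionHomRight_comp, dualTensor_condition,
    Category.assoc]

theorem dualTensorUnit_naturality {P P' : M} (p : A ⊙ₗ P ⟶ P) (p' : A ⊙ₗ P' ⟶ P') (f : P ⟶ P')
    (h : p ≫ f = A ⊴ₗ f ≫ p') :
    f ≫ dualTensorUnit A p' = dualTensorUnit A p ≫ A ⊴ₗ dualTensorMap A p p' f h := by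
  rw [dualTensorUnit, dualTensorUnit, reassoc_of% leftCoev_naturality A (ldual A), Category.assoc,
    ← actionHomRight_comp, ← actionHomRight_comp, dualTensorπ_map]

/-- The counit `A^∨ ⊗_A (A ⊗ Y) ⟶ Y`. -/
noncomputable def dualTensorCounit (Y : M) : dualTensor A ((αₗ A A Y).inv ≫ μ[A] ⊵ₗ Y) ⟶ Y :=
  dualTensorDesc A _ (leftEv A (ldual A) Y) (by
    -- The evaluation is balanced because `dualAct` is by definition the transpose of `μ`.
    rw [Category.assoc]
    exact leftEv_mate (dualAct_evaluation A) Y)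

theorem dualTensorπ_counit (Y : M) :
    dualTensorπ A ((αₗ A A Y).inv ≫ μ[A] ⊵ₗ Y) ≫ dualTensorCounit A Y = leftEv A (ldual A) Y :=
  dualTensorπ_desc _ _ _ _

theorem dualTensorCounit_naturality {Y Y' : M} (f : Y ⟶ Y') :
    dualTensorMap A _ _ (A ⊴ₗ f) (mul_actionHomRight A f) ≫ dualTensorCounit A Y' =
      dualTensorCounit A Y ≫ f := by
  rw [← cancel_epi (dualTensorπ A _), reassoc_of% dualTensorπ_map, dualTensorπ_counit,
    leftEv_naturality, reassoc_of% dualTensorπ_counit]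

/-- The triangle identity for A^∨ ⊗ - ⊣ A ⊗ - descends along the projection, which is an
epimorphism. -/
theorem dualTensorMap_unit_counit {P : M} (p : A ⊙ₗ P ⟶ P) :
    dualTensorMap A _ _ (dualTensorUnit A p) (dualTensorUnit_act A p) ≫
      dualTensorCounit A (dualTensor A p) = 𝟙 _ := by
  rw [← cancel_epi (dualTensorπ A _), reassoc_of% dualTensorπ_map, dualTensorπ_counit,
    dualTensorUnit, actionHomRight_comp, Category.assoc, leftEv_naturality,
    reassoc_of% leftCoev_leftEv, Category.comp_id]

theorem dualTensorUnit_counit (Y : M) :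
    dualTensorUnit A ((αₗ A A Y).inv ≫ μ[A] ⊵ₗ Y) ≫ A ⊴ₗ dualTensorCounit A Y = 𝟙 _ := by
  rw [dualTensorUnit, Category.assoc, ← actionHomRight_comp, dualTensorπ_counit, leftCoev_leftEv']

variable (M) in
/-- The functor `A^∨ ⊗_A -` is left adjoint to the free module functor. -/
noncomputable def dualTensorAdj : dualTensorFunctor A ⊣ freeMod M A where
  unit :=
    { app := fun P => Mod.Hom.mk' (N := freeModObj M A (dualTensor A γ[P.X]))
        (dualTensorUnit A γ[P.X]) (dualTensorUnit_act A γ[P.X])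
      naturality := fun P P' f => Mod.hom_ext _ _ (dualTensorUnit_naturality A _ _ f.hom (by simp)) }
  counit :=
    { app := fun Y => dualTensorCounit A Y
      naturality := fun Y Y' f => dualTensorCounit_naturality A f }
  left_triangle_components P := dualTensorMap_unit_counit A γ[P.X]
  right_triangle_components Y := by
    apply Mod.hom_ext
    exact dualTensorUnit_counit A Y

end DualTensorAdjunction

/-! ### Jointly epimorphic families and actions -/

section JointlyEpi

universe w

variable {M : Type u₂} [Category.{v₂} M]

/-- A family of morphisms with common target which detects equality of morphisms. -/
def JointlyEpi {J : Type w} {Y : J → M} {N : M} (φ : ∀ i, Y i ⟶ N) : Prop :=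
  ∀ ⦃Z : M⦄ (g g' : N ⟶ Z), (∀ i, φ i ≫ g = φ i ≫ g') → g = g'

/-- Transposing along the adjunction reduces equality after `L.map (φ i)` to equality after `φ i`.
-/
theorem JointlyEpi.map {M' : Type u₃} [Category.{v₃} M'] {L : M ⥤ M'} {R : M' ⥤ M} (a : L ⊣ R)
    {J : Type w} {Y : J → M} {N : M} {φ : ∀ i, Y i ⟶ N} (h : JointlyEpi φ) :
    JointlyEpi fun i => L.map (φ i) := fun Z g g' hg => by
  refine (a.homEquiv _ _).injective (h _ _ fun i => ?_)
  rw [← Adjunction.homEquiv_naturality_left, ← Adjunction.homEquiv_naturality_left, hg]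

variable {C : Type u₁} [Category.{v₁} C] [MonoidalCategory C] [RigidCategory C]

/-- Rigidity makes the action of X a left adjoint, with right adjoint the action of ^∨X. -/
theorem JointlyEpi.actionLeft [MonoidalLeftAction C M] {J : Type w} {Y : J → M} {N : M}
    {φ : ∀ i, Y i ⟶ N} (h : JointlyEpi φ) (X : C) : JointlyEpi fun i => X ⊴ₗ φ i :=
  h.map (leftActionAdj M (rdual X) X)

theorem JointlyEpi.actionRight [MonoidalRightAction C M] {J : Type w} {Y : J → M} {N : M}
    {φ : ∀ i, Y i ⟶ N} (h : JointlyEpi φ) (X : C) : JointlyEpi fun i => φ i ⊵ᵣ X :=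
  h.map (rightActionAdj M X (ldual X))

open MonoidalLeftAction in
-- Compatibility with actions may be tested on a covering family, since X ⊗ - keeps the family
-- jointly epimorphic.
theorem JointlyEpi.leftAct_hom [MonoidalLeftAction C M] {J : Type w} {Y : J → M} {N Z : M}
    {φ : ∀ i, Y i ⟶ N} (h : JointlyEpi φ) {X : C} {y : ∀ i, X ⊙ₗ Y i ⟶ Y i} {a : X ⊙ₗ N ⟶ N}
    {z : X ⊙ₗ Z ⟶ Z} (ha : ∀ i, X ⊴ₗ φ i ≫ a = y i ≫ φ i) (g : N ⟶ Z)
    (hg : ∀ i, y i ≫ φ i ≫ g = X ⊴ₗ (φ i ≫ g) ≫ z) : a ≫ g = X ⊴ₗ g ≫ z :=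
  h.actionLeft X _ _ fun i => by
    rw [reassoc_of% ha, hg, actionHomRight_comp_assoc]

open MonoidalRightAction in
theorem JointlyEpi.rightAct_hom [MonoidalRightAction C M] {J : Type w} {Y : J → M} {N Z : M}
    {φ : ∀ i, Y i ⟶ N} (h : JointlyEpi φ) {X : C} {y : ∀ i, Y i ⊙ᵣ X ⟶ Y i} {b : N ⊙ᵣ X ⟶ N}
    {z : Z ⊙ᵣ X ⟶ Z} (hb : ∀ i, φ i ⊵ᵣ X ≫ b = y i ≫ φ i) (g : N ⟶ Z)
    (hg : ∀ i, y i ≫ φ i ≫ g = (φ i ≫ g) ⊵ᵣ X ≫ z) : b ≫ g = g ⊵ᵣ X ≫ z :=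
  h.actionRight X _ _ fun i => by
    rw [reassoc_of% hb, hg, comp_actionHomLeft_assoc]

variable {D : Type u₃} [Category.{v₃} D] {F : D ⥤ M}

open MonoidalLeftAction in
/-- A family of morphisms `A ⊗ F d ⟶ F d` is a left action if it is covered by actions. -/
theorem IsLeftActionOn.of_jointlyEpi [MonoidalLeftAction C M] {A : C} [MonObj A]
    {a : ∀ d, A ⊙ₗ F.obj d ⟶ F.obj d} {J : D → Type w} {Y : ∀ d, J d → Mod M A}
    {φ : ∀ d (i : J d), (Y d i).X ⟶ F.obj d} (hφ : ∀ d, JointlyEpi (φ d))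
    (ha : ∀ d i, A ⊴ₗ φ d i ≫ a d = γ[(Y d i).X] ≫ φ d i)
    (hn : ∀ {d d'} (f : d ⟶ d') (i : J d),
      γ[(Y d i).X] ≫ φ d i ≫ F.map f = A ⊴ₗ (φ d i ≫ F.map f) ≫ a d') :
    IsLeftActionOn F a where
  -- Each axiom is tested on the covering modules; the exchange law moves the unit or the
  -- multiplication of `A` onto them, where the axiom is known.
  one d := (hφ d).actionLeft (𝟙_ C) _ _ fun i => by
    rw [action_exchange_assoc, ha, ModObj.one_smul_assoc]
    simp
  mul d := (hφ d).actionLeft (A ⊗ A) _ _ fun i => by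
    have h₁ : (A ⊗ A) ⊴ₗ φ d i ≫ (αₗ A A (F.obj d)).hom =
      (αₗ A A (Y d i).X).hom ≫ A ⊴ₗ A ⊴ₗ φ d i := by simp
    rw [action_exchange_assoc, ha, ModObj.mul_smul_assoc, reassoc_of% h₁,
      ← actionHomRight_comp_assoc, ha, actionHomRight_comp_assoc, ha]
  natural {d _} f := (hφ d).leftAct_hom (ha d) _ (hn f)

open MonoidalRightAction in
/-- A family of morphisms `F d ⊗ B ⟶ F d` is a right action if it is covered by actions. -/
theorem IsRightActionOn.of_jointlyEpi [MonoidalRightAction C M] {B : C} [MonObj B]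
    {b : ∀ d, F.obj d ⊙ᵣ B ⟶ F.obj d} {J : D → Type w} {Y : ∀ d, J d → RightMod M B}
    {φ : ∀ d (i : J d), (Y d i).X ⟶ F.obj d} (hφ : ∀ d, JointlyEpi (φ d))
    (hb : ∀ d i, φ d i ⊵ᵣ B ≫ b d = (Y d i).act ≫ φ d i)
    (hn : ∀ {d d'} (f : d ⟶ d') (i : J d),
      (Y d i).act ≫ φ d i ≫ F.map f = (φ d i ≫ F.map f) ⊵ᵣ B ≫ b d') :
    IsRightActionOn F b where
  one d := (hφ d).actionRight (𝟙_ C) _ _ fun i => by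
    rw [← action_exchange_assoc, hb, reassoc_of% (Y d i).act_one]
    simp
  mul d := (hφ d).actionRight (B ⊗ B) _ _ fun i => by
    have h₁ : φ d i ⊵ᵣ (B ⊗ B) ≫ (αᵣ (F.obj d) B B).hom =
      (αᵣ (Y d i).X B B).hom ≫ (φ d i ⊵ᵣ B) ⊵ᵣ B := by simp
    rw [← action_exchange_assoc, hb, reassoc_of% (Y d i).act_mul, reassoc_of% h₁,
      ← comp_actionHomLeft_assoc, hb, comp_actionHomLeft_assoc, hb]
  natural {d _} f := (hφ d).rightAct_hom (hb d) _ (hn f)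

end JointlyEpi

section Relative

variable {k : Type u} [Field k]
variable {E : Type u₁} [Category.{v₁} E] [Preadditive E] [Linear k E]
variable {M : Type u₂} [Category.{v₂} M] [Preadditive M] [Linear k M]
variable {G : E ⥤ M} {F : M ⥤ E} {U : E ⥤ M} (a₁ : G ⊣ F) (a₂ : F ⊣ U)
variable [F.Additive] [F.Linear k] {N : M ⥤ M} (S : NakayamaStructure k N)

theorem jointlyEpi_relCowedge (P : E) :
    JointlyEpi fun i : Σ Q : E, Module.Dual k (P ⟶ Q) => relCowedge a₁ a₂ S P i.1 i.2 :=
  fun _ _ _ h => relCowedge_hom_ext a₁ a₂ S fun Q ξ => h ⟨Q, ξ⟩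

end Relative

/-! ### The Nakayama functor of a category of left modules -/

section LeftEquivariance

open MonoidalLeftAction

variable {k : Type u} [Field k]
variable {C : Type u₁} [Category.{v₁} C] [Preadditive C] [Linear k C] [MonoidalCategory C]
  [RigidCategory C]
variable {M : Type u₂} [Category.{v₂} M] [Preadditive M] [Linear k M]
variable {N : M ⥤ M} (S : NakayamaStructure k N)
variable [MonoidalLeftAction C M] [LeftActionPreadditive C M] [LeftActionLinear k C M]

/-- A component of the universal dinatural family is compatible with actions of `A` if the
functional is invariant. -/
theorem cowedge_nakayamaLeftAct {A : C} {X Y : M} (q : ldual (ldual A) ⊙ₗ X ⟶ X)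
    (act : A ⊙ₗ Y ⟶ Y) (ζ : Module.Dual k (X ⟶ Y))
    (hζ : ∀ h : X ⟶ A ⊙ₗ Y, ζ (h ≫ act) =
      ζ (leftCoev (ldual A) (ldual (ldual A)) X ≫ ldual A ⊴ₗ (q ≫ h) ≫ leftEv A (ldual A) Y)) :
    A ⊴ₗ (S.cowedge X).app Y ζ ≫ nakayamaLeftAct k S A q = act ≫ (S.cowedge X).app Y ζ := by
  have h := map_app_can k (leftActionAdj M (ldual A) (ldual (ldual A)))
    (leftActionAdj M A (ldual A)) (leftActionAdj M (rdual A) A) S S X Y ζ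
  refine (Category.assoc _ _ _).symm.trans ((congrArg (· ≫ N.map q) h).trans ?_)
  -- Both sides become structure morphisms at A ⊗ Y: the right one by dinaturality along `act`, the
  -- left one by the characterisation of `can` and the functoriality of `N` along `q`. Only their
  -- functionals remain to be compared.
  rw [← NakayamaCowedge.dinatural]
  refine (S.natural q _ _).trans (congrArg ((S.cowedge X).app (A ⊙ₗ Y)) ?_)
  ext h
  refine Eq.trans ?_ (hζ h).symm
  refine congrArg ζ ?_
  change leftCoev (ldual A) (ldual (ldual A)) X ≫ ldual A ⊴ₗ (q ≫ h) ≫ leftEv A (ldual A) Y = _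
  rfl

end LeftEquivariance

/-! ### Invariance of the trace over A -/

section DualTensorUnit

open MonoidalLeftAction

variable {C : Type u₁} [Category.{v₁} C] [MonoidalCategory C] [RightRigidCategory C]
variable {M : Type u₂} [Category.{v₂} M] [MonoidalLeftAction C M] [HasCoequalizers M]
  [LeftActionRightExact C M] (A : C) [MonObj A]

/-- The action of `A` on the target is moved to the action of `A^∨∨` on `A^∨ ⊗_A P`. -/
theorem dualTensorUnit_mul {P : M} (p : A ⊙ₗ P ⟶ P) (Q : Mod M A)
    (h : dualTensor A p ⟶ A ⊙ₗ Q.X) :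
    dualTensorUnit A p ≫ A ⊴ₗ (h ≫ γ[Q.X]) ≫ γ[Q.X] =
      dualTensorUnit A p ≫ A ⊴ₗ (leftCoev (ldual A) (ldual (ldual A)) (dualTensor A p) ≫
        ldual A ⊴ₗ (dualTensorAct A p ≫ h) ≫ leftEv A (ldual A) Q.X) ≫ γ[Q.X] := by
  have h₁ := leftCoev_mul A (dualTensorπ A p ≫ h)
  -- The action of A^∨∨ on A^∨ ⊗_A P comes from A^∨ ⊗ P, so along the projection the inner morphism
  -- is the one in `leftCoev_mul`.
  have h₂ : dualTensorπ A p ≫ leftCoev (ldual A) (ldual (ldual A)) (dualTensor A p) ≫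
        ldual A ⊴ₗ (dualTensorAct A p ≫ h) ≫ leftEv A (ldual A) Q.X =
      leftCoev (ldual A) (ldual (ldual A)) (ldual A ⊙ₗ P) ≫
        ldual A ⊴ₗ ((αₗ _ _ P).inv ≫ dualBiact A ⊵ₗ P ≫ dualTensorπ A p ≫ h) ≫
          leftEv A (ldual A) Q.X := by
    rw [reassoc_of% leftCoev_naturality (ldual A) (ldual (ldual A)),
      ← actionHomRight_comp_assoc, reassoc_of% dualTensorπ_act]
  -- On the left the two successive actions on `Q` merge into one action after `μ`, by
  -- associativity; this is closed by the final simplification.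
  rw [dualTensorUnit, Category.assoc, Category.assoc, ← actionHomRight_comp_assoc,
    ← actionHomRight_comp_assoc, h₂, ← reassoc_of% h₁]
  simp

end DualTensorUnit

/-! ### Assembly of the left module case -/

section LeftMain

open MonoidalLeftAction

variable (k : Type u) [Field k]
variable {C : Type u₁} [Category.{v₁} C] [Preadditive C] [Linear k C] [MonoidalCategory C]
  [RigidCategory C]
variable {M : Type u₂} [Category.{v₂} M] [Preadditive M] [Linear k M]
variable [MonoidalLeftAction C M] [LeftActionPreadditive C M] [LeftActionLinear k C M]
variable (A : C) [MonObj A]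

instance : (freeMod M A).Additive where
  map_add {_ _ f g} := Mod.hom_ext _ _ (LeftActionPreadditive.actionHomRight_add A f g)

instance : (freeMod M A).Linear k where
  map_smul f r := Mod.hom_ext _ _ (LeftActionLinear.actionHomRight_smul A r f)

instance : (Mod.forget (D := M) A).Additive where

instance : (Mod.forget (D := M) A).Linear k where

instance : (Mod.forget (D := M) A).Faithful where
  map_injective h := Mod.hom_ext _ _ h

variable [HasCoequalizers M] [LeftActionRightExact C M]
  {N : M ⥤ M} (S : NakayamaStructure k N)

/-- The comparison map is the trace h ↦ unit ≫ (A ⊗ h) ≫ action, so the invariance required by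
`cowedge_nakayamaLeftAct` already holds before applying `ξ`, by `dualTensorUnit_mul`. -/
theorem relCowedge_nakayamaLeftAct (P Q : Mod M A) (ξ : Module.Dual k (P ⟶ Q)) :
    A ⊴ₗ relCowedge (dualTensorAdj M A) (freeModAdj M A) S P Q ξ ≫
        nakayamaLeftAct k S A (dualTensorAct A γ[P.X]) =
      γ[Q.X] ≫ relCowedge (dualTensorAdj M A) (freeModAdj M A) S P Q ξ :=
  cowedge_nakayamaLeftAct S _ _ _ fun h => congrArg ξ (Mod.hom_ext _ _
    (dualTensorUnit_mul A γ[P.X] Q h))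

theorem isLeftActionOn_nakayama :
    IsLeftActionOn (dualTensorFunctor A ⋙ N)
      (fun P : Mod M A => nakayamaLeftAct k S A (dualTensorAct A γ[P.X])) :=
  IsLeftActionOn.of_jointlyEpi
    (jointlyEpi_relCowedge (dualTensorAdj M A) (freeModAdj M A) S)
    (fun P i => relCowedge_nakayamaLeftAct k A S P i.1 i.2)
    (fun {P P'} f i => by
      -- The image of a member of the family for `P` is a member of the family for `P'`, hence again
      -- equivariant.
      have h := relCowedge_natural (dualTensorAdj M A) (freeModAdj M A) S f i.1 i.2
      refine (congrArg (γ[i.1.X] ≫ ·) h).trans ?_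
      exact (relCowedge_nakayamaLeftAct k A S P' i.1 _).symm.trans
        (congrArg (fun x => A ⊴ₗ x ≫ _) h.symm))

theorem nakayamaStructure_left
    (h : IsLeftActionOn (dualTensorFunctor A ⋙ N)
      (fun P : Mod M A => nakayamaLeftAct k S A (dualTensorAct A γ[P.X]))) :
    Nonempty (NakayamaStructure k h.lift) :=
  NakayamaStructure.nonempty_of_adjunctions (dualTensorAdj M A) (freeModAdj M A) S
    (Iso.refl (dualTensorFunctor A ⋙ N))
    (fun P Q ξ => ⟨Mod.Hom.mk' (N := h.lift.obj P)
      (relCowedge (dualTensorAdj M A) (freeModAdj M A) S P Q ξ)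
      (relCowedge_nakayamaLeftAct k A S P Q ξ).symm, Category.comp_id _⟩)
    (fun P Z g hg => ⟨Mod.Hom.mk' (M := h.lift.obj P) g
      -- Each composite of `g` with the family underlies a module morphism, so `g` is linear on a
      -- cover and hence linear.
      ((jointlyEpi_relCowedge (dualTensorAdj M A) (freeModAdj M A) S P).leftAct_hom
        (fun i => relCowedge_nakayamaLeftAct k A S P i.1 i.2) g fun i => by
          obtain ⟨s, hs⟩ := hg i.1 i.2
          have hs' : γ[i.1.X] ≫ s.hom = A ⊴ₗ s.hom ≫ γ[Z.X] := IsModHom.smul_hom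
          change s.hom = _ at hs
          rw [hs] at hs'
          exact hs'), (Category.id_comp _).symm⟩)

end LeftMain

/-! ### Right module categories -/

section RightDuality

open MonoidalRightAction

variable {C : Type u₁} [Category.{v₁} C] [MonoidalCategory C]
variable {M : Type u₂} [Category.{v₂} M] [MonoidalRightAction C M]

section Pairing

variable (X Y : C) [ExactPairing X Y]

/-- The coevaluation `P ⟶ P ⊗ X ⊗ Y` of a dual pair acting on the right. -/
def rightCoev (P : M) : P ⟶ (P ⊙ᵣ X) ⊙ᵣ Y := (ρᵣ P).inv ≫ P ⊴ᵣ η_ X Y ≫ (αᵣ P X Y).hom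

/-- The evaluation `P ⊗ Y ⊗ X ⟶ P` of a dual pair acting on the right. -/
def rightEv (P : M) : (P ⊙ᵣ Y) ⊙ᵣ X ⟶ P := (αᵣ P Y X).inv ≫ P ⊴ᵣ ε_ X Y ≫ (ρᵣ P).hom

theorem rightCoev_naturality {P P' : M} (f : P ⟶ P') :
    f ≫ rightCoev X Y P' = rightCoev X Y P ≫ (f ⊵ᵣ X) ⊵ᵣ Y :=
  (rightActionAdj M X Y).unit.naturality f

theorem rightEv_naturality {P P' : M} (f : P ⟶ P') :
    (f ⊵ᵣ Y) ⊵ᵣ X ≫ rightEv X Y P' = rightEv X Y P ≫ f :=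
  (rightActionAdj M X Y).counit.naturality f

theorem rightCoev_rightEv (P : M) : rightCoev X Y P ⊵ᵣ X ≫ rightEv X Y (P ⊙ᵣ X) = 𝟙 (P ⊙ᵣ X) :=
  (rightActionAdj M X Y).left_triangle_components P

theorem rightCoev_rightEv' (P : M) : rightCoev X Y (P ⊙ᵣ Y) ≫ rightEv X Y P ⊵ᵣ Y = 𝟙 (P ⊙ᵣ Y) :=
  (rightActionAdj M X Y).right_triangle_components P

end Pairing

section Mates

variable {X Y V Z T : C} [ExactPairing X Y] [ExactPairing Z V] {s : Y ⊗ T ⟶ V} {r : T ⊗ Z ⟶ X}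
  (h : Y ◁ r ≫ ε_ X Y = (α_ Y T Z).inv ≫ s ▷ Z ≫ ε_ Z V)

include h

/-- The mirror image of `leftEv_mate`: `r` is the transpose of `s` for duals on the other side. The
pairs in use are (`μ`, `codualAct`) and (`codualAct`, `codualBiact`). -/
theorem rightEv_mate (W : M) :
    ((αᵣ W Y T).inv ≫ W ⊴ᵣ s) ⊵ᵣ Z ≫ rightEv Z V W =
      (αᵣ (W ⊙ᵣ Y) T Z).inv ≫ (W ⊙ᵣ Y) ⊴ᵣ r ≫ rightEv X Y W := by
  have h' := congrArg (W ⊴ᵣ ·) h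
  simp only [actionHomRight_comp, actionHomRight_whiskerRight, Category.assoc] at h'
  have h₁ : (W ⊙ᵣ Y) ⊴ᵣ r ≫ (αᵣ W Y X).inv = (αᵣ W Y (T ⊗ Z)).inv ≫ W ⊴ᵣ (Y ◁ r) := by simp
  have h₂ := actionAssoc_right Y T Z W
  rw [← cancel_epi ((αᵣ W Y T).inv ⊵ᵣ Z)] at h₂
  simp only [inv_hom_actionHomLeft_assoc] at h₂
  simp only [rightEv, comp_actionHomLeft, Category.assoc]
  rw [reassoc_of% h₁, reassoc_of% h', reassoc_of% h₂]
  simp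

/-- As on the left, both sides have the same transpose, here under the adjunction between the right
actions of `Z` and `V`. -/
theorem rightCoev_mate (P : M) :
    rightCoev X Y P ⊵ᵣ T ≫ (αᵣ (P ⊙ᵣ X) Y T).inv ≫ (P ⊙ᵣ X) ⊴ᵣ s =
      rightCoev Z V (P ⊙ᵣ T) ≫ ((αᵣ P T Z).inv ≫ P ⊴ᵣ r) ⊵ᵣ V := by
  have h₁ : (rightCoev X Y P ⊵ᵣ T) ⊵ᵣ Z ≫ (αᵣ ((P ⊙ᵣ X) ⊙ᵣ Y) T Z).inv =
      (αᵣ P T Z).inv ≫ rightCoev X Y P ⊵ᵣ (T ⊗ Z) := by simp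
  have key : (rightCoev X Y P ⊵ᵣ T ≫ (αᵣ (P ⊙ᵣ X) Y T).inv ≫ (P ⊙ᵣ X) ⊴ᵣ s) ⊵ᵣ Z ≫
      rightEv Z V (P ⊙ᵣ X) = (αᵣ P T Z).inv ≫ P ⊴ᵣ r := by
    rw [comp_actionHomLeft, Category.assoc, rightEv_mate h, reassoc_of% h₁,
      ← action_exchange_assoc, rightCoev_rightEv, Category.comp_id]
  rw [← key, comp_actionHomLeft, ← reassoc_of% rightCoev_naturality Z V, rightCoev_rightEv',
    Category.comp_id]

end Mates

section Algebras

variable [LeftRigidCategory C] (B : C) [MonObj B]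

theorem codualAct_evaluation :
    B ◁ codualAct B ≫ ε_ (rdual B) B =
      (α_ B B (rdual B)).inv ≫ μ[B] ▷ rdual B ≫ ε_ (rdual B) B :=
  mateRight_evaluation _

theorem codualBiact_evaluation :
    B ◁ codualBiact B ≫ ε_ (rdual B) B =
      (α_ B (rdual B) (rdual (rdual B))).inv ≫ codualAct B ▷ rdual (rdual B) ≫
        ε_ (rdual (rdual B)) (rdual B) :=
  mateRight_evaluation _

/-- The transport of multiplication through `^∨B ⊗ ^∨∨B ⟶ ^∨B`. -/
theorem rightCoev_mul {P Q : M} (H : P ⊙ᵣ rdual B ⟶ Q ⊙ᵣ B) :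
    rightCoev (rdual B) B P ≫ H ⊵ᵣ B ≫ (αᵣ Q B B).inv ≫ Q ⊴ᵣ μ[B] =
      rightCoev (rdual B) B P ≫ (rightCoev (rdual (rdual B)) (rdual B) (P ⊙ᵣ rdual B) ≫
        ((αᵣ P _ _).inv ≫ P ⊴ᵣ codualBiact B ≫ H) ⊵ᵣ rdual B ≫ rightEv (rdual B) B Q) ⊵ᵣ B := by
  have h₁ := rightCoev_mate (codualBiact_evaluation B) P
  -- The inner morphism on the right is the transpose of the whole left side, through `codualBiact`,
  -- then `codualAct`, then `μ`.
  have h₂ : rightCoev (rdual (rdual B)) (rdual B) (P ⊙ᵣ rdual B) ≫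
        ((αᵣ P _ _).inv ≫ P ⊴ᵣ codualBiact B ≫ H) ⊵ᵣ rdual B ≫ rightEv (rdual B) B Q =
      (rightCoev (rdual B) B P ≫ H ⊵ᵣ B ≫ (αᵣ Q B B).inv ≫ Q ⊴ᵣ μ[B]) ⊵ᵣ rdual B ≫
        rightEv (rdual B) B Q := by
    have h₃ : (H ⊵ᵣ B) ⊵ᵣ rdual B ≫ (αᵣ (Q ⊙ᵣ B) B (rdual B)).inv =
        (αᵣ (P ⊙ᵣ rdual B) B (rdual B)).inv ≫ H ⊵ᵣ (B ⊗ rdual B) := by simp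
    rw [← Category.assoc (αᵣ P _ _).inv, comp_actionHomLeft, Category.assoc,
      ← reassoc_of% h₁]
    simp only [comp_actionHomLeft (rightCoev (rdual B) B P),
      comp_actionHomLeft (H ⊵ᵣ B), Category.assoc]
    rw [rightEv_mate (codualAct_evaluation B), reassoc_of% h₃, ← action_exchange_assoc]
  rw [h₂, comp_actionHomLeft, ← reassoc_of% rightCoev_naturality (rdual B) B]
  simp only [Category.assoc]
  rw [rightCoev_rightEv', Category.comp_id]

end Algebras

end RightDuality

/-! ### The adjunctions between right modules and objects -/

section RightModuleAdjunctions

open MonoidalRightAction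

variable {C : Type u₁} [Category.{v₁} C] [MonoidalCategory C]
variable (M : Type u₂) [Category.{v₂} M] [MonoidalRightAction C M] (B : C) [MonObj B]

/-- The free right `B`-module on an object. -/
def freeRightModObj (Y : M) : RightMod M B where
  X := Y ⊙ᵣ B
  act := (αᵣ Y B B).inv ≫ Y ⊴ᵣ μ[B]
  act_one := by
    have h := congrArg (Y ⊴ᵣ ·) (MonObj.mul_one B)
    simp only [actionHomRight_comp] at h
    rw [action_actionHomRight]
    simp [h]
  act_mul := by
    have h := congrArg (Y ⊴ᵣ ·) (MonObj.mul_assoc_flip B)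
    simp only [actionHomRight_comp, actionHomRight_whiskerRight, Category.assoc] at h
    rw [action_actionHomRight]
    simp only [Category.assoc, Iso.hom_inv_id_assoc, comp_actionHomLeft]
    rw [h, ← reassoc_of% actionAssoc_right' B B B Y, Iso.inv_hom_id_assoc]

variable {M} in
theorem mul_actionHomLeft {Y Y' : M} (f : Y ⟶ Y') :
    ((αᵣ Y B B).inv ≫ Y ⊴ᵣ μ[B]) ≫ f ⊵ᵣ B = (f ⊵ᵣ B) ⊵ᵣ B ≫ (αᵣ Y' B B).inv ≫ Y' ⊴ᵣ μ[B] := by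
  rw [Category.assoc, action_exchange]
  simp

/-- The free right `B`-module functor. -/
def freeRightMod : M ⥤ RightMod M B where
  obj Y := freeRightModObj M B Y
  map f := ⟨f ⊵ᵣ B, mul_actionHomLeft B f⟩
  map_id Y := RightMod.hom_ext _ _ (by simp; rfl)
  map_comp f g := RightMod.hom_ext _ _ (by simp; rfl)

/-- The forgetful functor from right modules. -/
def RightMod.forget : RightMod M B ⥤ M where
  obj P := P.X
  map f := f.hom

/-- Free right modules are left adjoint to the forgetful functor. -/
def freeRightModAdj : freeRightMod M B ⊣ RightMod.forget M B where
  unit :=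
    { app := fun Y => (ρᵣ Y).inv ≫ Y ⊴ᵣ η[B]
      naturality := fun Y Y' f => by
        change f ≫ (ρᵣ Y').inv ≫ Y' ⊴ᵣ η[B] = ((ρᵣ Y).inv ≫ Y ⊴ᵣ η[B]) ≫ f ⊵ᵣ B
        rw [← actionUnitIso_inv_naturality_assoc, Category.assoc, action_exchange] }
  counit :=
    { app := fun Q => ⟨Q.act, by
        change ((αᵣ Q.X B B).inv ≫ Q.X ⊴ᵣ μ[B]) ≫ Q.act = Q.act ⊵ᵣ B ≫ Q.act
        rw [Category.assoc, Q.act_mul, Iso.inv_hom_id_assoc]⟩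
      naturality := fun Q Q' f => RightMod.hom_ext _ _ f.act_hom.symm }
  left_triangle_components Y := RightMod.hom_ext _ _ (by
    have h := congrArg (Y ⊴ᵣ ·) (MonObj.one_mul B)
    simp only [actionHomRight_comp, actionHomRight_whiskerRight, Category.assoc,
      actionHom_leftUnitor] at h
    change ((ρᵣ Y).inv ≫ Y ⊴ᵣ η[B]) ⊵ᵣ B ≫ (αᵣ Y B B).inv ≫ Y ⊴ᵣ μ[B] = 𝟙 _
    rw [comp_actionHomLeft, Category.assoc, ← cancel_epi ((ρᵣ[C] Y).hom ⊵ᵣ B),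
      ← cancel_epi (αᵣ Y (𝟙_ C) B).hom]
    simp [h])
  right_triangle_components Q := by
    change ((ρᵣ Q.X).inv ≫ Q.X ⊴ᵣ η[B]) ≫ Q.act = 𝟙 _
    rw [Category.assoc, Q.act_one, Iso.inv_hom_id]

end RightModuleAdjunctions

/-! ### The adjunction between - ⊗_B ^∨B and free right modules -/

section CodualTensorAdjunction

open MonoidalRightAction

variable {C : Type u₁} [Category.{v₁} C] [MonoidalCategory C] [LeftRigidCategory C]
variable {M : Type u₂} [Category.{v₂} M] [MonoidalRightAction C M] [HasCoequalizers M]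
variable (B : C) [MonObj B]

/-- A balanced morphism out of `P ⊗ ^∨B` factors through `P ⊗_B ^∨B`. -/
noncomputable def codualTensorDesc {P Z : M} (b : P ⊙ᵣ B ⟶ P) (g : P ⊙ᵣ rdual B ⟶ Z)
    (h : b ⊵ᵣ rdual B ≫ g = ((αᵣ P B (rdual B)).inv ≫ P ⊴ᵣ codualAct B) ≫ g) :
    codualTensor B b ⟶ Z :=
  coequalizer.desc g h

theorem codualTensorπ_desc {P Z : M} (b : P ⊙ᵣ B ⟶ P) (g : P ⊙ᵣ rdual B ⟶ Z)
    (h : b ⊵ᵣ rdual B ≫ g = ((αᵣ P B (rdual B)).inv ≫ P ⊴ᵣ codualAct B) ≫ g) :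
    codualTensorπ B b ≫ codualTensorDesc B b g h = g :=
  coequalizer.π_desc _ _

/-- The unit `P ⟶ (P ⊗_B ^∨B) ⊗ B`. -/
noncomputable def codualTensorUnit {P : M} (b : P ⊙ᵣ B ⟶ P) : P ⟶ codualTensor B b ⊙ᵣ B :=
  rightCoev (rdual B) B P ≫ codualTensorπ B b ⊵ᵣ B

/-- Balancing turns `b` into the action of B on ^∨B, whose transpose is multiplication on the outer
factor B. -/
theorem codualTensorUnit_act {P : M} (b : P ⊙ᵣ B ⟶ P) :
    b ≫ codualTensorUnit B b = codualTensorUnit B b ⊵ᵣ B ≫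
      (αᵣ (codualTensor B b) B B).inv ≫ codualTensor B b ⊴ᵣ μ[B] := by
  have h := rightCoev_mate (codualAct_evaluation B) P
  have h₁ : (codualTensorπ B b ⊵ᵣ B) ⊵ᵣ B ≫ (αᵣ (codualTensor B b) B B).inv =
    (αᵣ (P ⊙ᵣ rdual B) B B).inv ≫ codualTensorπ B b ⊵ᵣ (B ⊗ B) := by simp
  rw [codualTensorUnit, reassoc_of% rightCoev_naturality (rdual B) B,
    comp_actionHomLeft (rightCoev _ _ _), Category.assoc, reassoc_of% h₁, ← action_exchange,
    reassoc_of% h, ← comp_actionHomLeft, ← comp_actionHomLeft, codualTensor_condition,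
    Category.assoc]

theorem codualTensorUnit_naturality {P P' : M} (b : P ⊙ᵣ B ⟶ P) (b' : P' ⊙ᵣ B ⟶ P') (f : P ⟶ P')
    (h : b ≫ f = f ⊵ᵣ B ≫ b') :
    f ≫ codualTensorUnit B b' = codualTensorUnit B b ≫ codualTensorMap B b b' f h ⊵ᵣ B := by
  rw [codualTensorUnit, codualTensorUnit, reassoc_of% rightCoev_naturality (rdual B) B,
    Category.assoc, ← comp_actionHomLeft, ← comp_actionHomLeft, codualTensorπ_map]

/-- The counit `(Y ⊗ B) ⊗_B ^∨B ⟶ Y`. -/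
noncomputable def codualTensorCounit (Y : M) :
    codualTensor B ((αᵣ Y B B).inv ≫ Y ⊴ᵣ μ[B]) ⟶ Y :=
  codualTensorDesc B _ (rightEv (rdual B) B Y) (by
    rw [Category.assoc]
    exact rightEv_mate (codualAct_evaluation B) Y)

theorem codualTensorπ_counit (Y : M) :
    codualTensorπ B ((αᵣ Y B B).inv ≫ Y ⊴ᵣ μ[B]) ≫ codualTensorCounit B Y =
      rightEv (rdual B) B Y :=
  codualTensorπ_desc _ _ _ _

theorem codualTensorCounit_naturality {Y Y' : M} (f : Y ⟶ Y') :
    codualTensorMap B _ _ (f ⊵ᵣ B) (mul_actionHomLeft B f) ≫ codualTensorCounit B Y' =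
      codualTensorCounit B Y ≫ f := by
  rw [← cancel_epi (codualTensorπ B _), reassoc_of% codualTensorπ_map, codualTensorπ_counit,
    rightEv_naturality, reassoc_of% codualTensorπ_counit]

theorem codualTensorMap_unit_counit {P : M} (b : P ⊙ᵣ B ⟶ P) :
    codualTensorMap B _ _ (codualTensorUnit B b) (codualTensorUnit_act B b) ≫
      codualTensorCounit B (codualTensor B b) = 𝟙 _ := by
  rw [← cancel_epi (codualTensorπ B _), reassoc_of% codualTensorπ_map, codualTensorπ_counit,
    codualTensorUnit, comp_actionHomLeft, Category.assoc, rightEv_naturality,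
    reassoc_of% rightCoev_rightEv, Category.comp_id]

theorem codualTensorUnit_counit (Y : M) :
    codualTensorUnit B ((αᵣ Y B B).inv ≫ Y ⊴ᵣ μ[B]) ≫ codualTensorCounit B Y ⊵ᵣ B = 𝟙 _ := by
  rw [codualTensorUnit, Category.assoc, ← comp_actionHomLeft, codualTensorπ_counit,
    rightCoev_rightEv']

variable (M) in
/-- The functor `- ⊗_B ^∨B` is left adjoint to the free right module functor. -/
noncomputable def codualTensorAdj : codualTensorFunctor B ⊣ freeRightMod M B where
  unit :=
    { app := fun P => ⟨codualTensorUnit B P.act, codualTensorUnit_act B P.act⟩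
      naturality := fun P P' f => RightMod.hom_ext _ _
        (codualTensorUnit_naturality B _ _ f.hom f.act_hom) }
  counit :=
    { app := fun Y => codualTensorCounit B Y
      naturality := fun Y Y' f => codualTensorCounit_naturality B f }
  left_triangle_components P := codualTensorMap_unit_counit B P.act
  right_triangle_components Y := by
    apply RightMod.hom_ext
    exact codualTensorUnit_counit B Y

variable [RightActionRightExact C M]

/-- The action of `B` on the target is moved to the action of `^∨∨B` on `P ⊗_B ^∨B`. -/
theorem codualTensorUnit_mul {P : M} (b : P ⊙ᵣ B ⟶ P) (Q : RightMod M B)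
    (h : codualTensor B b ⟶ Q.X ⊙ᵣ B) :
    codualTensorUnit B b ≫ (h ≫ Q.act) ⊵ᵣ B ≫ Q.act =
      codualTensorUnit B b ≫ (rightCoev (rdual (rdual B)) (rdual B) (codualTensor B b) ≫
        (codualTensorAct B b ≫ h) ⊵ᵣ rdual B ≫ rightEv (rdual B) B Q.X) ⊵ᵣ B ≫ Q.act := by
  -- The identity for the double transpose, applied before the quotient; `Q.act_mul` later supplies
  -- the associativity that introduces `μ`.
  have h₁ := rightCoev_mul B (codualTensorπ B b ≫ h)
  have h₂ : codualTensorπ B b ≫ rightCoev (rdual (rdual B)) (rdual B) (codualTensor B b) ≫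
        (codualTensorAct B b ≫ h) ⊵ᵣ rdual B ≫ rightEv (rdual B) B Q.X =
      rightCoev (rdual (rdual B)) (rdual B) (P ⊙ᵣ rdual B) ≫
        ((αᵣ P _ _).inv ≫ P ⊴ᵣ codualBiact B ≫ codualTensorπ B b ≫ h) ⊵ᵣ rdual B ≫
          rightEv (rdual B) B Q.X := by
    rw [reassoc_of% rightCoev_naturality (rdual (rdual B)) (rdual B),
      ← comp_actionHomLeft_assoc, reassoc_of% codualTensorπ_act]
  rw [codualTensorUnit, Category.assoc, Category.assoc, ← comp_actionHomLeft_assoc,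
    ← comp_actionHomLeft_assoc, h₂, ← reassoc_of% h₁]
  simp [Q.act_mul]

end CodualTensorAdjunction

/-! ### The Nakayama functor of a category of right modules -/

section RightEquivariance

open MonoidalRightAction

variable {k : Type u} [Field k]
variable {C : Type u₁} [Category.{v₁} C] [Preadditive C] [Linear k C] [MonoidalCategory C]
  [RigidCategory C]
variable {M : Type u₂} [Category.{v₂} M] [Preadditive M] [Linear k M]
variable {N : M ⥤ M} (S : NakayamaStructure k N)
variable [MonoidalRightAction C M] [RightActionPreadditive C M] [RightActionLinear k C M]

/-- A component of the universal dinatural family is compatible with actions of `B` if the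
functional is invariant. -/
theorem cowedge_nakayamaRightAct {B : C} {X Y : M} (q : X ⊙ᵣ rdual (rdual B) ⟶ X)
    (act : Y ⊙ᵣ B ⟶ Y) (ζ : Module.Dual k (X ⟶ Y))
    (hζ : ∀ h : X ⟶ Y ⊙ᵣ B, ζ (h ≫ act) =
      ζ (rightCoev (rdual (rdual B)) (rdual B) X ≫ (q ≫ h) ⊵ᵣ rdual B ≫
        rightEv (rdual B) B Y)) :
    (S.cowedge X).app Y ζ ⊵ᵣ B ≫ nakayamaRightAct k S B q = act ≫ (S.cowedge X).app Y ζ := by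
  have h := map_app_can k (rightActionAdj M (rdual (rdual B)) (rdual B))
    (rightActionAdj M (rdual B) B) (rightActionAdj M B (ldual B)) S S X Y ζ
  refine (Category.assoc _ _ _).symm.trans ((congrArg (· ≫ N.map q) h).trans ?_)
  -- Both sides become structure morphisms at Y ⊗ B, so only the two functionals are left to
  -- compare.
  rw [← NakayamaCowedge.dinatural]
  refine (S.natural q _ _).trans (congrArg ((S.cowedge X).app (Y ⊙ᵣ B)) ?_)
  ext h
  exact (hζ h).symm

end RightEquivariance

/-! ### Assembly of the right module case -/

section RightMain

open MonoidalRightAction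

variable (k : Type u) [Field k]
variable {C : Type u₁} [Category.{v₁} C] [Preadditive C] [Linear k C] [MonoidalCategory C]
  [RigidCategory C]
variable {M : Type u₂} [Category.{v₂} M] [Preadditive M] [Linear k M]
variable [MonoidalRightAction C M] [RightActionPreadditive C M] [RightActionLinear k C M]
variable (B : C) [MonObj B]

instance : (freeRightMod M B).Additive where
  map_add {_ _ f g} := RightMod.hom_ext _ _ (RightActionPreadditive.add_actionHomLeft f g B)

instance : (freeRightMod M B).Linear k where
  map_smul f r := RightMod.hom_ext _ _ (RightActionLinear.smul_actionHomLeft r f B)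

instance : (RightMod.forget M B).Additive where

instance : (RightMod.forget M B).Linear k where

instance : (RightMod.forget M B).Faithful where
  map_injective h := RightMod.hom_ext _ _ h

variable [HasCoequalizers M] [RightActionRightExact C M]
  {N : M ⥤ M} (S : NakayamaStructure k N)

/-- The trace over B satisfies the invariance criterion by `codualTensorUnit_mul`, independently of
`ξ`. -/
theorem relCowedge_nakayamaRightAct (P Q : RightMod M B) (ξ : Module.Dual k (P ⟶ Q)) :
    relCowedge (codualTensorAdj M B) (freeRightModAdj M B) S P Q ξ ⊵ᵣ B ≫
        nakayamaRightAct k S B (codualTensorAct B P.act) =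
      Q.act ≫ relCowedge (codualTensorAdj M B) (freeRightModAdj M B) S P Q ξ :=
  cowedge_nakayamaRightAct S _ _ _ fun h => congrArg ξ (RightMod.hom_ext _ _
    (codualTensorUnit_mul B P.act Q h))

theorem isRightActionOn_nakayama :
    IsRightActionOn (codualTensorFunctor B ⋙ N)
      (fun P : RightMod M B => nakayamaRightAct k S B (codualTensorAct B P.act)) :=
  IsRightActionOn.of_jointlyEpi
    (jointlyEpi_relCowedge (codualTensorAdj M B) (freeRightModAdj M B) S)
    (fun P i => relCowedge_nakayamaRightAct k B S P i.1 i.2)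
    (fun {P P'} f i => by
      have h := relCowedge_natural (codualTensorAdj M B) (freeRightModAdj M B) S f i.1 i.2
      refine (congrArg (i.1.act ≫ ·) h).trans ?_
      exact (relCowedge_nakayamaRightAct k B S P' i.1 _).symm.trans
        (congrArg (fun x => x ⊵ᵣ B ≫ _) h.symm))

theorem nakayamaStructure_right
    (h : IsRightActionOn (codualTensorFunctor B ⋙ N)
      (fun P : RightMod M B => nakayamaRightAct k S B (codualTensorAct B P.act))) :
    Nonempty (NakayamaStructure k h.lift) :=
  NakayamaStructure.nonempty_of_adjunctions (codualTensorAdj M B) (freeRightModAdj M B) S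
    (Iso.refl (codualTensorFunctor B ⋙ N))
    (fun P Q ξ => ⟨⟨relCowedge (codualTensorAdj M B) (freeRightModAdj M B) S P Q ξ,
      (relCowedge_nakayamaRightAct k B S P Q ξ).symm⟩, Category.comp_id _⟩)
    (fun P Z g hg => ⟨⟨g,
      (jointlyEpi_relCowedge (codualTensorAdj M B) (freeRightModAdj M B) S P).rightAct_hom
        (fun i => relCowedge_nakayamaRightAct k B S P i.1 i.2) g fun i => by
          obtain ⟨s, hs⟩ := hg i.1 i.2
          have hs' := s.act_hom
          change s.hom = _ at hs
          rw [hs] at hs'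
          exact hs'⟩, (Category.id_comp _).symm⟩)

end RightMain

/-! ### Bimodule categories -/

section MiddleDuality

variable {C : Type u₁} [Category.{v₁} C] [MonoidalCategory C]
variable {M : Type u₂} [Category.{v₂} M] [MonoidalLeftAction C M] [MonoidalRightAction C M]
  [BimoduleCategory C M]

theorem middle_inv_naturality_middle (X : C) {m m' : M} (f : m ⟶ m') (Y : C) :
    X ⊴ₗ (f ⊵ᵣ Y) ≫ (middle X m' Y).inv = (middle X m Y).inv ≫ (X ⊴ₗ f) ⊵ᵣ Y := by
  rw [Iso.comp_inv_eq, Category.assoc, Iso.eq_inv_comp, middle_naturality_middle]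

/-- The pentagon handles the associator, naturality the coevaluation and the triangle axiom the
unit. Together with `leftEv_middle` this lets transposition over A commute with a right action. -/
theorem leftCoev_middle (X Y : C) [ExactPairing X Y] (P : M) (T : C) :
    leftCoev X Y P ⊵ᵣ T ≫ (middle X (Y ⊙ₗ P) T).hom ≫ X ⊴ₗ (middle Y P T).hom =
      leftCoev X Y (P ⊙ᵣ T) := by
  have h : (λₗ[C] P).inv ⊵ᵣ T ≫ (middle (𝟙_ C) P T).hom = (λₗ[C] (P ⊙ᵣ T)).inv := by
    rw [← cancel_mono (λₗ[C] (P ⊙ᵣ T)).hom, Category.assoc, triangle_left]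
    simp
  simp only [leftCoev, MonoidalRightAction.comp_actionHomLeft, Category.assoc]
  rw [pentagon_left, reassoc_of% middle_naturality_left, reassoc_of% h]

theorem leftEv_middle (X Y : C) [ExactPairing X Y] (P : M) (T : C) :
    (middle Y (X ⊙ₗ P) T).hom ≫ Y ⊴ₗ (middle X P T).hom ≫ leftEv X Y (P ⊙ᵣ T) =
      leftEv X Y P ⊵ᵣ T := by
  have h := pentagon_left Y X P T
  rw [← cancel_epi ((αₗ Y X P).inv ⊵ᵣ T)] at h
  simp only [MonoidalRightAction.inv_hom_actionHomLeft_assoc] at h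
  simp only [leftEv, MonoidalRightAction.comp_actionHomLeft]
  rw [reassoc_of% h, Iso.hom_inv_id_assoc, ← triangle_left,
    ← reassoc_of% middle_naturality_left]

theorem rightCoev_middle (X Y : C) [ExactPairing X Y] (P : M) (T : C) :
    T ⊴ₗ rightCoev X Y P ≫ (middle T (P ⊙ᵣ X) Y).inv ≫ (middle T P X).inv ⊵ᵣ Y =
      rightCoev X Y (T ⊙ₗ P) := by
  have h : T ⊴ₗ (ρᵣ[C] P).inv ≫ (middle T P (𝟙_ C)).inv = (ρᵣ[C] (T ⊙ₗ P)).inv := by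
    rw [← cancel_epi (T ⊴ₗ (ρᵣ[C] P).hom), ← cancel_epi (middle T P (𝟙_ C)).hom,
      MonoidalLeftAction.actionHomRight_hom_inv_assoc, Iso.hom_inv_id, reassoc_of% triangle_right,
      Iso.hom_inv_id]
  have h₁ : T ⊴ₗ (P ⊴ᵣ η_ X Y) ≫ (middle T P (X ⊗ Y)).inv =
      (middle T P (𝟙_ C)).inv ≫ (T ⊙ₗ P) ⊴ᵣ η_ X Y := by
    rw [Iso.comp_inv_eq, Category.assoc, Iso.eq_inv_comp, middle_naturality_right]
  have h₂ : T ⊴ₗ (αᵣ P X Y).hom ≫ (middle T (P ⊙ᵣ X) Y).inv ≫ (middle T P X).inv ⊵ᵣ Y =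
      (middle T P (X ⊗ Y)).inv ≫ (αᵣ (T ⊙ₗ P) X Y).hom := by
    rw [← cancel_epi (middle T P (X ⊗ Y)).hom, reassoc_of% pentagon_right]
    simp
  simp only [rightCoev, MonoidalLeftAction.actionHomRight_comp, Category.assoc]
  rw [h₂, reassoc_of% h₁, reassoc_of% h]

end MiddleDuality

/-! ### Compatibility of each adjunction with the action on the other side -/

section MiddleActions

variable {C : Type u₁} [Category.{v₁} C] [MonoidalCategory C] [RigidCategory C]
variable {M : Type u₂} [Category.{v₂} M] [MonoidalLeftAction C M] [MonoidalRightAction C M]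
  [BimoduleCategory C M]

/-- The object `X ⊗ P` with the right action induced by an action on `P`. -/
def RightMod.leftAct {B : C} [MonObj B] (X : C) (P : RightMod M B) : RightMod M B where
  X := X ⊙ₗ P.X
  act := (middle X P.X B).hom ≫ X ⊴ₗ P.act
  act_one := by
    rw [reassoc_of% middle_naturality_right, ← MonoidalLeftAction.actionHomRight_comp, P.act_one,
      triangle_right]
  act_mul := by
    rw [reassoc_of% middle_naturality_right, ← MonoidalLeftAction.actionHomRight_comp, P.act_mul,
      MonoidalLeftAction.actionHomRight_comp, reassoc_of% pentagon_right]
    simp only [MonoidalRightAction.comp_actionHomLeft,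
      Category.assoc,
      MonoidalLeftAction.actionHomRight_comp]
    rw [reassoc_of% middle_naturality_middle]

variable [HasCoequalizers M]

/-- This is what lifts the unit of the adjunction for A from objects to right modules. It follows
from `leftCoev_middle`, since the right action on A^∨ ⊗_A P is induced from P. -/
theorem dualTensorUnit_rightAct [RightActionRightExact C M] (A : C) [MonObj A] {Y : C} {P : M}
    (p : A ⊙ₗ P ⟶ P)
    (r : P ⊙ᵣ Y ⟶ P) (h : (middle A P Y).hom ≫ A ⊴ₗ r ≫ p = p ⊵ᵣ Y ≫ r) :
    r ≫ dualTensorUnit A p = dualTensorUnit A p ⊵ᵣ Y ≫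
      (middle A (dualTensor A p) Y).hom ≫ A ⊴ₗ dualTensorRightAct A p r h := by
  rw [dualTensorUnit, MonoidalRightAction.comp_actionHomLeft,
      Category.assoc,
    reassoc_of% middle_naturality_middle, ← MonoidalLeftAction.actionHomRight_comp,
    dualTensorπ_rightAct, MonoidalLeftAction.actionHomRight_comp, reassoc_of% leftCoev_middle,
    MonoidalLeftAction.actionHomRight_comp, reassoc_of% leftCoev_naturality A (ldual A)]

theorem codualTensorUnit_leftAct [LeftActionRightExact C M] (B : C) [MonObj B] {X : C} {P : M}
    (b : P ⊙ᵣ B ⟶ P) (l : X ⊙ₗ P ⟶ P) (h : (middle X P B).hom ≫ X ⊴ₗ b ≫ l = l ⊵ᵣ B ≫ b) :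
    l ≫ codualTensorUnit B b = X ⊴ₗ codualTensorUnit B b ≫
      (middle X (codualTensor B b) B).inv ≫ codualTensorLeftAct B b l h ⊵ᵣ B := by
  rw [codualTensorUnit, MonoidalLeftAction.actionHomRight_comp, Category.assoc,
    reassoc_of% middle_inv_naturality_middle, ← MonoidalRightAction.comp_actionHomLeft,
    codualTensorπ_leftAct, MonoidalRightAction.comp_actionHomLeft, reassoc_of% rightCoev_middle,
    MonoidalRightAction.comp_actionHomLeft, reassoc_of% rightCoev_naturality (rdual B) B]

/-- The action of `A^∨∨` on `P ⊗_B ^∨B` is compatible with the adjunction for `B`. -/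
theorem codualTensorUnit_leftEv [LeftActionRightExact C M] (A : C) (B : C) [MonObj B]
    {P Q : M} (b : P ⊙ᵣ B ⟶ P) (l : ldual (ldual A) ⊙ₗ P ⟶ P)
    (hl : (middle (ldual (ldual A)) P B).hom ≫ ldual (ldual A) ⊴ₗ b ≫ l = l ⊵ᵣ B ≫ b)
    (h : codualTensor B b ⟶ A ⊙ₗ Q) (r : Q ⊙ᵣ B ⟶ Q) :
    codualTensorUnit B b ≫ (leftCoev (ldual A) (ldual (ldual A)) (codualTensor B b) ≫
        ldual A ⊴ₗ (codualTensorLeftAct B b l hl ≫ h) ≫ leftEv A (ldual A) Q) ⊵ᵣ B ≫ r =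
      leftCoev (ldual A) (ldual (ldual A)) P ≫ ldual A ⊴ₗ (l ≫ codualTensorUnit B b ≫ h ⊵ᵣ B ≫
        (middle A Q B).hom ≫ A ⊴ₗ r) ≫ leftEv A (ldual A) Q := by
  -- First `l` is moved past the unit for B; then the coevaluation and evaluation for A are moved
  -- past the right action of B.
  rw [reassoc_of% codualTensorUnit_leftAct B b l hl]
  simp only [MonoidalRightAction.comp_actionHomLeft, MonoidalLeftAction.actionHomRight_comp,
    Category.assoc]
  rw [leftEv_naturality, ← reassoc_of% leftCoev_naturality (ldual A) (ldual (ldual A)),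
    ← leftCoev_middle, ← leftEv_middle]
  simp only [Category.assoc, MonoidalLeftAction.actionHomRight_hom_inv_assoc]
  rw [← reassoc_of% middle_naturality_middle, ← reassoc_of% middle_naturality_middle]

end MiddleActions

/-! ### The adjunctions between bimodules and right modules -/

section BimoduleAdjunctions

variable {C : Type u₁} [Category.{v₁} C] [MonoidalCategory C] [RigidCategory C]
variable (M : Type u₂) [Category.{v₂} M] [MonoidalLeftAction C M] [MonoidalRightAction C M]
  [BimoduleCategory C M] (A B : C) [MonObj A] [MonObj B]

variable {M A B} in
/-- The right module underlying a bimodule. -/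
def BiMod.right (P : BiMod M A B) : RightMod M B := ⟨P.left.X, P.act, P.act_one, P.act_mul⟩

/-- The forgetful functor from bimodules to right modules. -/
def BiMod.forgetLeft : BiMod M A B ⥤ RightMod M B where
  obj P := P.right
  map f := ⟨f.left.hom, f.act_hom⟩

variable {M B} in
/-- The bimodule `A ⊗ Y`, for a right module `Y`. -/
def freeBiModObj (Y : RightMod M B) : BiMod M A B where
  left := freeModObj M A Y.X
  act := (Y.leftAct A).act
  act_one := (Y.leftAct A).act_one
  act_mul := (Y.leftAct A).act_mul
  comm := by
    have h := pentagon_left A A Y.X B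
    rw [← cancel_epi ((αₗ A A Y.X).inv ⊵ᵣ B)] at h
    simp only [MonoidalRightAction.inv_hom_actionHomLeft_assoc] at h
    change (middle A (A ⊙ₗ Y.X) B).hom ≫ A ⊴ₗ ((middle A Y.X B).hom ≫ A ⊴ₗ Y.act) ≫
      (αₗ A A Y.X).inv ≫ μ[A] ⊵ₗ Y.X =
        ((αₗ A A Y.X).inv ≫ μ[A] ⊵ₗ Y.X) ⊵ᵣ B ≫ (middle A Y.X B).hom ≫ A ⊴ₗ Y.act
    rw [MonoidalLeftAction.actionHomRight_comp, Category.assoc, ← mul_actionHomRight,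
      reassoc_of% h, Category.assoc, Iso.hom_inv_id_assoc, MonoidalRightAction.comp_actionHomLeft,
      Category.assoc,
      reassoc_of% middle_naturality_left]

/-- The functor `Y ↦ A ⊗ Y` from right modules to bimodules. -/
def freeBiMod : RightMod M B ⥤ BiMod M A B where
  obj Y := freeBiModObj A Y
  map {Y Y'} f := ⟨(freeMod M A).map f.hom, by
    change ((middle A Y.X B).hom ≫ A ⊴ₗ Y.act) ≫ A ⊴ₗ f.hom =
      (A ⊴ₗ f.hom) ⊵ᵣ B ≫ (middle A Y'.X B).hom ≫ A ⊴ₗ Y'.act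
    rw [reassoc_of% middle_naturality_middle, Category.assoc,
      ← MonoidalLeftAction.actionHomRight_comp, f.act_hom,
      MonoidalLeftAction.actionHomRight_comp]⟩
  map_id Y := BiMod.hom_ext _ _ ((freeMod M A).map_id Y.X)
  map_comp f g := BiMod.hom_ext _ _ ((freeMod M A).map_comp f.hom g.hom)

/-- The functor `Y ↦ A ⊗ Y` is left adjoint to the forgetful functor. -/
def freeBiModAdj : freeBiMod M A B ⊣ BiMod.forgetLeft M A B where
  unit :=
    { app := fun Y => ⟨(freeModAdj M A).unit.app Y.X, by
        have h : (λₗ[C] Y.X).inv ⊵ᵣ B ≫ (middle (𝟙_ C) Y.X B).hom = (λₗ[C] (Y.X ⊙ᵣ B)).inv := by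
          rw [← cancel_mono (λₗ[C] (Y.X ⊙ᵣ B)).hom, Category.assoc, triangle_left]
          simp
        change Y.act ≫ (λₗ Y.X).inv ≫ η[A] ⊵ₗ Y.X =
          ((λₗ Y.X).inv ≫ η[A] ⊵ₗ Y.X) ⊵ᵣ B ≫ (middle A Y.X B).hom ≫ A ⊴ₗ Y.act
        rw [MonoidalRightAction.comp_actionHomLeft,
      Category.assoc,
          reassoc_of% middle_naturality_left, reassoc_of% h,
          ← MonoidalLeftAction.action_exchange,
          MonoidalLeftAction.actionUnitIso_inv_naturality_assoc]⟩
      naturality := fun _ _ f => RightMod.hom_ext _ _ ((freeModAdj M A).unit.naturality f.hom) }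
  counit :=
    { app := fun Q => ⟨(freeModAdj M A).counit.app Q.left, by
        -- Right linearity of the action map A ⊗ Q ⟶ Q is the commutation of the two actions on `Q`.
        have h := Q.comm
        refine (Category.assoc _ _ _).trans h⟩
      naturality := fun Q Q' f =>
        BiMod.hom_ext _ _ ((freeModAdj M A).counit.naturality f.left) }
  left_triangle_components Y :=
    BiMod.hom_ext _ _ ((freeModAdj M A).left_triangle_components Y.X)
  right_triangle_components Q :=
    RightMod.hom_ext _ _ ((freeModAdj M A).right_triangle_components Q.left)

variable [HasCoequalizers M] [RightActionRightExact C M]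

variable {M A B} in
/-- The right module `A^∨ ⊗_A P`, for a bimodule `P`. -/
noncomputable def BiMod.inner (P : BiMod M A B) : RightMod M B where
  X := dualTensor A γ[P.left.X]
  act := P.innerAct
  act_one := by
    have h := dualTensorπ_rightAct A γ[P.left.X] P.act P.comm
    have h₁ : (ldual A ⊙ₗ P.left.X) ⊴ᵣ η[B] ≫ (middle (ldual A) P.left.X B).hom ≫
        ldual A ⊴ₗ P.act = (ρᵣ[C] (ldual A ⊙ₗ P.left.X)).hom :=
      (P.right.leftAct (ldual A)).act_one
    -- The projection stays an epimorphism under right actions, so the module axioms descend from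
    -- A^∨ ⊗ P.
    rw [← cancel_epi (dualTensorπ A γ[P.left.X] ⊵ᵣ 𝟙_ C), BiMod.innerAct,
      ← MonoidalRightAction.action_exchange_assoc, h, reassoc_of% h₁]
    simp
  act_mul := by
    have h := dualTensorπ_rightAct A γ[P.left.X] P.act P.comm
    have h₁ : (ldual A ⊙ₗ P.left.X) ⊴ᵣ μ[B] ≫ (middle (ldual A) P.left.X B).hom ≫
        ldual A ⊴ₗ P.act = (αᵣ (ldual A ⊙ₗ P.left.X) B B).hom ≫
          ((middle (ldual A) P.left.X B).hom ≫ ldual A ⊴ₗ P.act) ⊵ᵣ B ≫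
            (middle (ldual A) P.left.X B).hom ≫ ldual A ⊴ₗ P.act :=
      (P.right.leftAct (ldual A)).act_mul
    have h₂ : dualTensorπ A γ[P.left.X] ⊵ᵣ (B ⊗ B) ≫ (αᵣ (dualTensor A γ[P.left.X]) B B).hom =
        (αᵣ (ldual A ⊙ₗ P.left.X) B B).hom ≫ (dualTensorπ A γ[P.left.X] ⊵ᵣ B) ⊵ᵣ B := by simp
    rw [← cancel_epi (dualTensorπ A γ[P.left.X] ⊵ᵣ (B ⊗ B)), BiMod.innerAct,
      ← MonoidalRightAction.action_exchange_assoc, h, reassoc_of% h₁, reassoc_of% h₂,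
      ← MonoidalRightAction.comp_actionHomLeft_assoc, h]
    simp only [MonoidalRightAction.comp_actionHomLeft, Category.assoc, h]

/-- The functor `P ↦ A^∨ ⊗_A P` from bimodules to right modules. -/
noncomputable def innerFunctor : BiMod M A B ⥤ RightMod M B where
  obj P := P.inner
  map f := ⟨BiMod.innerMap f, BiMod.innerAct_map f⟩
  map_id P := RightMod.hom_ext _ _ (BiMod.innerMap_id P)
  map_comp f g := RightMod.hom_ext _ _ (BiMod.innerMap_comp f g)

variable {M B} in
-- The counit is induced by the evaluation, which commutes with right actions by `leftEv_middle`;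
-- this lifts it to right modules.
theorem dualTensorCounit_rightAct (Y : RightMod M B) :
    (freeBiModObj A Y).innerAct ≫ dualTensorCounit A Y.X =
      dualTensorCounit A Y.X ⊵ᵣ B ≫ Y.act := by
  have h : dualTensorπ A ((αₗ A A Y.X).inv ≫ μ[A] ⊵ₗ Y.X) ⊵ᵣ B ≫ (freeBiModObj A Y).innerAct =
      (middle (ldual A) (A ⊙ₗ Y.X) B).hom ≫
        ldual A ⊴ₗ ((middle A Y.X B).hom ≫ A ⊴ₗ Y.act) ≫
          dualTensorπ A ((αₗ A A Y.X).inv ≫ μ[A] ⊵ₗ Y.X) :=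
    dualTensorπ_rightAct A γ[(freeModObj M A Y.X).X] (freeBiModObj A Y).act (freeBiModObj A Y).comm
  refine (cancel_epi (dualTensorπ A ((αₗ A A Y.X).inv ≫ μ[A] ⊵ₗ Y.X) ⊵ᵣ B)).1 ?_
  refine ((Category.assoc _ _ _).symm.trans (congrArg (· ≫ dualTensorCounit A Y.X) h)).trans ?_
  rw [← MonoidalRightAction.comp_actionHomLeft_assoc, dualTensorπ_counit, ← leftEv_middle]
  simp only [Category.assoc, MonoidalLeftAction.actionHomRight_comp]
  rw [dualTensorπ_counit, leftEv_naturality]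

/-- The functor `A^∨ ⊗_A -` from bimodules to right modules is left adjoint to `A ⊗ -`. -/
noncomputable def innerAdj : innerFunctor M A B ⊣ freeBiMod M A B where
  unit :=
    { app := fun P => ⟨(dualTensorAdj M A).unit.app P.left,
        dualTensorUnit_rightAct A γ[P.left.X] P.act P.comm⟩
      naturality := fun _ _ f =>
        BiMod.hom_ext _ _ ((dualTensorAdj M A).unit.naturality f.left) }
  counit :=
    { app := fun Y => ⟨dualTensorCounit A Y.X, dualTensorCounit_rightAct A Y⟩
      naturality := fun _ _ f =>
        RightMod.hom_ext _ _ ((dualTensorAdj M A).counit.naturality f.hom) }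
  left_triangle_components P :=
    RightMod.hom_ext _ _ ((dualTensorAdj M A).left_triangle_components P.left)
  right_triangle_components Y :=
    BiMod.hom_ext _ _ ((dualTensorAdj M A).right_triangle_components Y.X)

/-- The functor `P ↦ (A^∨ ⊗_A P) ⊗_B ^∨B` is left adjoint to the free bimodule functor. -/
noncomputable def biTensorAdj :
    biTensorFunctor (M := M) A B ⊣ freeRightMod M B ⋙ freeBiMod M A B :=
  (innerAdj M A B).comp (codualTensorAdj M B)

/-- The free bimodule functor is left adjoint to the forgetful functor. -/
noncomputable def biFreeAdj :
    freeRightMod M B ⋙ freeBiMod M A B ⊣ BiMod.forgetLeft M A B ⋙ RightMod.forget M B :=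
  (freeRightModAdj M B).comp (freeBiModAdj M A B)

end BimoduleAdjunctions

/-! ### Invariance of the double trace under A -/

section BiTensorUnit

variable {C : Type u₁} [Category.{v₁} C] [MonoidalCategory C] [RigidCategory C]
variable {M : Type u₂} [Category.{v₂} M] [MonoidalLeftAction C M] [MonoidalRightAction C M]
  [BimoduleCategory C M] (A B : C) [MonObj A] [MonObj B]
variable [HasCoequalizers M] [LeftActionRightExact C M] [RightActionRightExact C M]

/-- Since the actions on `Q` commute, the action of A can be taken out of the trace over B. The
invariance of the trace over A then applies, and `codualTensorUnit_leftEv` carries the resulting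
action of A^∨∨ back inside the trace over B. -/
theorem biTensor_mul (P Q : BiMod M A B) (h : codualTensor B P.innerAct ⟶ A ⊙ₗ Q.left.X) :
    dualTensorUnit A γ[P.left.X] ≫
        A ⊴ₗ (codualTensorUnit B P.innerAct ≫ (h ≫ γ[Q.left.X]) ⊵ᵣ B ≫ Q.act) ≫ γ[Q.left.X] =
      dualTensorUnit A γ[P.left.X] ≫
        A ⊴ₗ (codualTensorUnit B P.innerAct ≫
          (leftCoev (ldual A) (ldual (ldual A)) (codualTensor B P.innerAct) ≫
            ldual A ⊴ₗ (codualTensorLeftAct B P.innerAct (dualTensorAct A γ[P.left.X])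
              (dualTensorAct_rightAct A γ[P.left.X] P.act P.comm) ≫ h) ≫
                leftEv A (ldual A) Q.left.X) ⊵ᵣ B ≫ Q.act) ≫ γ[Q.left.X] := by
  have h₁ := dualTensorUnit_mul A γ[P.left.X] Q.left (codualTensorUnit B P.innerAct ≫ h ⊵ᵣ B ≫
      (middle A Q.left.X B).hom ≫ A ⊴ₗ Q.act)
  have h₂ := codualTensorUnit_leftEv A B P.innerAct (dualTensorAct A γ[P.left.X])
    (dualTensorAct_rightAct A γ[P.left.X] P.act P.comm) h Q.act
  refine Eq.trans ?_ ((h₁.trans (congrArg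
    (fun x => dualTensorUnit A γ[P.left.X] ≫ A ⊴ₗ x ≫ γ[Q.left.X]) h₂.symm)))
  rw [MonoidalRightAction.comp_actionHomLeft, Category.assoc, ← Q.comm]
  simp only [Category.assoc]

end BiTensorUnit

/-! ### Assembly of the bimodule case -/

section BimoduleMain

variable (k : Type u) [Field k]
variable {C : Type u₁} [Category.{v₁} C] [Preadditive C] [Linear k C] [MonoidalCategory C]
  [RigidCategory C]
variable {M : Type u₂} [Category.{v₂} M] [Preadditive M] [Linear k M]
variable [MonoidalLeftAction C M] [LeftActionPreadditive C M] [LeftActionLinear k C M]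
variable [MonoidalRightAction C M] [RightActionPreadditive C M] [RightActionLinear k C M]
  [BimoduleCategory C M]
variable (A B : C) [MonObj A] [MonObj B]

instance : (freeBiMod M A B).Additive where
  map_add := BiMod.hom_ext _ _ ((freeMod M A).map_add)

instance : (freeBiMod M A B).Linear k where
  map_smul f r := BiMod.hom_ext _ _ (Functor.Linear.map_smul (F := freeMod M A) f.hom r)

instance : (BiMod.forgetLeft M A B).Additive where

instance : (BiMod.forgetLeft M A B).Linear k where

instance : (BiMod.forgetLeft M A B).Faithful where
  map_injective h := BiMod.hom_ext _ _ (Mod.hom_ext _ _ (congrArg RightMod.Hom.hom h))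

variable [HasCoequalizers M] [RightActionRightExact C M] {N : M ⥤ M} (S : NakayamaStructure k N)

/-- The comparison map of the composite chain is a double trace. In terms of elements, with dual
bases e_i, e^i for A and f_j, f^j for B, it sends h to p ↦ ∑ e_i (h(e^i ⊗ p ⊗ f^j) f_j). -/
theorem adjComp_biTensor_hom (P Q : BiMod M A B) (h : P.biTensor ⟶ Q.left.X) :
    (adjComp k (biTensorAdj M A B) (biFreeAdj M A B) P Q h).left.hom =
      dualTensorUnit A γ[P.left.X] ≫
        A ⊴ₗ (codualTensorUnit B P.innerAct ≫ h ⊵ᵣ B ≫ Q.act) ≫ γ[Q.left.X] := by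
  have hu : (biTensorAdj M A B).unit.app P = (innerAdj M A B).unit.app P ≫
      (freeBiMod M A B).map ((codualTensorAdj M B).unit.app P.inner) :=
    Adjunction.comp_unit_app _ _ P
  have hc : (biFreeAdj M A B).counit.app Q =
      (freeBiMod M A B).map ((freeRightModAdj M B).counit.app Q.right) ≫
        (freeBiModAdj M A B).counit.app Q :=
    Adjunction.comp_counit_app _ _ Q
  have e : (adjComp k (biTensorAdj M A B) (biFreeAdj M A B) P Q h).left.hom =
      (dualTensorUnit A γ[P.left.X] ≫ A ⊴ₗ codualTensorUnit B P.innerAct) ≫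
        A ⊴ₗ (h ⊵ᵣ B) ≫ A ⊴ₗ Q.act ≫ γ[Q.left.X] :=
    -- Once the composite unit and counit are expanded, the identification holds by definition.
    congrArg₂ (fun x y => (x ≫ (freeRightMod M B ⋙ freeBiMod M A B).map h ≫ y).left.hom) hu hc
  have key (h : codualTensor B P.innerAct ⟶ Q.left.X) :
      (dualTensorUnit A γ[P.left.X] ≫ A ⊴ₗ codualTensorUnit B P.innerAct) ≫
        A ⊴ₗ (h ⊵ᵣ B) ≫ A ⊴ₗ Q.act ≫ γ[Q.left.X] =
      dualTensorUnit A γ[P.left.X] ≫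
        A ⊴ₗ (codualTensorUnit B P.innerAct ≫ h ⊵ᵣ B ≫ Q.act) ≫ γ[Q.left.X] := by
    simp only [Category.assoc, MonoidalLeftAction.actionHomRight_comp]
  exact e.trans (key h)

/-- The morphism `Q ⟶ N ((A^∨ ⊗_A P) ⊗_B ^∨B)` attached to a functional on `Hom(P, Q)`. -/
noncomputable def biCowedge (P : BiMod M A B) (i : Σ Q : BiMod M A B, Module.Dual k (P ⟶ Q)) :
    i.1.left.X ⟶ N.obj P.biTensor :=
  relCowedge (biTensorAdj M A B) (biFreeAdj M A B) S P i.1 i.2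

theorem jointlyEpi_biCowedge (P : BiMod M A B) : JointlyEpi (biCowedge k A B S P) :=
  jointlyEpi_relCowedge (biTensorAdj M A B) (biFreeAdj M A B) S P

theorem biCowedge_natural {P P' : BiMod M A B} (f : P ⟶ P')
    (i : Σ Q : BiMod M A B, Module.Dual k (P ⟶ Q)) :
    biCowedge k A B S P i ≫ (biTensorFunctor A B ⋙ N).map f =
      biCowedge k A B S P' ⟨i.1, i.2 ∘ₗ Linear.leftComp k i.1 f⟩ :=
  relCowedge_natural (biTensorAdj M A B) (biFreeAdj M A B) S f i.1 i.2

/-- B acts only in the inner trace, so the identity of the right module case applies under the trace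
over A. -/
theorem biCowedge_nakayamaRightAct (P : BiMod M A B)
    (i : Σ Q : BiMod M A B, Module.Dual k (P ⟶ Q)) :
    biCowedge k A B S P i ⊵ᵣ B ≫ nakayamaRightAct k S B P.biTensorRightAct =
      i.1.act ≫ biCowedge k A B S P i :=
  cowedge_nakayamaRightAct S _ _ _ fun h => congrArg i.2 (by
    refine BiMod.hom_ext _ _ (Mod.hom_ext _ _ ?_)
    refine (adjComp_biTensor_hom k A B P i.1 _).trans (Eq.trans ?_
      (adjComp_biTensor_hom k A B P i.1 _).symm)
    exact congrArg (fun x => dualTensorUnit A γ[P.left.X] ≫ A ⊴ₗ x ≫ γ[i.1.left.X])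
      (codualTensorUnit_mul B P.innerAct i.1.right h))

variable [LeftActionRightExact C M]

/-- Here the action of A has to cross the inner trace over B, which is the content of
`biTensor_mul`. -/
theorem biCowedge_nakayamaLeftAct (P : BiMod M A B)
    (i : Σ Q : BiMod M A B, Module.Dual k (P ⟶ Q)) :
    A ⊴ₗ biCowedge k A B S P i ≫ nakayamaLeftAct k S A P.biTensorLeftAct =
      γ[i.1.left.X] ≫ biCowedge k A B S P i :=
  cowedge_nakayamaLeftAct S _ _ _ fun h => congrArg i.2 (by
    refine BiMod.hom_ext _ _ (Mod.hom_ext _ _ ?_)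
    refine (adjComp_biTensor_hom k A B P i.1 _).trans (Eq.trans ?_
      (adjComp_biTensor_hom k A B P i.1 _).symm)
    exact biTensor_mul A B P i.1 h)

theorem isBiactionOn_nakayama :
    IsBiactionOn (biTensorFunctor A B ⋙ N)
      (fun P : BiMod M A B => nakayamaLeftAct k S A P.biTensorLeftAct)
      (fun P : BiMod M A B => nakayamaRightAct k S B P.biTensorRightAct) where
  left := IsLeftActionOn.of_jointlyEpi
    (J := fun P : BiMod M A B => Σ Q : BiMod M A B, Module.Dual k (P ⟶ Q))
    (Y := fun _ i => i.1.left) (jointlyEpi_biCowedge k A B S)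
    (biCowedge_nakayamaLeftAct k A B S)
    (fun {P P'} f i => by
      have h := biCowedge_natural k A B S f i
      refine (congrArg (γ[i.1.left.X] ≫ ·) h).trans ?_
      exact (biCowedge_nakayamaLeftAct k A B S P' _).symm.trans
        (congrArg (fun x => A ⊴ₗ x ≫ _) h.symm))
  right := IsRightActionOn.of_jointlyEpi
    (J := fun P : BiMod M A B => Σ Q : BiMod M A B, Module.Dual k (P ⟶ Q))
    (Y := fun _ i => i.1.right) (jointlyEpi_biCowedge k A B S)
    (biCowedge_nakayamaRightAct k A B S)
    (fun {P P'} f i => by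
      have h := biCowedge_natural k A B S f i
      refine (congrArg (i.1.act ≫ ·) h).trans ?_
      exact (biCowedge_nakayamaRightAct k A B S P' _).symm.trans
        (congrArg (fun x => x ⊵ᵣ B ≫ _) h.symm))
  -- The family remains jointly epimorphic under A on the left and then B on the right. On each
  -- member equivariance reduces both orders of acting to the commutation on the bimodule `i.1`.
  comm P := ((jointlyEpi_biCowedge k A B S P).actionLeft A).actionRight B _ _ fun i => by
    have hl := biCowedge_nakayamaLeftAct k A B S P i
    have hr := biCowedge_nakayamaRightAct k A B S P i
    change (A ⊴ₗ biCowedge k A B S P i) ⊵ᵣ B ≫ (middle A (N.obj P.biTensor) B).hom ≫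
      A ⊴ₗ nakayamaRightAct k S B P.biTensorRightAct ≫ nakayamaLeftAct k S A P.biTensorLeftAct =
      (A ⊴ₗ biCowedge k A B S P i) ⊵ᵣ B ≫ nakayamaLeftAct k S A P.biTensorLeftAct ⊵ᵣ B ≫
        nakayamaRightAct k S B P.biTensorRightAct
    rw [reassoc_of% middle_naturality_middle, ← MonoidalLeftAction.actionHomRight_comp_assoc, hr,
      MonoidalLeftAction.actionHomRight_comp_assoc, hl,
      ← MonoidalRightAction.comp_actionHomLeft_assoc, hl,
      MonoidalRightAction.comp_actionHomLeft_assoc, hr, reassoc_of% i.1.comm]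

theorem nakayamaStructure_bi
    (h : IsBiactionOn (biTensorFunctor A B ⋙ N)
      (fun P : BiMod M A B => nakayamaLeftAct k S A P.biTensorLeftAct)
      (fun P : BiMod M A B => nakayamaRightAct k S B P.biTensorRightAct)) :
    Nonempty (NakayamaStructure k h.lift) :=
  NakayamaStructure.nonempty_of_adjunctions (biTensorAdj M A B) (biFreeAdj M A B) S
    (Iso.refl (biTensorFunctor A B ⋙ N))
    (fun P Q ξ => ⟨⟨Mod.Hom.mk' (N := h.left.lift.obj P) (biCowedge k A B S P ⟨Q, ξ⟩)
      (biCowedge_nakayamaLeftAct k A B S P ⟨Q, ξ⟩).symm,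
      (biCowedge_nakayamaRightAct k A B S P ⟨Q, ξ⟩).symm⟩, Category.comp_id _⟩)
    (fun P Z g hg => ⟨⟨Mod.Hom.mk' (M := h.left.lift.obj P) g
      ((jointlyEpi_biCowedge k A B S P).leftAct_hom
        (fun i => biCowedge_nakayamaLeftAct k A B S P i) g fun i => by
          obtain ⟨s, hs⟩ := hg i.1 i.2
          have hs' : γ[i.1.left.X] ≫ s.left.hom = A ⊴ₗ s.left.hom ≫ γ[Z.left.X] :=
            IsModHom.smul_hom
          change s.left.hom = _ at hs
          rw [hs] at hs'
          exact hs'),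
      -- Linearity of `g` on the right is tested on the same cover as on the left.
      (jointlyEpi_biCowedge k A B S P).rightAct_hom
        (fun i => biCowedge_nakayamaRightAct k A B S P i) g fun i => by
          obtain ⟨s, hs⟩ := hg i.1 i.2
          have hs' := s.act_hom
          change s.left.hom = _ at hs
          rw [hs] at hs'
          exact hs'⟩, (Category.id_comp _).symm⟩)

end BimoduleMain

end NakayamaModules

/-! ### The theorem -/

theorem mainTheorem3
    {k : Type u} [Field k] {C : Type u₁} [Category.{v₁} C] [Abelian C] [Linear k C]
    [MonoidalCategory C] [MonoidalPreadditive C] [MonoidalLinear k C] [RigidCategory C]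
    [FiniteAbelian k C] (A B : C) [MonObj A] [MonObj B] :
    (∀ (M : Type u₂) [Category.{v₂} M] [Abelian M] [Linear k M] [FiniteAbelian k M]
      [MonoidalLeftAction C M] [LeftActionPreadditive C M] [LeftActionLinear k C M]
      [LeftActionRightExact C M],
      (∃ N : M ⥤ M, Nonempty (NakayamaStructure k N)) ∧
      ∀ (N : M ⥤ M) (S : NakayamaStructure k N),
        ∃ h : IsLeftActionOn (dualTensorFunctor A ⋙ N)
            (fun P : Mod M A => nakayamaLeftAct k S A (dualTensorAct A γ[P.X])),
          Nonempty (NakayamaStructure k h.lift) ∧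
          ∀ N' : Mod M A ⥤ Mod M A, Nonempty (NakayamaStructure k N') →
            Nonempty (N' ≅ h.lift)) ∧
    (∀ (M : Type u₂) [Category.{v₂} M] [Abelian M] [Linear k M] [FiniteAbelian k M]
      [MonoidalRightAction C M] [RightActionPreadditive C M] [RightActionLinear k C M]
      [RightActionRightExact C M],
      (∃ N : M ⥤ M, Nonempty (NakayamaStructure k N)) ∧
      ∀ (N : M ⥤ M) (S : NakayamaStructure k N),
        ∃ h : IsRightActionOn (codualTensorFunctor B ⋙ N)
            (fun P : RightMod M B => nakayamaRightAct k S B (codualTensorAct B P.act)),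
          Nonempty (NakayamaStructure k h.lift) ∧
          ∀ N' : RightMod M B ⥤ RightMod M B, Nonempty (NakayamaStructure k N') →
            Nonempty (N' ≅ h.lift)) ∧
    (∀ (M : Type u₂) [Category.{v₂} M] [Abelian M] [Linear k M] [FiniteAbelian k M]
      [MonoidalLeftAction C M] [LeftActionPreadditive C M] [LeftActionLinear k C M]
      [LeftActionRightExact C M]
      [MonoidalRightAction C M] [RightActionPreadditive C M] [RightActionLinear k C M]
      [RightActionRightExact C M] [BimoduleCategory C M],
      (∃ N : M ⥤ M, Nonempty (NakayamaStructure k N)) ∧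
      ∀ (N : M ⥤ M) (S : NakayamaStructure k N),
        ∃ h : IsBiactionOn (biTensorFunctor A B ⋙ N)
            (fun P : BiMod M A B => nakayamaLeftAct k S A P.biTensorLeftAct)
            (fun P : BiMod M A B => nakayamaRightAct k S B P.biTensorRightAct),
          Nonempty (NakayamaStructure k h.lift) ∧
          ∀ N' : BiMod M A B ⥤ BiMod M A B, Nonempty (NakayamaStructure k N') →
            Nonempty (N' ≅ h.lift)) := by
  refine ⟨fun M _ _ _ _ _ _ _ _ => ⟨FiniteAbelian.exists_nakayamaStructure k M, fun N S => ?_⟩,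
    fun M _ _ _ _ _ _ _ _ => ⟨FiniteAbelian.exists_nakayamaStructure k M, fun N S => ?_⟩,
    fun M _ _ _ _ _ _ _ _ _ _ _ _ _ =>
      ⟨FiniteAbelian.exists_nakayamaStructure k M, fun N S => ?_⟩⟩
  · have h := isLeftActionOn_nakayama k A S
    obtain ⟨T⟩ := nakayamaStructure_left k A S h
    -- The comparison with any other Nakayama functor is the uniqueness of the coend.
    exact ⟨h, ⟨T⟩, fun N' ⟨T'⟩ => ⟨T'.iso T⟩⟩
  · have h := isRightActionOn_nakayama k B S
    obtain ⟨T⟩ := nakayamaStructure_right k B S h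
    exact ⟨h, ⟨T⟩, fun N' ⟨T'⟩ => ⟨T'.iso T⟩⟩
  · have h := isBiactionOn_nakayama k A B S
    obtain ⟨T⟩ := nakayamaStructure_bi k A B S h
    exact ⟨h, ⟨T⟩, fun N' ⟨T'⟩ => ⟨T'.iso T⟩⟩
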